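/- Let $n\ge 2$ and $d\ge 3$. An \emph{$n$-periodic network $N$ of degree $d$} is a connected simple graph, all of whose vertices have degree $d$, mapped to $\mathbb R^n$ with straight edges of positive length such that the star of each vertex is embedded, together with a lattice $\Lambda\subset\mathbb R^n$ of rank $n$ acting on $N$ by translations, such that the quotient graph $N/\Lambda$ (possibly with loops and multiple edges) is finite. Let $L$ be the length of $N/\Lambda$ and $V$ the volume of $\mathbb R^n/\Lambda$. The network is \emph{balanced} if at each vertex $p$, with neighbours $q_1,\dots,q_d$, we have $\sum_i (p-q_i)/|p-q_i|=0$. It is \emph{irreducible} if its quotient $N/\Lambda$ has the least number of vertices possible for a balanced $n$-periodic network of degree $d$. Let $B_\ell$ be the graph with one vertex and $\ell$ loops, let $D_{\ell,k}$ be the graph with two vertices, each with $\ell$ loops, joined by $k$ edges, and let $D_k=D_{0,k}$. Networks are \emph{similar} if a similarity of $\mathbb R^n$ maps one to the other, together with their lattices. Theorem. Consider irreducible triply periodic networks $N\subset\mathbb R^3$ of degree $d$. 1. For $d=4$ the quotient graph is $D_4$ or $D_{1,2}$. For $d=5$, if $N$ is balanced, the quotient graph is $D_5$ or $D_{1,3}$.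 For $d=6$ the quotient graph is $B_3$. 2. Among the irreducible networks of degree $4,4,5,5,6$ with quotient graph $D_4$, $D_{1,2}$, $D_{1,3}$, $D_5$, $B_3$, respectively, the length quotient $L/V^{1/3}$ attains a minimum, and its values are, respectively, $$(12\sqrt3)^{1/3}\approx 2.75,\qquad 3,\qquad (27\sqrt3)^{1/3}\approx 3.6,\qquad (405/8)^{1/3}\approx 3.7,\qquad 3.$$ 3. For the quotient graphs $D_4$, $D_{1,3}$, $D_5$, $B_3$ the minimizer is unique up to similarity. It is, respectively: the diamond network (the neighbours of each vertex form a regular tetrahedron centred at it); the network of prismatic honeycombs over regular hexagons of edge length $1$ with prism height $3/4$; the network whose edge vectors from one of its vertices are $(\pm\sqrt{15},0,-1)$, $(0,\pm\sqrt{15},-1)$, $(0,0,13/2)$ (so that the neighbours of each vertex form a square pyramid of height $L/3$); and the primitive cubic network. For $D_{1,2}$ the minimizers are, up to similarity, exactly the members $N_t$, $t\in(0,1)$, of the following one-parameter family: the lattice is $\mathbb Z^3$, the vertices are the lattice translates of $p=0$ and $q=te_3$, and the edges are the lattice translates of those from $p$ to $p+e_1$, from $q$ to $q+e_2$, from $p$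 to $q$ and from $p$ to $q-e_3$. Here $N_s$ and $N_t$ are similar if and only if $s=t$ or $s=1-t$. 4. For every $d\ge7$, each irreducible triply periodic network of degree $d$ has $L/V^{1/3}$ strictly larger than all the values in 2, and larger than the values $2.67$ and $2.73$ quoted (as approximations) for the minimizers of degree $3$. -/

import Mathlib

/-!
Periodic networks of fixed degree in Euclidean space, their quotient graphs, length and volume.
-/

/-! ### Finite multigraphs -/

/-- The multigraph with vertex set all of `α`, edge set all of `β`, and end points prescribed
by `ends`. An edge whose ends are `s(x, x)` is a loop. -/
def graphOfEnds {α β : Type} (ends : β → Sym2 α) : Graph α β where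
  vertexSet := Set.univ
  IsLink e x y := ends e = s(x, y)
  edgeSet := Set.univ
  isLink_symm e _ := ⟨fun x y h => by rw [h, Sym2.eq_swap]⟩
  eq_or_eq_of_isLink_of_isLink e x y v w h h' := by
    rw [h, Sym2.eq_iff] at h'
    tauto
  edge_mem_iff_exists_isLink e := by
    refine ⟨fun _ => ?_, fun _ => Set.mem_univ e⟩
    induction h : ends e using Sym2.ind with
    | _ x y => exact ⟨x, y, rfl⟩
  left_mem_of_isLink e x y _ := Set.mem_univ x

/-- Isomorphism of multigraphs. -/
def GraphIso {α β α' β' : Type} (G : Graph α β) (H : Graph α' β') : Prop :=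
  ∃ (f : G.vertexSet ≃ H.vertexSet) (g : G.edgeSet ≃ H.edgeSet),
    ∀ (e : G.edgeSet) (x y : G.vertexSet), G.IsLink e x y ↔ H.IsLink (g e) (f x) (f y)

/-- The bouquet graph `B_ℓ`: one vertex with `ℓ` loops. -/
def bouquet (ℓ : ℕ) : Graph Unit (Fin ℓ) := graphOfEnds fun _ => s((), ())

/-- The double bouquet graph `D_{ℓ,k}`: two vertices with `ℓ` loops each, joined by `k` edges. -/
def doubleBouquet (ℓ k : ℕ) : Graph (Fin 2) (Fin 2 × Fin ℓ ⊕ Fin k) :=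
  graphOfEnds (Sum.elim (fun e => s(e.1, e.1)) fun _ => s(0, 1))

/-- The dipole graph `D_k = D_{0,k}`. -/
abbrev dipole (k : ℕ) : Graph (Fin 2) (Fin 2 × Fin 0 ⊕ Fin k) := doubleBouquet 0 k

/-! ### Periodic networks -/

/-- Two edges of a graph are equivalent if the action of the group on the vertices moves one
to the other. -/
def edgeOrbitRel (Λ : Type) {W : Type} [AddGroup Λ] [AddAction Λ W] (G : SimpleGraph W) :
    Setoid G.edgeSet where
  r e e' := ∃ g : Λ, Sym2.map (fun v => g +ᵥ v) e.1 = e'.1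
  iseqv :=
    { refl := fun e => ⟨0, by simp⟩
      symm := by
        rintro e e' ⟨g, h⟩
        exact ⟨-g, by rw [← h, Sym2.map_map]; simp⟩
      trans := by
        rintro e e' e'' ⟨g, h⟩ ⟨g', h'⟩
        exact ⟨g' + g, by rw [← h', ← h, Sym2.map_map]; simp [add_vadd]⟩ }

/-- An `n`-periodic network of degree `d`, together with the lattice under which it is
considered to be periodic: a connected simple graph, all of whose vertices have degree `d`,
immersed with straight edges of positive length into Euclidean `n`-space (the star of each vertex
is embedded), invariant under translation by a lattice of rank `n`, with finite quotient. -/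
structure PeriodicNetwork (n d : ℕ) where
  two_le : 2 ≤ n
  three_le : 3 ≤ d
  /-- the vertices of the network -/
  Vert : Type
  /-- the underlying simple graph -/
  graph : SimpleGraph Vert
  connected : graph.Connected
  degree_eq : ∀ v, (graph.neighborSet v).ncard = d
  /-- the position of a vertex; the edge between `v` and `w` is mapped to the segment
  from `pos v` to `pos w` -/
  pos : Vert → EuclideanSpace ℝ (Fin n)
  pos_ne : ∀ v w, graph.Adj v w → pos v ≠ pos w
  immersed : ∀ v w w', graph.Adj v w → graph.Adj v w' → w ≠ w' →
    segment ℝ (pos v) (pos w) ∩ segment ℝ (pos v) (pos w') = {pos v}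
  /-- the lattice -/
  lattice : Submodule ℤ (EuclideanSpace ℝ (Fin n))
  [discrete : DiscreteTopology lattice]
  [isZLattice : IsZLattice ℝ lattice]
  /-- the action of the lattice on the network by translations -/
  [action : AddAction lattice Vert]
  pos_vadd : ∀ (g : lattice) (v : Vert), pos (g +ᵥ v) = (g : EuclideanSpace ℝ (Fin n)) + pos v
  adj_vadd : ∀ (g : lattice) (v w : Vert), graph.Adj v w → graph.Adj (g +ᵥ v) (g +ᵥ w)
  finite_vert : Finite (AddAction.orbitRel.Quotient lattice Vert)
  finite_edge : Finite (Quotient (edgeOrbitRel lattice graph))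

namespace PeriodicNetwork

attribute [instance] PeriodicNetwork.discrete PeriodicNetwork.isZLattice PeriodicNetwork.action

variable {n d : ℕ}

/-- The vertices of the quotient `N / Λ`. -/
abbrev QVert (N : PeriodicNetwork n d) : Type := AddAction.orbitRel.Quotient N.lattice N.Vert

/-- The edges of the quotient `N / Λ`. -/
abbrev QEdge (N : PeriodicNetwork n d) : Type := Quotient (edgeOrbitRel N.lattice N.graph)

/-- The projection of the vertices to the quotient. -/
def proj (N : PeriodicNetwork n d) (v : N.Vert) : N.QVert :=
  Quotient.mk (AddAction.orbitRel N.lattice N.Vert) v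

theorem proj_vadd (N : PeriodicNetwork n d) (g : N.lattice) (v : N.Vert) :
    N.proj (g +ᵥ v) = N.proj v :=
  Quotient.sound (s := AddAction.orbitRel N.lattice N.Vert) ⟨g, rfl⟩

/-- The end points of an edge of the quotient. -/
def qEnds (N : PeriodicNetwork n d) : N.QEdge → Sym2 N.QVert :=
  Quotient.lift (fun e : N.graph.edgeSet => Sym2.map N.proj e.1) (by
    rintro e e' ⟨g, h⟩
    rw [← h, Sym2.map_map]
    congr 1
    funext v
    exact (N.proj_vadd g v).symm)

/-- The quotient graph `N / Λ`, possibly with loops and multiple edges. -/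
def quotientGraph (N : PeriodicNetwork n d) : Graph N.QVert N.QEdge := graphOfEnds N.qEnds

/-- The quotient graph of `N` is `Γ`, i.e. `N` covers `Γ`. -/
def HasQuotient (N : PeriodicNetwork n d) {α β : Type} (Γ : Graph α β) : Prop :=
  GraphIso N.quotientGraph Γ

/-- The number of vertices in the quotient. -/
noncomputable def numVertices (N : PeriodicNetwork n d) : ℕ := Nat.card N.QVert

/-- The length of a straight edge with given end points. -/
noncomputable def edgeLength (N : PeriodicNetwork n d) : Sym2 N.Vert → ℝ :=
  Sym2.lift ⟨fun v w => dist (N.pos v) (N.pos w), fun _ _ => dist_comm _ _⟩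

theorem edgeLength_map (N : PeriodicNetwork n d) (g : N.lattice) (e : Sym2 N.Vert) :
    N.edgeLength (Sym2.map (fun v => g +ᵥ v) e) = N.edgeLength e := by
  induction e using Sym2.ind with
  | _ v w => simp [edgeLength, N.pos_vadd]

/-- The length of an edge of the quotient. -/
noncomputable def qEdgeLength (N : PeriodicNetwork n d) : N.QEdge → ℝ :=
  Quotient.lift (fun e : N.graph.edgeSet => N.edgeLength e.1) (by
    rintro e e' ⟨g, h⟩
    rw [← h, N.edgeLength_map])

/-- The length `L` of the quotient network `N / Λ`; a finite sum, as the quotient is finite. -/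
noncomputable def length (N : PeriodicNetwork n d) : ℝ := ∑ᶠ e : N.QEdge, N.qEdgeLength e

/-- The volume `V` of a fundamental domain of the lattice. -/
noncomputable def volume (N : PeriodicNetwork n d) : ℝ := ZLattice.covolume N.lattice

/-- The scaling invariant quotient `L / V^{1/n}`. -/
noncomputable def lengthQuotient (N : PeriodicNetwork n d) : ℝ :=
  N.length / N.volume ^ (1 / (n : ℝ))

/-- The total force exerted at `v` by the incident edges; a finite sum, as the degree is `d`. -/
noncomputable def force (N : PeriodicNetwork n d) (v : N.Vert) : EuclideanSpace ℝ (Fin n) :=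
  ∑ᶠ w : N.graph.neighborSet v, ‖N.pos v - N.pos w‖⁻¹ • (N.pos v - N.pos w)

/-- A network is balanced if the force vanishes at each vertex. -/
def Balanced (N : PeriodicNetwork n d) : Prop := ∀ v, N.force v = 0

/-- A network is irreducible if its quotient has the least number of vertices
possible for a balanced network of the same degree in the same dimension. -/
def Irreducible (N : PeriodicNetwork n d) : Prop :=
  IsLeast {m | ∃ M : PeriodicNetwork n d, M.Balanced ∧ M.numVertices = m} N.numVertices

/-- Among the irreducible networks with quotient graph `Γ`, the network `N` minimizes
the length quotient. -/
def IsMinimizer (N : PeriodicNetwork n d) {α β : Type} (Γ : Graph α β) : Prop :=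
  N.Irreducible ∧ N.HasQuotient Γ ∧
    ∀ M : PeriodicNetwork n d, M.Irreducible → M.HasQuotient Γ →
      N.lengthQuotient ≤ M.lengthQuotient

/-- Two networks are similar if a similarity `x ↦ r A x + b` of Euclidean space maps one onto
the other, as networks and together with their lattices. -/
def Similar (N M : PeriodicNetwork n d) : Prop :=
  ∃ (r : ℝ) (A : EuclideanSpace ℝ (Fin n) ≃ₗᵢ[ℝ] EuclideanSpace ℝ (Fin n))
    (b : EuclideanSpace ℝ (Fin n)) (φ : N.graph ≃g M.graph) (ψ : N.lattice ≃+ M.lattice),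
    0 < r ∧ (∀ v, M.pos (φ v) = r • A (N.pos v) + b) ∧
    (∀ g, (ψ g : EuclideanSpace ℝ (Fin n)) = r • A g) ∧
    ∀ (g : N.lattice) (v : N.Vert), φ (g +ᵥ v) = ψ g +ᵥ φ v

/-- The vectors `y i` are the edge vectors from some vertex `p` to translates of `p`.
If the quotient of `N` is `B_ℓ` and the `y i` are distinct up to sign, these are all the edges of
`N` up to translation. -/
def HasLoopVectors (N : PeriodicNetwork n d) {ℓ : ℕ}
    (y : Fin ℓ → EuclideanSpace ℝ (Fin n)) : Prop :=
  ∃ p : N.Vert, ∀ i, ∃ g : N.lattice, (g : EuclideanSpace ℝ (Fin n)) = y i ∧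
    N.graph.Adj p (g +ᵥ p)

/-- There are vertices `p`, `q`, inequivalent under the lattice, such that the vectors `y i`
are edge vectors from `p` to translates of `p`, the `z i` are edge vectors from `q` to
translates of `q`, and the `x j` are edge vectors from `p` to translates of `q`.
If the quotient of `N` is `D_{ℓ,k}`, the `y i` as well as the `z i` are distinct up to sign, and the
`x j` are distinct, then these are all the edges of `N` up to translation. -/
def HasEdgeVectors (N : PeriodicNetwork n d) {ℓ k : ℕ}
    (y z : Fin ℓ → EuclideanSpace ℝ (Fin n)) (x : Fin k → EuclideanSpace ℝ (Fin n)) : Prop :=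
  ∃ p q : N.Vert, N.proj p ≠ N.proj q ∧
    (∀ i, ∃ g : N.lattice, (g : EuclideanSpace ℝ (Fin n)) = y i ∧ N.graph.Adj p (g +ᵥ p)) ∧
    (∀ i, ∃ g : N.lattice, (g : EuclideanSpace ℝ (Fin n)) = z i ∧ N.graph.Adj q (g +ᵥ q)) ∧
    ∀ j, ∃ g : N.lattice, N.pos (g +ᵥ q) - N.pos p = x j ∧ N.graph.Adj p (g +ᵥ q)

/-- The diamond network `dia`: the neighbours of each vertex form a regular tetrahedron. -/
def IsDia (N : PeriodicNetwork 3 4) : Prop :=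
  N.HasQuotient (dipole 4) ∧
    N.HasEdgeVectors ![] ![] ![!₂[1, 1, 1], !₂[1, -1, -1], !₂[-1, 1, -1], !₂[-1, -1, 1]]

/-- The network `cds` with parameter `t`: the lattice is `ℤ³`, one vertex is moved along an edge. -/
def IsCds (t : ℝ) (N : PeriodicNetwork 3 4) : Prop :=
  N.HasQuotient (doubleBouquet 1 2) ∧
    N.HasEdgeVectors ![!₂[1, 0, 0]] ![!₂[0, 1, 0]] ![!₂[0, 0, t], !₂[0, 0, t - 1]]

/-- The network `bnn`: prismatic honeycombs over regular hexagons of edge length `1`,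
of prism height `3 / 4`. -/
def IsBnn (N : PeriodicNetwork 3 5) : Prop :=
  N.HasQuotient (doubleBouquet 1 3) ∧
    N.HasEdgeVectors ![!₂[0, 0, 3 / 4]] ![!₂[0, 0, 3 / 4]]
      ![!₂[1, 0, 0], !₂[-(1 / 2), √3 / 2, 0], !₂[-(1 / 2), -(√3 / 2), 0]]

/-- The network `sqp`: the neighbours of each vertex form a square pyramid whose height is one
third of the length of the quotient. -/
def IsSqp (N : PeriodicNetwork 3 5) : Prop :=
  N.HasQuotient (dipole 5) ∧
    N.HasEdgeVectors ![] ![] ![!₂[√15, 0, -1], !₂[-√15, 0, -1], !₂[0, √15, -1],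
      !₂[0, -√15, -1], !₂[0, 0, 13 / 2]]

/-- The primitive cubic network `pcu`. -/
def IsPcu (N : PeriodicNetwork 3 6) : Prop :=
  N.HasQuotient (bouquet 3) ∧
    N.HasLoopVectors ![!₂[1, 0, 0], !₂[0, 1, 0], !₂[0, 0, 1]]

end PeriodicNetwork

/-! A network with one or two vertices modulo its lattice is encoded by the vectors of its quotient
edges: loops at each vertex, and links between the two vertices. Connectedness says exactly that the
loop vectors and the differences of link vectors generate the lattice. Coordinates in a lattice
basis are integers, so every determinant of three lattice vectors is an integer multiple of the
covolume `V` (`DetIntegral`), and a nonzero one has absolute value at least `V`. Each value of the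
theorem therefore amounts to an upper bound for a determinant in terms of edge lengths, together
with its case of equality.

The bounds come from Hadamard's inequality. For `B_3` and `D_{1,2}` it suffices to combine it with
the triangle inequality and the arithmetic-geometric mean. For `D_4`, a row of ones is added to the
four link vectors, so that the determinant becomes that of their differences, and each column is
divided by the square root of the length of its vector. The squared lengths of the three coordinate
rows then add up to the total length, and Maclaurin's inequality for the lengths finishes
(`det3_sub_sq_le`). For `D_5` the matrix has five columns. It is completed to a square by a row made
of its own minors (`sum_mul_affMinor_sq_le`). The minors are integers times `V` and form an affine
dependence of five distinct points, which leads to a polynomial inequality with integer weights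
(`weighted_minor_bound`). For `D_{1,3}` a weighted bound is applied to the prism over the triangle
of links along each loop, and the two bounds are added. A loop parallel to the plane of the triangle
needs a separate, strict estimate (`degenerate_loop_bound`).

Equality in Hadamard's inequality makes the rows orthogonal, hence after normalization also the
columns. This determines the Gram matrix of the edge vectors, and proportional Gram matrices give
similar networks (`exists_isometry_of_gram`, `similar_of_edgeVec`). Only for `D_{1,2}` does a
freedom remain, namely the position of one vertex on a segment.

A quotient with one vertex has loops spanning space, so its degree is even and at least 6. Explicit
balanced models show that two vertices suffice in all other degrees from 4 on, so irreducibility is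
a condition on the number of vertices. In degree at least 7 there is either a spare lattice vector
besides a basis, which gives `L ^ 3 ≥ 54 * V`, or a sixth link beyond the extremal five; both beat
`405 / 8`, the largest of the listed cubes. -/

open scoped RealInnerProductSpace

/-! ### Hadamard's inequality -/

/-- The determinant is the volume form evaluated at the rows. The squared form keeps square roots
out of the later algebra. -/
theorem Matrix.det_sq_le_prod_sum_sq {n : ℕ} (M : Matrix (Fin n) (Fin n) ℝ) :
    M.det ^ 2 ≤ ∏ i, ∑ j, M i j ^ 2 := by
  let b := EuclideanSpace.basisFun (Fin n) ℝ
  have : Fact (Module.finrank ℝ (EuclideanSpace ℝ (Fin n)) = n) := ⟨by simp⟩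
  let v : Fin n → EuclideanSpace ℝ (Fin n) := fun i => WithLp.toLp 2 (M i)
  have h := b.toBasis.orientation.abs_volumeForm_apply_le v
  rw [Orientation.volumeForm_robust _ b rfl] at h
  have hd : b.toBasis.det v = M.det := by
    rw [Module.Basis.det_apply, ← Matrix.det_transpose]
    congr 1
  rw [hd] at h
  calc M.det ^ 2 = |M.det| ^ 2 := (sq_abs _).symm
    _ ≤ (∏ i, ‖v i‖) ^ 2 := by gcongr
    _ = ∏ i, ∑ j, M i j ^ 2 := by
      rw [← Finset.prod_pow]
      refine Finset.prod_congr rfl fun i _ => ?_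
      rw [EuclideanSpace.norm_sq_eq]
      simp [v]

/-- If rows `i` and `j` were not orthogonal, subtracting from row `j` its projection to row `i`
would keep the determinant but strictly decrease the product of lengths, against Hadamard's
inequality. -/
theorem Matrix.sum_mul_eq_zero_of_det_sq_eq {n : ℕ} {M : Matrix (Fin n) (Fin n) ℝ}
    (hM : M.det ≠ 0) (h : M.det ^ 2 = ∏ i, ∑ j, M i j ^ 2) {i j : Fin n} (hij : i ≠ j) :
    ∑ k, M i k * M j k = 0 := by
  by_contra hs
  set s := ∑ k, M i k * M j k with hsdef
  have hpos : ∀ a, 0 < ∑ k, M a k ^ 2 := by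
    intro a
    have h0 : 0 ≤ ∑ k, M a k ^ 2 := Finset.sum_nonneg fun k _ => sq_nonneg _
    refine lt_of_le_of_ne h0 fun h1 => ?_
    have : ∏ i, ∑ j, M i j ^ 2 = 0 := Finset.prod_eq_zero (Finset.mem_univ a) h1.symm
    rw [this] at h
    exact hM (by simpa using h)
  set q := ∑ k, M i k ^ 2 with hq
  have hqp : 0 < q := hpos i
  let N := M.updateRow j (M j + (-(s / q)) • M i)
  have hN : N.det = M.det := Matrix.det_updateRow_add_smul_self M hij.symm _
  have hle := N.det_sq_le_prod_sum_sq
  rw [hN, h, ← Finset.mul_prod_erase _ _ (Finset.mem_univ j),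
    ← Finset.mul_prod_erase _ (fun i => ∑ j, N i j ^ 2) (Finset.mem_univ j)] at hle
  have hrest : ∏ x ∈ Finset.univ.erase j, ∑ k, N x k ^ 2
      = ∏ x ∈ Finset.univ.erase j, ∑ k, M x k ^ 2 := by
    refine Finset.prod_congr rfl fun x hx => ?_
    simp [N, Matrix.updateRow_ne (Finset.ne_of_mem_erase hx)]
  have hrp : 0 < ∏ x ∈ Finset.univ.erase j, ∑ k, M x k ^ 2 := Finset.prod_pos fun x _ => hpos x
  rw [hrest] at hle
  have hle' := le_of_mul_le_mul_right hle hrp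
  have hNj : ∑ k, N j k ^ 2 = ∑ k, M j k ^ 2 - s ^ 2 / q := by
    have : ∀ k, N j k ^ 2 = M j k ^ 2 - 2 * (s / q) * (M i k * M j k) + (s / q) ^ 2 * M i k ^ 2 := by
      intro k
      simp only [N, Matrix.updateRow_self, Pi.add_apply, Pi.smul_apply, smul_eq_mul]
      ring
    simp_rw [this]
    rw [Finset.sum_add_distrib, Finset.sum_sub_distrib, ← Finset.mul_sum, ← Finset.mul_sum,
      ← hsdef, ← hq]
    field_simp
    ring
  rw [hNj] at hle'
  have : 0 < s ^ 2 / q := by positivity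
  linarith

/-- In case of equality in Hadamard's inequality, the columns satisfy orthogonality relations. -/
theorem Matrix.sum_div_eq_of_det_sq_eq {n : ℕ} {M : Matrix (Fin n) (Fin n) ℝ}
    (hM : M.det ≠ 0) (h : M.det ^ 2 = ∏ i, ∑ j, M i j ^ 2) (i j : Fin n) :
    ∑ a, M a i * M a j / (∑ k, M a k ^ 2) = if i = j then 1 else 0 := by
  have hpos : ∀ a, (∑ k, M a k ^ 2) ≠ 0 := by
    intro a h1
    have : ∏ i, ∑ j, M i j ^ 2 = 0 := Finset.prod_eq_zero (Finset.mem_univ a) h1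
    rw [this] at h
    exact hM (by simpa using h)
  -- Orthogonality of the rows says that this rescaled transpose is a right inverse. A right inverse
  -- of a square matrix is also a left inverse, and that relation concerns the columns.
  let W : Matrix (Fin n) (Fin n) ℝ := Matrix.of fun j a => M a j / (∑ k, M a k ^ 2)
  have h1 : M * W = 1 := by
    ext a b
    rw [Matrix.mul_apply, Matrix.one_apply]
    have : ∑ j, M a j * W j b = (∑ j, M a j * M b j) / (∑ k, M b k ^ 2) := by
      rw [Finset.sum_div]
      exact Finset.sum_congr rfl fun j _ => by simp [W, mul_div_assoc]
    rw [this]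
    split_ifs with hab
    · subst hab
      simp_rw [← sq]
      exact div_self (hpos a)
    · rw [Matrix.sum_mul_eq_zero_of_det_sq_eq hM h hab, zero_div]
  have h2 : W * M = 1 := mul_eq_one_comm.1 h1
  have h3 := congrFun (congrFun h2 j) i
  rw [Matrix.mul_apply, Matrix.one_apply] at h3
  rw [show (if i = j then (1 : ℝ) else 0) = if j = i then 1 else 0 by simp [eq_comm], ← h3]
  exact Finset.sum_congr rfl fun a _ => by simp only [W, Matrix.of_apply]; ring

/-! ### The arithmetic-geometric mean inequality for three numbers -/

theorem mul_mul_le_cube {a b c : ℝ} (ha : 0 ≤ a) (hb : 0 ≤ b) (hc : 0 ≤ c) :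
    27 * (a * b * c) ≤ (a + b + c) ^ 3 := by
  nlinarith [mul_nonneg ha (sq_nonneg (b - c)), mul_nonneg hb (sq_nonneg (a - c)),
    mul_nonneg hc (sq_nonneg (a - b)), mul_nonneg ha (sq_nonneg (a - b)),
    mul_nonneg ha (sq_nonneg (a - c)), mul_nonneg hb (sq_nonneg (b - a)),
    mul_nonneg hb (sq_nonneg (b - c)), mul_nonneg hc (sq_nonneg (c - a)),
    mul_nonneg hc (sq_nonneg (c - b))]

theorem eq_of_mul_mul_eq_cube {a b c : ℝ} (ha : 0 < a) (hb : 0 < b) (hc : 0 < c)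
    (h : 27 * (a * b * c) = (a + b + c) ^ 3) : a = b ∧ b = c := by
  -- The defect is a combination of squares with positive coefficients, so in the case of equality
  -- each square vanishes.
  have key : (a + b + c) ^ 3 - 27 * (a * b * c)
      = (a + b + c) / 2 * ((a - b) ^ 2 + (b - c) ^ 2 + (c - a) ^ 2) + 3 * a * (b - c) ^ 2
        + 3 * b * (a - c) ^ 2 + 3 * c * (a - b) ^ 2 := by ring
  rw [h, sub_self] at key
  have h1 : 3 * c * (a - b) ^ 2 ≤ 0 := by
    have : 0 ≤ (a + b + c) / 2 * ((a - b) ^ 2 + (b - c) ^ 2 + (c - a) ^ 2) + 3 * a * (b - c) ^ 2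
        + 3 * b * (a - c) ^ 2 := by positivity
    linarith
  have h2 : 3 * a * (b - c) ^ 2 ≤ 0 := by
    have : 0 ≤ (a + b + c) / 2 * ((a - b) ^ 2 + (b - c) ^ 2 + (c - a) ^ 2)
        + 3 * b * (a - c) ^ 2 + 3 * c * (a - b) ^ 2 := by positivity
    linarith
  constructor
  · have : (a - b) ^ 2 = 0 := by nlinarith [sq_nonneg (a - b)]
    nlinarith [pow_eq_zero_iff (two_ne_zero) |>.1 this]
  · have : (b - c) ^ 2 = 0 := by nlinarith [sq_nonneg (b - c)]
    nlinarith [pow_eq_zero_iff (two_ne_zero) |>.1 this]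

/-! ### Determinants in Euclidean three-space -/

/-- Euclidean three-space. -/
abbrev E3 := EuclideanSpace ℝ (Fin 3)

/-- The determinant of three vectors in Euclidean three-space. -/
def det3 (a b c : E3) : ℝ :=
  a 0 * (b 1 * c 2 - b 2 * c 1) - a 1 * (b 0 * c 2 - b 2 * c 0) + a 2 * (b 0 * c 1 - b 1 * c 0)

theorem inner_E3 (a b : E3) : ⟪a, b⟫ = a 0 * b 0 + a 1 * b 1 + a 2 * b 2 := by
  simp [PiLp.inner_apply, Fin.sum_univ_three]
  ring

theorem norm_sq_E3 (a : E3) : ‖a‖ ^ 2 = a 0 ^ 2 + a 1 ^ 2 + a 2 ^ 2 := by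
  rw [EuclideanSpace.norm_sq_eq, Fin.sum_univ_three]
  simp

theorem ext_E3 {a b : E3} (h0 : a 0 = b 0) (h1 : a 1 = b 1) (h2 : a 2 = b 2) : a = b := by
  ext i
  fin_cases i <;> assumption

theorem det3_sq_le (a b c : E3) : det3 a b c ^ 2 ≤ (‖a‖ * ‖b‖ * ‖c‖) ^ 2 := by
  have := Matrix.det_sq_le_prod_sum_sq !![a 0, a 1, a 2; b 0, b 1, b 2; c 0, c 1, c 2]
  simp only [Matrix.det_fin_three, Fin.prod_univ_three, Fin.sum_univ_three] at this
  simp at this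
  rw [mul_pow, mul_pow, norm_sq_E3, norm_sq_E3, norm_sq_E3]
  refine le_trans (le_of_eq ?_) this
  simp only [det3]
  ring

theorem abs_det3_le (a b c : E3) : |det3 a b c| ≤ ‖a‖ * ‖b‖ * ‖c‖ :=
  abs_le_of_sq_le_sq' (det3_sq_le a b c) (by positivity) |> abs_le.2

theorem inner_eq_zero_of_abs_det3_eq {a b c : E3} (hd : det3 a b c ≠ 0)
    (h : |det3 a b c| = ‖a‖ * ‖b‖ * ‖c‖) : ⟪a, b⟫ = 0 ∧ ⟪b, c⟫ = 0 ∧ ⟪a, c⟫ = 0 := by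
  let M : Matrix (Fin 3) (Fin 3) ℝ := !![a 0, a 1, a 2; b 0, b 1, b 2; c 0, c 1, c 2]
  have hM : M.det = det3 a b c := by
    simp only [M, Matrix.det_fin_three, det3]
    simp
    ring
  have h2 : M.det ^ 2 = ∏ i, ∑ j, M i j ^ 2 := by
    rw [hM, ← sq_abs, h, mul_pow, mul_pow, norm_sq_E3, norm_sq_E3, norm_sq_E3]
    simp [M, Fin.prod_univ_three, Fin.sum_univ_three]
  have hM' : M.det ≠ 0 := hM ▸ hd
  refine ⟨?_, ?_, ?_⟩
  · simpa [M, Fin.sum_univ_three, inner_E3] using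
      Matrix.sum_mul_eq_zero_of_det_sq_eq hM' h2 (i := 0) (j := 1) (by decide)
  · simpa [M, Fin.sum_univ_three, inner_E3] using
      Matrix.sum_mul_eq_zero_of_det_sq_eq hM' h2 (i := 1) (j := 2) (by decide)
  · simpa [M, Fin.sum_univ_three, inner_E3] using
      Matrix.sum_mul_eq_zero_of_det_sq_eq hM' h2 (i := 0) (j := 2) (by decide)

/-- Cramer's rule. -/
theorem det3_smul_eq (a b c v : E3) : det3 a b c • v =
    det3 v b c • a + det3 a v c • b + det3 a b v • c := by
  apply ext_E3 <;> simp [det3] <;> ring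

/-- The determinant as a linear function of its last argument. -/
def det3Lin (a b : E3) : E3 →ₗ[ℝ] ℝ where
  toFun := det3 a b
  map_add' c c' := by simp [det3]; ring
  map_smul' r c := by simp [det3]; ring

theorem det3_swap (a b c : E3) : det3 b a c = -det3 a b c := by simp only [det3]; ring
theorem det3_rotate (a b c : E3) : det3 b c a = det3 a b c := by simp only [det3]; ring

/-- A linear functional that vanishes on a spanning set is zero, whereas `det3Lin a b` does not
vanish at `c`. -/
theorem exists_det3_ne_zero_of_span {a b c : E3} (h : det3 a b c ≠ 0) {S : Set E3}
    (hS : Submodule.span ℝ S = ⊤) : ∃ v ∈ S, det3 a b v ≠ 0 := by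
  by_contra! hc
  have h0 : det3Lin a b = 0 := LinearMap.ext_on hS fun v hv => hc v hv
  exact h (congrArg (fun f => f c) h0)

/-- The vectors of the standard basis are exchanged one at a time for elements of `S`; the rotations
bring the vector to be exchanged into the last place. -/
theorem exists_det3_ne_zero_triple {S : Set E3} (hS : Submodule.span ℝ S = ⊤) :
    ∃ a ∈ S, ∃ b ∈ S, ∃ c ∈ S, det3 a b c ≠ 0 := by
  have h1 : det3 !₂[1, 0, 0] !₂[0, 1, 0] !₂[0, 0, 1] ≠ 0 := by simp [det3]
  obtain ⟨c, hc, h2⟩ := exists_det3_ne_zero_of_span h1 hS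
  rw [← det3_rotate, ← det3_rotate] at h2
  obtain ⟨b, hb, h3⟩ := exists_det3_ne_zero_of_span h2 hS
  rw [← det3_rotate, ← det3_rotate] at h3
  obtain ⟨a, ha, h4⟩ := exists_det3_ne_zero_of_span h3 hS
  rw [← det3_rotate, ← det3_rotate] at h4
  exact ⟨a, ha, b, hb, c, hc, h4⟩

/-- Two linearly independent vectors are completed to a basis by some vector. -/
theorem exists_det3_ne_zero_of_linearIndependent {a b : E3}
    (h : LinearIndependent ℝ ![a, b]) : ∃ c, det3 a b c ≠ 0 := by
  by_contra! hc
  have h0 := hc !₂[1, 0, 0]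
  have h1 := hc !₂[0, 1, 0]
  have h2 := hc !₂[0, 0, 1]
  simp [det3] at h0 h1 h2
  rw [LinearIndependent.pair_iff] at h
  have e0 := h (b 0) (-a 0) (by apply ext_E3 <;> simp <;> linarith)
  have e1 := h (b 1) (-a 1) (by apply ext_E3 <;> simp <;> linarith)
  have e2 := h (b 2) (-a 2) (by apply ext_E3 <;> simp <;> linarith)
  have ha : a = 0 := by
    apply ext_E3 <;> simp <;> linarith
  have := h 1 0 (by simp [ha])
  simp at this

/-! ### Weighted determinants of point configurations -/

/-- The matrix whose columns are the vectors `w i`, extended by the entries `ε i`. -/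
def affMat {n : ℕ} (w : Fin n → E3) (ε : Fin n → ℝ) : Matrix (Fin 4) (Fin n) ℝ :=
  Matrix.of ![fun i => w i 0, fun i => w i 1, fun i => w i 2, ε]

/-- The columns of `affMat` scaled by the inverse square roots of weights. -/
noncomputable def affMatScaled {n : ℕ} (w : Fin n → E3) (ε ρ : Fin n → ℝ) :
    Matrix (Fin 4) (Fin n) ℝ :=
  Matrix.of fun a i => (√(ρ i))⁻¹ * affMat w ε a i

theorem sum_affMatScaled_sq {n : ℕ} (w : Fin n → E3) (ε ρ : Fin n → ℝ) (hρ : ∀ i, 0 < ρ i)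
    (a : Fin 4) : ∑ i, affMatScaled w ε ρ a i ^ 2 = ∑ i, affMat w ε a i ^ 2 / ρ i := by
  refine Finset.sum_congr rfl fun i _ => ?_
  simp only [affMatScaled, Matrix.of_apply, mul_pow, inv_pow, Real.sq_sqrt (hρ i).le]
  rw [div_eq_inv_mul]

theorem sum_rows_affMat {n : ℕ} (w : Fin n → E3) (ε ρ : Fin n → ℝ) :
    ∑ i, affMat w ε 0 i ^ 2 / ρ i + ∑ i, affMat w ε 1 i ^ 2 / ρ i + ∑ i, affMat w ε 2 i ^ 2 / ρ i
      = ∑ i, ‖w i‖ ^ 2 / ρ i := by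
  rw [← Finset.sum_add_distrib, ← Finset.sum_add_distrib]
  refine Finset.sum_congr rfl fun i _ => ?_
  rw [norm_sq_E3]
  simp [affMat]
  ring

theorem affMat_nonneg {n : ℕ} (w : Fin n → E3) (ε ρ : Fin n → ℝ) (hρ : ∀ i, 0 < ρ i)
    (a : Fin 4) : 0 ≤ ∑ i, affMat w ε a i ^ 2 / ρ i :=
  Finset.sum_nonneg fun i _ => div_nonneg (sq_nonneg _) (hρ i).le

/-- The squared lengths of the three coordinate rows add up to a quantity independent of the
coordinate system, so the arithmetic-geometric mean removes the coordinates from Hadamard's bound.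
-/
theorem prod_rows_affMat_le {n : ℕ} (w : Fin n → E3) (ε ρ : Fin n → ℝ) (hρ : ∀ i, 0 < ρ i) :
    ∏ a, ∑ i, affMatScaled w ε ρ a i ^ 2 ≤
      ((∑ i, ‖w i‖ ^ 2 / ρ i) / 3) ^ 3 * ∑ i, ε i ^ 2 / ρ i := by
  simp_rw [sum_affMatScaled_sq w ε ρ hρ]
  rw [Fin.prod_univ_four]
  have h3 := affMat_nonneg w ε ρ hρ 3
  have : ∑ i, affMat w ε 3 i ^ 2 / ρ i = ∑ i, ε i ^ 2 / ρ i := rfl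
  rw [this] at h3 ⊢
  refine mul_le_mul_of_nonneg_right ?_ h3
  rw [← sum_rows_affMat w ε ρ]
  have := mul_mul_le_cube (affMat_nonneg w ε ρ hρ 0) (affMat_nonneg w ε ρ hρ 1)
    (affMat_nonneg w ε ρ hρ 2)
  rw [div_pow]
  linarith

theorem rows_affMat_eq {n : ℕ} (w : Fin n → E3) (ε ρ : Fin n → ℝ) (hρ : ∀ i, 0 < ρ i)
    (h0 : ∏ a, ∑ i, affMatScaled w ε ρ a i ^ 2 ≠ 0)
    (h : ∏ a, ∑ i, affMatScaled w ε ρ a i ^ 2 =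
      ((∑ i, ‖w i‖ ^ 2 / ρ i) / 3) ^ 3 * ∑ i, ε i ^ 2 / ρ i) :
    ∑ i, affMatScaled w ε ρ 0 i ^ 2 = (∑ i, ‖w i‖ ^ 2 / ρ i) / 3 ∧
    ∑ i, affMatScaled w ε ρ 1 i ^ 2 = (∑ i, ‖w i‖ ^ 2 / ρ i) / 3 ∧
    ∑ i, affMatScaled w ε ρ 2 i ^ 2 = (∑ i, ‖w i‖ ^ 2 / ρ i) / 3 := by
  simp_rw [sum_affMatScaled_sq w ε ρ hρ] at h0 h ⊢
  have hp : ∀ a, 0 < ∑ i, affMat w ε a i ^ 2 / ρ i := fun a =>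
    lt_of_le_of_ne (affMat_nonneg w ε ρ hρ a)
      fun h1 => h0 (Finset.prod_eq_zero (Finset.mem_univ a) h1.symm)
  rw [Fin.prod_univ_four] at h
  have : ∑ i, affMat w ε 3 i ^ 2 / ρ i = ∑ i, ε i ^ 2 / ρ i := rfl
  have h3 := hp 3
  rw [← this, ← sum_rows_affMat w ε ρ] at h
  have h' := mul_right_cancel₀ h3.ne' h
  rw [← sum_rows_affMat w ε ρ]
  obtain ⟨e1, e2⟩ := eq_of_mul_mul_eq_cube (hp 0) (hp 1) (hp 2) (by rw [h']; ring)
  refine ⟨?_, ?_, ?_⟩ <;> linarith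

theorem det_affMatScaled (w : Fin 4 → E3) (ε ρ : Fin 4 → ℝ) :
    (affMatScaled w ε ρ).det = (∏ i, (√(ρ i))⁻¹) * (affMat w ε).det :=
  Matrix.det_mul_row _ _

theorem affMatScaled_mul_affMatScaled {n : ℕ} (w : Fin n → E3) (ε ρ : Fin n → ℝ)
    (a : Fin 4) (i j : Fin n) : affMatScaled w ε ρ a i * affMatScaled w ε ρ a j =
      (√(ρ i) * √(ρ j))⁻¹ * (affMat w ε a i * affMat w ε a j) := by
  simp only [affMatScaled, Matrix.of_apply, mul_inv]
  ring

/-- Hadamard's inequality for the rows of the scaled matrix. The weights are free; with weights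
equal to the norms, the first sum is the total length, and the bound depends on lengths only. -/
theorem det_affMat_sq_le (w : Fin 4 → E3) (ε ρ : Fin 4 → ℝ) (hρ : ∀ i, 0 < ρ i) :
    (affMat w ε).det ^ 2 ≤
      (∏ i, ρ i) * (((∑ i, ‖w i‖ ^ 2 / ρ i) / 3) ^ 3 * ∑ i, ε i ^ 2 / ρ i) := by
  have h := (affMatScaled w ε ρ).det_sq_le_prod_sum_sq.trans (prod_rows_affMat_le w ε ρ hρ)
  have hP : 0 < ∏ i, ρ i := Finset.prod_pos fun i _ => hρ i
  rw [det_affMatScaled, mul_pow, Finset.prod_inv_distrib, inv_pow, ← Finset.prod_pow] at h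
  simp_rw [Real.sq_sqrt (hρ _).le] at h
  rwa [inv_mul_le_iff₀ hP] at h

/-- Equality holds both in Hadamard's inequality and in the mean inequality. Hence the rows are
orthogonal, the coordinate rows have the same length, and the relations between the columns give all
inner products: an extremal configuration is determined up to isometry. -/
theorem inner_eq_of_det_affMat_sq_eq (w : Fin 4 → E3) (ε ρ : Fin 4 → ℝ) (hρ : ∀ i, 0 < ρ i)
    (hd : (affMat w ε).det ≠ 0)
    (h : (affMat w ε).det ^ 2 =
      (∏ i, ρ i) * (((∑ i, ‖w i‖ ^ 2 / ρ i) / 3) ^ 3 * ∑ i, ε i ^ 2 / ρ i)) (i j : Fin 4) :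
    ⟪w i, w j⟫ / ((∑ i, ‖w i‖ ^ 2 / ρ i) / 3) + ε i * ε j / (∑ i, ε i ^ 2 / ρ i) =
      if i = j then ρ i else 0 := by
  have hP : 0 < ∏ i, ρ i := Finset.prod_pos fun i _ => hρ i
  have hPs : (∏ i, (√(ρ i))⁻¹) ^ 2 = (∏ i, ρ i)⁻¹ := by
    rw [Finset.prod_inv_distrib, inv_pow, ← Finset.prod_pow]
    simp_rw [Real.sq_sqrt (hρ _).le]
  have hdn : (affMatScaled w ε ρ).det ≠ 0 := by
    rw [det_affMatScaled]
    refine mul_ne_zero (Finset.prod_ne_zero_iff.2 fun i _ => ?_) hd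
    exact inv_ne_zero (Real.sqrt_pos.2 (hρ i)).ne'
  have hsq : (affMatScaled w ε ρ).det ^ 2 =
      ((∑ i, ‖w i‖ ^ 2 / ρ i) / 3) ^ 3 * ∑ i, ε i ^ 2 / ρ i := by
    rw [det_affMatScaled, mul_pow, hPs, h, ← mul_assoc, inv_mul_cancel₀ hP.ne', one_mul]
  have hle := (affMatScaled w ε ρ).det_sq_le_prod_sum_sq
  have hle2 := prod_rows_affMat_le w ε ρ hρ
  have heq : (affMatScaled w ε ρ).det ^ 2 = ∏ a, ∑ i, affMatScaled w ε ρ a i ^ 2 :=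
    le_antisymm hle (hsq ▸ hle2)
  have hne : ∏ a, ∑ i, affMatScaled w ε ρ a i ^ 2 ≠ 0 := heq ▸ pow_ne_zero 2 hdn
  obtain ⟨e0, e1, e2⟩ := rows_affMat_eq w ε ρ hρ hne (heq ▸ hsq)
  have key := Matrix.sum_div_eq_of_det_sq_eq hdn heq i j
  rw [Fin.sum_univ_four, e0, e1, e2] at key
  have e3 : ∑ i, affMatScaled w ε ρ 3 i ^ 2 = ∑ i, ε i ^ 2 / ρ i :=
    sum_affMatScaled_sq w ε ρ hρ 3
  rw [e3] at key
  simp_rw [affMatScaled_mul_affMatScaled] at key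
  have hi := Real.sqrt_pos.2 (hρ i)
  have hj := Real.sqrt_pos.2 (hρ j)
  have : ⟪w i, w j⟫ / ((∑ i, ‖w i‖ ^ 2 / ρ i) / 3) + ε i * ε j / (∑ i, ε i ^ 2 / ρ i) =
      (√(ρ i) * √(ρ j)) * (if i = j then 1 else 0) := by
    rw [← key, inner_E3]
    simp only [affMat, Matrix.of_apply, Matrix.cons_val]
    field_simp
  rw [this]
  split_ifs with hij
  · subst hij
    rw [mul_one, Real.mul_self_sqrt (hρ i).le]
  · rw [mul_zero]

/-- The maximal minors of `affMat` for five columns, with alternating signs. -/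
def affMinor (w : Fin 5 → E3) (ε : Fin 5 → ℝ) (i : Fin 5) : ℝ :=
  (-1) ^ (i : ℕ) * (affMat (fun j => w (i.succAbove j)) fun j => ε (i.succAbove j)).det

/-- The matrix `affMatScaled`, extended by its own minors to a square matrix. -/
noncomputable def affMatExt (w : Fin 5 → E3) (ε ρ : Fin 5 → ℝ) : Matrix (Fin 5) (Fin 5) ℝ :=
  Matrix.of (Fin.cons (fun i => √(ρ i) * affMinor w ε i) (affMatScaled w ε ρ))

/-- Expansion along the added row multiplies each minor by itself. The minor belonging to `i` lacks
the factor `(√(ρ i))⁻¹`, which is why the added entry carries `√(ρ i)`. -/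
theorem det_affMatExt (w : Fin 5 → E3) (ε ρ : Fin 5 → ℝ) (hρ : ∀ i, 0 < ρ i) :
    (affMatExt w ε ρ).det = (∏ i, (√(ρ i))⁻¹) * ∑ i, ρ i * affMinor w ε i ^ 2 := by
  rw [Matrix.det_succ_row_zero, Finset.mul_sum]
  refine Finset.sum_congr rfl fun i _ => ?_
  have h1 : (affMatExt w ε ρ).submatrix Fin.succ i.succAbove =
      affMatScaled (fun j => w (i.succAbove j)) (fun j => ε (i.succAbove j))
        (fun j => ρ (i.succAbove j)) := by
    ext a j
    fin_cases a <;> rfl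
  have hi := Real.sqrt_pos.2 (hρ i)
  have h2 : affMatExt w ε ρ 0 i = √(ρ i) * affMinor w ε i := rfl
  rw [h1, det_affMatScaled, h2, Fin.prod_univ_succAbove _ i, affMinor]
  have h3 : ρ i = √(ρ i) * √(ρ i) := (Real.mul_self_sqrt (hρ i).le).symm
  generalize (affMat (fun j => w (i.succAbove j)) fun j => ε (i.succAbove j)).det = d
  generalize ∏ j, (√(ρ (i.succAbove j)))⁻¹ = p
  calc _ = √(ρ i) * ((-1) ^ (i : ℕ)) ^ 2 * d ^ 2 * p := by ring
    _ = (√(ρ i))⁻¹ * p * (√(ρ i) * √(ρ i) * ((-1) ^ (i : ℕ) * d) ^ 2) := by field_simp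
    _ = _ := by rw [← h3]

theorem sum_affMatExt_zero (w : Fin 5 → E3) (ε ρ : Fin 5 → ℝ) (hρ : ∀ i, 0 < ρ i) :
    ∑ i, affMatExt w ε ρ 0 i ^ 2 = ∑ i, ρ i * affMinor w ε i ^ 2 := by
  refine Finset.sum_congr rfl fun i _ => ?_
  change (√(ρ i) * affMinor w ε i) ^ 2 = _
  rw [mul_pow, Real.sq_sqrt (hρ i).le]

theorem prod_sum_affMatExt (w : Fin 5 → E3) (ε ρ : Fin 5 → ℝ) (hρ : ∀ i, 0 < ρ i) :
    ∏ a, ∑ i, affMatExt w ε ρ a i ^ 2 = (∑ i, ρ i * affMinor w ε i ^ 2) *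
      ∏ a, ∑ i, affMatScaled w ε ρ a i ^ 2 := by
  rw [Fin.prod_univ_succ, sum_affMatExt_zero w ε ρ hρ]
  rfl

/-- The added row has squared length equal to the sum on the left, and the determinant is a multiple
of that same sum. One factor of it cancels in Hadamard's inequality, leaving a bound for the Gram
determinant of the four remaining rows. -/
theorem sum_mul_affMinor_sq_le (w : Fin 5 → E3) (ε ρ : Fin 5 → ℝ) (hρ : ∀ i, 0 < ρ i) :
    ∑ i, ρ i * affMinor w ε i ^ 2 ≤
      (∏ i, ρ i) * (((∑ i, ‖w i‖ ^ 2 / ρ i) / 3) ^ 3 * ∑ i, ε i ^ 2 / ρ i) := by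
  have hP : 0 < ∏ i, ρ i := Finset.prod_pos fun i _ => hρ i
  have hPs : (∏ i, (√(ρ i))⁻¹) ^ 2 = (∏ i, ρ i)⁻¹ := by
    rw [Finset.prod_inv_distrib, inv_pow, ← Finset.prod_pow]
    simp_rw [Real.sq_sqrt (hρ _).le]
  have h := (affMatExt w ε ρ).det_sq_le_prod_sum_sq
  rw [det_affMatExt w ε ρ hρ, prod_sum_affMatExt w ε ρ hρ, mul_pow, hPs] at h
  have h1 := prod_rows_affMat_le w ε ρ hρ
  set B := ∑ i, ρ i * affMinor w ε i ^ 2 with hB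
  have hB0 : 0 ≤ B := Finset.sum_nonneg fun i _ => mul_nonneg (hρ i).le (sq_nonneg _)
  rcases hB0.eq_or_lt with h0 | h0
  · rw [← h0]
    refine mul_nonneg hP.le (le_trans ?_ h1)
    exact Finset.prod_nonneg fun a _ => Finset.sum_nonneg fun i _ => sq_nonneg _
  · rw [inv_mul_le_iff₀ hP, sq, mul_left_comm] at h
    exact (le_of_mul_le_mul_left h h0).trans (mul_le_mul_of_nonneg_left h1 hP.le)

/-- As for four columns, equality makes the extended matrix orthogonal up to scaling of rows. The
added row accounts for the term of rank one in the minors. -/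
theorem inner_eq_of_sum_mul_affMinor_sq_eq (w : Fin 5 → E3) (ε ρ : Fin 5 → ℝ)
    (hρ : ∀ i, 0 < ρ i) (hd : ∑ i, ρ i * affMinor w ε i ^ 2 ≠ 0)
    (h : ∑ i, ρ i * affMinor w ε i ^ 2 =
      (∏ i, ρ i) * (((∑ i, ‖w i‖ ^ 2 / ρ i) / 3) ^ 3 * ∑ i, ε i ^ 2 / ρ i)) (i j : Fin 5) :
    ⟪w i, w j⟫ / ((∑ i, ‖w i‖ ^ 2 / ρ i) / 3) + ε i * ε j / (∑ i, ε i ^ 2 / ρ i) =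
      (if i = j then ρ i else 0) - ρ i * ρ j * (affMinor w ε i * affMinor w ε j) /
        (∑ i, ρ i * affMinor w ε i ^ 2) := by
  have hP : 0 < ∏ i, ρ i := Finset.prod_pos fun i _ => hρ i
  have hPs : (∏ i, (√(ρ i))⁻¹) ^ 2 = (∏ i, ρ i)⁻¹ := by
    rw [Finset.prod_inv_distrib, inv_pow, ← Finset.prod_pow]
    simp_rw [Real.sq_sqrt (hρ _).le]
  have hdn : (affMatExt w ε ρ).det ≠ 0 := by
    rw [det_affMatExt w ε ρ hρ]
    refine mul_ne_zero (Finset.prod_ne_zero_iff.2 fun i _ => ?_) hd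
    exact inv_ne_zero (Real.sqrt_pos.2 (hρ i)).ne'
  have hle := (affMatExt w ε ρ).det_sq_le_prod_sum_sq
  have hle2 := prod_rows_affMat_le w ε ρ hρ
  have hsplit := prod_sum_affMatExt w ε ρ hρ
  have hB : 0 < ∑ i, ρ i * affMinor w ε i ^ 2 :=
    lt_of_le_of_ne (Finset.sum_nonneg fun i _ => mul_nonneg (hρ i).le (sq_nonneg _)) hd.symm
  have hsq : (affMatExt w ε ρ).det ^ 2 = (∑ i, ρ i * affMinor w ε i ^ 2) *
      (((∑ i, ‖w i‖ ^ 2 / ρ i) / 3) ^ 3 * ∑ i, ε i ^ 2 / ρ i) := by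
    rw [det_affMatExt w ε ρ hρ, mul_pow, hPs, sq]
    nth_rewrite 1 [h]
    field_simp
  have heq : (affMatExt w ε ρ).det ^ 2 = ∏ a, ∑ i, affMatExt w ε ρ a i ^ 2 := by
    refine le_antisymm hle ?_
    rw [hsq, hsplit]
    exact mul_le_mul_of_nonneg_left hle2 hB.le
  have heq' : ∏ a, ∑ i, affMatScaled w ε ρ a i ^ 2 =
      ((∑ i, ‖w i‖ ^ 2 / ρ i) / 3) ^ 3 * ∑ i, ε i ^ 2 / ρ i := by
    rw [hsq, hsplit] at heq
    exact (mul_left_cancel₀ hd heq).symm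
  have hne : ∏ a, ∑ i, affMatScaled w ε ρ a i ^ 2 ≠ 0 := by
    intro h0
    rw [hsplit, h0, mul_zero] at heq
    exact hdn (by simpa using heq)
  obtain ⟨e0, e1, e2⟩ := rows_affMat_eq w ε ρ hρ hne heq'
  have key := Matrix.sum_div_eq_of_det_sq_eq hdn heq i j
  have e3 : ∑ i, affMatScaled w ε ρ 3 i ^ 2 = ∑ i, ε i ^ 2 / ρ i :=
    sum_affMatScaled_sq w ε ρ hρ 3
  rw [Fin.sum_univ_succ, sum_affMatExt_zero w ε ρ hρ] at key
  change _ + ∑ a, affMatScaled w ε ρ a i * affMatScaled w ε ρ a j /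
    (∑ k, affMatScaled w ε ρ a k ^ 2) = _ at key
  rw [Fin.sum_univ_four, e0, e1, e2, e3] at key
  simp_rw [affMatScaled_mul_affMatScaled] at key
  change √(ρ i) * affMinor w ε i * (√(ρ j) * affMinor w ε j) / _ + _ = _ at key
  have hi := Real.sqrt_pos.2 (hρ i)
  have hj := Real.sqrt_pos.2 (hρ j)
  have hi2 := Real.mul_self_sqrt (hρ i).le
  have hj2 := Real.mul_self_sqrt (hρ j).le
  have key2 : ρ i * ρ j * (affMinor w ε i * affMinor w ε j) /
        (∑ i, ρ i * affMinor w ε i ^ 2) +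
      (⟪w i, w j⟫ / ((∑ i, ‖w i‖ ^ 2 / ρ i) / 3) + ε i * ε j / (∑ i, ε i ^ 2 / ρ i)) =
      (√(ρ i) * √(ρ j)) * (if i = j then 1 else 0) := by
    rw [← key, inner_E3]
    simp only [affMat, Matrix.of_apply, Matrix.cons_val]
    rw [mul_add]
    congr 1
    · nth_rewrite 1 [← hi2, ← hj2]
      ring
    · field_simp
  have key3 : (√(ρ i) * √(ρ j)) * (if i = j then (1 : ℝ) else 0) = if i = j then ρ i else 0 := by
    split_ifs with hij
    · subst hij
      rw [mul_one, hi2]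
    · rw [mul_zero]
  rw [key3] at key2
  linarith

/-- The minors are the coefficients of an affine dependence. -/
theorem sum_mul_affMinor (w : Fin 5 → E3) (ε : Fin 5 → ℝ) (a : Fin 4) :
    ∑ i, affMat w ε a i * affMinor w ε i = 0 := by
  -- Row `a` occurs twice, so the expansion along its first copy vanishes.
  let N : Matrix (Fin 5) (Fin 5) ℝ := Matrix.of (Fin.cons (affMat w ε a) (affMat w ε))
  have h : N.det = 0 := Matrix.det_zero_of_row_eq (i := 0) (j := a.succ) (Fin.succ_ne_zero a).symm
    (by ext j; rfl)
  rw [Matrix.det_succ_row_zero] at h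
  rw [← h]
  refine Finset.sum_congr rfl fun i _ => ?_
  have h1 : N.submatrix Fin.succ i.succAbove =
      affMat (fun j => w (i.succAbove j)) (fun j => ε (i.succAbove j)) := by
    ext a j
    fin_cases a <;> rfl
  rw [h1, affMinor]
  change _ = (-1) ^ (i : ℕ) * affMat w ε a i * _
  ring

theorem det_affMat_one (w : Fin 4 → E3) :
    (affMat w fun _ => 1).det = det3 (w 0 - w 3) (w 1 - w 3) (w 2 - w 3) := by
  simp [Matrix.det_succ_row_zero, Fin.sum_univ_succ, affMat, det3, Fin.succAbove,
    Matrix.submatrix]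
  ring

/-! ### Symmetric polynomials -/

/-- Maclaurin's inequality for the third elementary symmetric polynomial; the pairing of the
variables exhibits the difference as a sum of nonnegative terms that also settles equality. -/
theorem e3_four_le {a b c d : ℝ} (ha : 0 < a) (hb : 0 < b) (hc : 0 < c) (hd : 0 < d) :
    16 * (a * b * c + a * b * d + a * c * d + b * c * d) ≤ (a + b + c + d) ^ 3 := by
  have key : (a + b + c + d) ^ 3 - 16 * (a * b * c + a * b * d + a * c * d + b * c * d) =
      (a + b + c + d) * (a + b - c - d) ^ 2 + 4 * (c + d) * (a - b) ^ 2
        + 4 * (a + b) * (c - d) ^ 2 := by ring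
  have : 0 ≤ (a + b + c + d) * (a + b - c - d) ^ 2 + 4 * (c + d) * (a - b) ^ 2
        + 4 * (a + b) * (c - d) ^ 2 := by positivity
  linarith

theorem eq_of_e3_four_eq {a b c d : ℝ} (ha : 0 < a) (hb : 0 < b) (hc : 0 < c) (hd : 0 < d)
    (h : 16 * (a * b * c + a * b * d + a * c * d + b * c * d) = (a + b + c + d) ^ 3) :
    a = b ∧ b = c ∧ c = d := by
  have key : (a + b + c + d) ^ 3 - 16 * (a * b * c + a * b * d + a * c * d + b * c * d) =
      (a + b + c + d) * (a + b - c - d) ^ 2 + 4 * (c + d) * (a - b) ^ 2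
        + 4 * (a + b) * (c - d) ^ 2 := by ring
  rw [h, sub_self] at key
  have p1 : 0 ≤ (a + b + c + d) * (a + b - c - d) ^ 2 := by positivity
  have p2 : 0 ≤ 4 * (c + d) * (a - b) ^ 2 := by positivity
  have p3 : 0 ≤ 4 * (a + b) * (c - d) ^ 2 := by positivity
  have q1 : (a + b + c + d) * (a + b - c - d) ^ 2 = 0 := by linarith
  have q2 : 4 * (c + d) * (a - b) ^ 2 = 0 := by linarith
  have q3 : 4 * (a + b) * (c - d) ^ 2 = 0 := by linarith
  have r1 := pow_eq_zero_iff two_ne_zero |>.1 ((mul_eq_zero.1 q1).resolve_left (by positivity))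
  have r2 := pow_eq_zero_iff two_ne_zero |>.1 ((mul_eq_zero.1 q2).resolve_left (by positivity))
  have r3 := pow_eq_zero_iff two_ne_zero |>.1 ((mul_eq_zero.1 q3).resolve_left (by positivity))
  refine ⟨?_, ?_, ?_⟩ <;> linarith

theorem e4_four_le {a b c d : ℝ} (ha : 0 < a) (hb : 0 < b) (hc : 0 < c) (hd : 0 < d) :
    256 * (a * b * c * d) ≤ (a + b + c + d) ^ 4 := by
  have h1 : 4 * (a * b) ≤ (a + b) ^ 2 := by nlinarith [sq_nonneg (a - b)]
  have h2 : 4 * (c * d) ≤ (c + d) ^ 2 := by nlinarith [sq_nonneg (c - d)]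
  have h3 : 4 * ((a + b) * (c + d)) ≤ (a + b + c + d) ^ 2 := by
    nlinarith [sq_nonneg (a + b - c - d)]
  calc 256 * (a * b * c * d) = 16 * ((4 * (a * b)) * (4 * (c * d))) := by ring
    _ ≤ 16 * ((a + b) ^ 2 * (c + d) ^ 2) := by gcongr
    _ = (4 * ((a + b) * (c + d))) ^ 2 := by ring
    _ ≤ ((a + b + c + d) ^ 2) ^ 2 := by gcongr
    _ = _ := by ring

theorem prod_mul_sum_inv_four {r : Fin 4 → ℝ} (hr : ∀ i, 0 < r i) :
    (∏ i, r i) * ∑ i, 1 ^ 2 / r i =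
      r 0 * r 1 * r 2 + r 0 * r 1 * r 3 + r 0 * r 2 * r 3 + r 1 * r 2 * r 3 := by
  have h0 := hr 0
  have h1 := hr 1
  have h2 := hr 2
  have h3 := hr 3
  rw [Fin.prod_univ_four, Fin.sum_univ_four]
  field_simp
  ring

/-- The symmetric case `a = b = A`, `p = q = Q` of `collinear_case`, divided by 16. -/
theorem collinear_case_aux {A Q c : ℝ} (hA : 0 < A) (hQ : 0 < Q) (hc : 0 < c) :
    6075 * (A * Q * (A * Q + 2 * c * (A + Q))) < 128 * ((A + 2 * c) * (2 * (A + Q) + c) ^ 3) := by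
  have h1 : 0 ≤ A * ((2 * A - Q) ^ 2 * (A + 4 * Q)) := by positivity
  have h2 : 0 ≤ c * (A + Q) * (12150 * A ^ 2 - 9974 * A * (A + Q) + 2048 * (A + Q) ^ 2) := by
    have : 0 ≤ 12150 * A ^ 2 - 9974 * A * (A + Q) + 2048 * (A + Q) ^ 2 := by
      nlinarith [sq_nonneg (4987 * A - 2048 * (A + Q)), mul_pos hA hQ, sq_nonneg A]
    positivity
  have h3 : 0 ≤ (A + Q) ^ 2 * (124 * A ^ 2 - 640 * A * c + 3072 * c ^ 2) := by
    have : 0 ≤ 124 * A ^ 2 - 640 * A * c + 3072 * c ^ 2 := by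
      nlinarith [sq_nonneg (160 * A - 1536 * c / 3), sq_nonneg (A - 4 * c), sq_nonneg (A - 5 * c),
        sq_nonneg (A - 6 * c), sq_nonneg c]
    positivity
  have h4 : 0 < 124 * A * Q * (A + Q) ^ 2 + 768 * c ^ 2 * A * (A + Q)
      + 128 * (c ^ 3 * (A + 12 * (A + Q)) + 2 * c ^ 4) := by positivity
  have key : 128 * ((A + 2 * c) * (2 * (A + Q) + c) ^ 3)
      - 6075 * (A * Q * (A * Q + 2 * c * (A + Q))) =
      225 * (A * ((2 * A - Q) ^ 2 * (A + 4 * Q)))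
      + c * (A + Q) * (12150 * A ^ 2 - 9974 * A * (A + Q) + 2048 * (A + Q) ^ 2)
      + (A + Q) ^ 2 * (124 * A ^ 2 - 640 * A * c + 3072 * c ^ 2)
      + (124 * A * Q * (A + Q) ^ 2 + 768 * c ^ 2 * A * (A + Q)
      + 128 * (c ^ 3 * (A + 12 * (A + Q)) + 2 * c ^ 4)) := by ring
  linarith

/-- The bracket on the left is the fourth elementary symmetric polynomial of the five numbers. It
increases with the products `a * b` and `p * q`, while the right side depends only on the sums `a +
b` and `p + q`; so both pairs may be replaced by their means. -/
theorem collinear_case {a b c p q : ℝ} (ha : 0 < a) (hb : 0 < b) (hc : 0 < c) (hp : 0 < p)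
    (hq : 0 < q) :
    97200 * (a * b * p * q + c * (a * p * q + b * p * q + a * b * p + a * b * q)) <
      1024 * ((a + b + 4 * c) * (a + b + c + p + q) ^ 3) := by
  have h := collinear_case_aux (A := (a + b) / 2) (Q := (p + q) / 2) (c := c) (by positivity)
    (by positivity) hc
  have h1 : a * b ≤ ((a + b) / 2) ^ 2 := by nlinarith [sq_nonneg (a - b)]
  have h2 : p * q ≤ ((p + q) / 2) ^ 2 := by nlinarith [sq_nonneg (p - q)]
  have h3 : (a * b) * (p * q) ≤ ((a + b) / 2) ^ 2 * ((p + q) / 2) ^ 2 := by gcongr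
  have h4 : c * (a + b) * (p * q) ≤ c * (a + b) * ((p + q) / 2) ^ 2 := by gcongr
  have h5 : c * (p + q) * (a * b) ≤ c * (p + q) * ((a + b) / 2) ^ 2 := by gcongr
  nlinarith

/-! ### Four vectors -/

/-- The edge vectors of the diamond network. -/
noncomputable def diaVec : Fin 4 → E3 :=
  ![!₂[1, 1, 1], !₂[1, -1, -1], !₂[-1, 1, -1], !₂[-1, -1, 1]]

theorem sum_norm_sq_div_norm {n : ℕ} {x : Fin n → E3} (hx : ∀ i, x i ≠ 0) :
    ∑ i, ‖x i‖ ^ 2 / ‖x i‖ = ∑ i, ‖x i‖ :=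
  Finset.sum_congr rfl fun i _ => by
    have := norm_pos_iff.2 (hx i)
    field_simp

/-- The constant is `432 = 27 * 16`: 27 from the mean inequality for the three coordinate rows, 16
from `e3_four_le` for the four lengths. -/
theorem det3_sub_sq_le {x : Fin 4 → E3} (hx : ∀ i, x i ≠ 0) :
    432 * det3 (x 0 - x 3) (x 1 - x 3) (x 2 - x 3) ^ 2 ≤ (∑ i, ‖x i‖) ^ 6 := by
  have hr : ∀ i, 0 < ‖x i‖ := fun i => norm_pos_iff.2 (hx i)
  have h := det_affMat_sq_le x (fun _ => 1) (fun i => ‖x i‖) hr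
  rw [det_affMat_one, sum_norm_sq_div_norm hx, mul_left_comm, prod_mul_sum_inv_four hr] at h
  have h2 := e3_four_le (hr 0) (hr 1) (hr 2) (hr 3)
  rw [← Fin.sum_univ_four (fun i => ‖x i‖)] at h2
  have hX : 0 ≤ ∑ i, ‖x i‖ := Finset.sum_nonneg fun i _ => (hr i).le
  set X := ∑ i, ‖x i‖
  calc _ ≤ 432 * ((X / 3) ^ 3 * (X ^ 3 / 16)) := by
        refine mul_le_mul_of_nonneg_left (h.trans ?_) (by norm_num)
        exact mul_le_mul_of_nonneg_left (by linarith) (by positivity)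
    _ = X ^ 6 := by ring

/-- Equality in Maclaurin's inequality makes the four lengths equal, and the column relations give
the Gram matrix of a regular tetrahedron. The scale comes from the total length `4 * √3 = √48` of
`diaVec`. -/
theorem inner_eq_of_det3_sub_sq_eq {x : Fin 4 → E3} (hx : ∀ i, x i ≠ 0)
    (hd : det3 (x 0 - x 3) (x 1 - x 3) (x 2 - x 3) ≠ 0)
    (h : 432 * det3 (x 0 - x 3) (x 1 - x 3) (x 2 - x 3) ^ 2 = (∑ i, ‖x i‖) ^ 6) (i j : Fin 4) :
    ⟪x i, x j⟫ = (∑ i, ‖x i‖) ^ 2 / 48 * ⟪diaVec i, diaVec j⟫ := by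
  have hr : ∀ i, 0 < ‖x i‖ := fun i => norm_pos_iff.2 (hx i)
  have h1 := det_affMat_sq_le x (fun _ => 1) (fun i => ‖x i‖) hr
  have heq := inner_eq_of_det_affMat_sq_eq x (fun _ => 1) (fun i => ‖x i‖) hr
    (by rwa [det_affMat_one])
  rw [det_affMat_one, sum_norm_sq_div_norm hx] at h1 heq
  rw [mul_left_comm, prod_mul_sum_inv_four hr] at h1 heq
  have h2 := e3_four_le (hr 0) (hr 1) (hr 2) (hr 3)
  have h3 := eq_of_e3_four_eq (hr 0) (hr 1) (hr 2) (hr 3)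
  have hX : 0 < ∑ i, ‖x i‖ := Finset.sum_pos (fun i _ => hr i) ⟨0, Finset.mem_univ 0⟩
  rw [← Fin.sum_univ_four (fun i => ‖x i‖)] at h2 h3
  have hW : ∑ i, 1 ^ 2 / ‖x i‖ = 1 ^ 2 / ‖x 0‖ + 1 ^ 2 / ‖x 1‖ + 1 ^ 2 / ‖x 2‖ + 1 ^ 2 / ‖x 3‖ :=
    Fin.sum_univ_four _
  have hXs := Fin.sum_univ_four (fun i => ‖x i‖)
  set X := ∑ i, ‖x i‖
  set e := ‖x 0‖ * ‖x 1‖ * ‖x 2‖ + ‖x 0‖ * ‖x 1‖ * ‖x 3‖ + ‖x 0‖ * ‖x 2‖ * ‖x 3‖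
    + ‖x 1‖ * ‖x 2‖ * ‖x 3‖
  have hX3 : 0 < (X / 3) ^ 3 := by positivity
  have he : 16 * e = X ^ 3 := by
    refine le_antisymm h2 ?_
    have : (X / 3) ^ 3 * (X ^ 3 / 16) ≤ (X / 3) ^ 3 * e := by
      refine le_trans (le_of_eq ?_) h1
      linarith
    linarith [le_of_mul_le_mul_left this hX3]
  obtain ⟨e1, e2, e3⟩ := h3 he
  have hr4 : ∀ i, ‖x i‖ = X / 4 := by
    intro i
    fin_cases i <;> simp <;> linarith
  have key := heq (by rw [show e = X ^ 3 / 16 by linarith]; linarith) i j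
  rw [hW, hr4 0, hr4 1, hr4 2, hr4 3, hr4 i] at key
  have hG : ⟪diaVec i, diaVec j⟫ = if i = j then 3 else -1 := by
    rw [inner_E3]
    fin_cases i <;> fin_cases j <;> simp [diaVec] <;> norm_num
  rw [hG]
  split_ifs at key ⊢ <;> field_simp at key ⊢ <;> linarith

/-! ### Five vectors -/

/-- The edge vectors of the network `sqp`. -/
noncomputable def sqpVec : Fin 5 → E3 :=
  ![!₂[√15, 0, -1], !₂[-√15, 0, -1], !₂[0, √15, -1], !₂[0, -√15, -1], !₂[0, 0, 13 / 2]]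

theorem prod_mul_sum_inv_five {r : Fin 5 → ℝ} (hr : ∀ i, 0 < r i) (k : Fin 5) :
    (∏ i, r i) * ∑ i, 1 ^ 2 / r i = ∏ i, r (k.succAbove i) +
      r k * ((∏ i, r (k.succAbove i)) * ∑ i, 1 ^ 2 / r (k.succAbove i)) := by
  have := hr k
  rw [Fin.prod_univ_succAbove _ k, Fin.sum_univ_succAbove _ k]
  field_simp

theorem exists_perm_of_injective {i₀ i₁ i₂ i₃ i₄ : Fin 5}
    (h : Function.Injective ![i₀, i₁, i₂, i₃, i₄]) :
    ∃ σ : Equiv.Perm (Fin 5), σ 0 = i₀ ∧ σ 1 = i₁ ∧ σ 2 = i₂ ∧ σ 3 = i₃ ∧ σ 4 = i₄ :=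
  ⟨Equiv.ofBijective _ (Finite.injective_iff_bijective.1 h), rfl, rfl, rfl, rfl, rfl⟩

/-- By `h3` exactly three coefficients are nonzero. Three odd numbers cannot have sum zero, so they
are not all `±1`, and one of absolute value at least 2 is moved to index 2. -/
theorem exists_perm_of_sum_eq_zero {n : Fin 5 → ℤ} (hs : ∑ i, n i = 0) {k₁ k₂ : Fin 5}
    (hk : k₁ ≠ k₂) (h1 : n k₁ = 0) (h2 : n k₂ = 0)
    (h3 : ∀ i j, (∀ k, k ≠ i → k ≠ j → n k = 0) → False) :
    ∃ σ : Equiv.Perm (Fin 5), n (σ 3) = 0 ∧ n (σ 4) = 0 ∧ n (σ 0) ≠ 0 ∧ n (σ 1) ≠ 0 ∧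
      (2 ≤ n (σ 2) ∨ n (σ 2) ≤ -2) := by
  obtain ⟨i, j, l, hinj⟩ : ∃ i j l, Function.Injective ![i, j, l, k₁, k₂] := by
    clear * - hk
    revert k₁ k₂
    decide
  obtain ⟨σ, s0, s1, s2, s3, s4⟩ := exists_perm_of_injective hinj
  have hu : ∀ k, k = i ∨ k = j ∨ k = l ∨ k = k₁ ∨ k = k₂ := by
    intro k
    obtain ⟨m, rfl⟩ := σ.surjective k
    fin_cases m <;> simp [s0, s1, s2, s3, s4]
  have hi : n i ≠ 0 := fun h0 => h3 j l fun k hk1 hk2 => by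
    rcases hu k with rfl | rfl | rfl | rfl | rfl <;> simp_all
  have hj : n j ≠ 0 := fun h0 => h3 i l fun k hk1 hk2 => by
    rcases hu k with rfl | rfl | rfl | rfl | rfl <;> simp_all
  have hl : n l ≠ 0 := fun h0 => h3 i j fun k hk1 hk2 => by
    rcases hu k with rfl | rfl | rfl | rfl | rfl <;> simp_all
  have hsum : n i + n j + n l = 0 := by
    rw [← Equiv.sum_comp σ, Fin.sum_univ_five, s0, s1, s2, s3, s4, h1, h2] at hs
    linarith
  have hbig : (2 ≤ n i ∨ n i ≤ -2) ∨ (2 ≤ n j ∨ n j ≤ -2) ∨ (2 ≤ n l ∨ n l ≤ -2) := by omega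
  rcases hbig with hb | hb | hb
  · refine ⟨(Equiv.swap 0 2).trans σ, ?_, ?_, ?_, ?_, ?_⟩ <;>
      simp [Equiv.swap_apply_def, *]
  · refine ⟨(Equiv.swap 1 2).trans σ, ?_, ?_, ?_, ?_, ?_⟩ <;>
      simp [Equiv.swap_apply_def, *]
  · exact ⟨σ, by rwa [s3], by rwa [s4], by rwa [s0], by rwa [s1], by rwa [s2]⟩

/-- The left side is the fourth elementary symmetric polynomial of five numbers. Splitting off `r k`
leaves those of degree 4 and 3 in the other four, and Maclaurin's inequality applies to each. -/
theorem five_prod_mul_sum_le {r : Fin 5 → ℝ} (hr : ∀ i, 0 < r i) (k : Fin 5) :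
    256 * ((∏ i, r i) * ∑ i, 1 ^ 2 / r i) ≤
      (∑ i, r i - r k) ^ 4 + 16 * (r k * (∑ i, r i - r k) ^ 3) := by
  have h : ∀ i, 0 < r (k.succAbove i) := fun i => hr _
  have hs : ∑ i, r i - r k = ∑ i, r (k.succAbove i) := by
    rw [Fin.sum_univ_succAbove _ k]
    ring
  rw [prod_mul_sum_inv_five hr k, prod_mul_sum_inv_four h, hs, Fin.prod_univ_four,
    Fin.sum_univ_four]
  have h1 := mul_le_mul_of_nonneg_left (e3_four_le (h 0) (h 1) (h 2) (h 3)) (hr k).le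
  have h2 := e4_four_le (h 0) (h 1) (h 2) (h 3)
  linarith

theorem eq_of_five_prod_mul_sum_eq {r : Fin 5 → ℝ} (hr : ∀ i, 0 < r i) (k : Fin 5)
    (he : 256 * ((∏ i, r i) * ∑ i, 1 ^ 2 / r i) =
      (∑ i, r i - r k) ^ 4 + 16 * (r k * (∑ i, r i - r k) ^ 3)) (i : Fin 4) :
    r (k.succAbove i) = (∑ i, r i - r k) / 4 := by
  have h : ∀ i, 0 < r (k.succAbove i) := fun i => hr _
  have hs : ∑ i, r i - r k = ∑ i, r (k.succAbove i) := by
    rw [Fin.sum_univ_succAbove _ k]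
    ring
  rw [prod_mul_sum_inv_five hr k, prod_mul_sum_inv_four h, hs, Fin.prod_univ_four,
    Fin.sum_univ_four] at he
  rw [hs, Fin.sum_univ_four]
  have h1 := e3_four_le (h 0) (h 1) (h 2) (h 3)
  have h2 := e4_four_le (h 0) (h 1) (h 2) (h 3)
  have h3 := eq_of_e3_four_eq (h 0) (h 1) (h 2) (h 3)
  have h4 : r k * (16 * (r (k.succAbove 0) * r (k.succAbove 1) * r (k.succAbove 2) +
      r (k.succAbove 0) * r (k.succAbove 1) * r (k.succAbove 3) +
      r (k.succAbove 0) * r (k.succAbove 2) * r (k.succAbove 3) +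
      r (k.succAbove 1) * r (k.succAbove 2) * r (k.succAbove 3))) =
      r k * (r (k.succAbove 0) + r (k.succAbove 1) + r (k.succAbove 2)
        + r (k.succAbove 3)) ^ 3 := by
    have := mul_le_mul_of_nonneg_left h1 (hr k).le
    linarith
  obtain ⟨e1, e2, e3⟩ := h3 (mul_left_cancel₀ (hr k).ne' h4)
  fin_cases i <;> simp <;> linarith

/-- A bound for weights by the squares of the coefficients of an integral affine dependence of at
least three points. -/
theorem weighted_minor_bound {r : Fin 5 → ℝ} (hr : ∀ i, 0 < r i) {n : Fin 5 → ℤ}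
    (hs : ∑ i, n i = 0)
    (h3 : ∀ i j, (∀ k, k ≠ i → k ≠ j → n k = 0) → False) :
    97200 * ((∏ i, r i) * ∑ i, 1 ^ 2 / r i) ≤
      1024 * ((∑ i, r i * (n i : ℝ) ^ 2) * (∑ i, r i) ^ 3) ∧
    (97200 * ((∏ i, r i) * ∑ i, 1 ^ 2 / r i) =
      1024 * ((∑ i, r i * (n i : ℝ) ^ 2) * (∑ i, r i) ^ 3) →
      ∃ k, n k = 0 ∧ r k = 13 / 45 * ∑ i, r i ∧
        ∀ i, r (k.succAbove i) = 8 / 45 * ∑ i, r i ∧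
          (n (k.succAbove i) = 1 ∨ n (k.succAbove i) = -1)) := by
  have hX : 0 < ∑ i, r i := Finset.sum_pos (fun i _ => hr i) ⟨0, Finset.mem_univ 0⟩
  have hnsq : ∀ {m : ℤ}, m ≠ 0 → (1 : ℝ) ≤ (m : ℝ) ^ 2 := by
    intro m hm
    have : 1 ≤ m ^ 2 := by
      have := sq_nonneg m
      have h2 : m ^ 2 ≠ 0 := pow_ne_zero 2 hm
      omega
    exact_mod_cast this
  -- If two coefficients vanish, one of the other three has square at least 4. This extra weight
  -- makes the bound strict.
  by_cases hz : ∃ k₁ k₂, k₁ ≠ k₂ ∧ n k₁ = 0 ∧ n k₂ = 0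
  · obtain ⟨k₁, k₂, hk, h1, h2⟩ := hz
    obtain ⟨σ, z3, z4, z0, z1, z2⟩ := exists_perm_of_sum_eq_zero hs hk h1 h2 h3
    have hlt : 97200 * ((∏ i, r i) * ∑ i, 1 ^ 2 / r i) <
        1024 * ((∑ i, r i * (n i : ℝ) ^ 2) * (∑ i, r i) ^ 3) := by
      have g0 := hr (σ 0)
      have g1 := hr (σ 1)
      have g2 := hr (σ 2)
      have g3 := hr (σ 3)
      have g4 := hr (σ 4)
      rw [← Equiv.prod_comp σ, ← Equiv.sum_comp σ, ← Equiv.sum_comp σ (fun i => r i * (n i : ℝ) ^ 2),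
        ← Equiv.sum_comp σ r]
      have key := collinear_case g0 g1 g2 g3 g4
      have m0 := hnsq z0
      have m1 := hnsq z1
      have m2 : (4 : ℝ) ≤ (n (σ 2) : ℝ) ^ 2 := by
        have : 4 ≤ n (σ 2) ^ 2 := by rcases z2 with h | h <;> nlinarith
        exact_mod_cast this
      simp only [Fin.prod_univ_five, Fin.sum_univ_five, z3, z4]
      have hB : r (σ 0) + r (σ 1) + 4 * r (σ 2) ≤ r (σ 0) * (n (σ 0) : ℝ) ^ 2
          + r (σ 1) * (n (σ 1) : ℝ) ^ 2 + r (σ 2) * (n (σ 2) : ℝ) ^ 2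
          + r (σ 3) * ((0 : ℤ) : ℝ) ^ 2 + r (σ 4) * ((0 : ℤ) : ℝ) ^ 2 := by
        have := mul_le_mul_of_nonneg_left m0 g0.le
        have := mul_le_mul_of_nonneg_left m1 g1.le
        have := mul_le_mul_of_nonneg_left m2 g2.le
        push_cast
        linarith
      refine lt_of_lt_of_le (lt_of_eq_of_lt ?_ key) ?_
      · field_simp
        ring
      · gcongr
    exact ⟨hlt.le, fun h => absurd h hlt.ne⟩
  -- At most one coefficient vanishes: `k` is its index, or 0 if there is none. All other
  -- coefficients have square at least 1, so the weighted sum is at least `X - r k`.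
  · obtain ⟨k, hk⟩ : ∃ k : Fin 5, ∀ i, n (k.succAbove i) ≠ 0 := by
      by_cases hz' : ∃ k, n k = 0
      · obtain ⟨k, hk⟩ := hz'
        exact ⟨k, fun i hi => hz ⟨k, _, (Fin.succAbove_ne k i).symm, hk, hi⟩⟩
      · push Not at hz'
        exact ⟨0, fun i => hz' _⟩
    set X := ∑ i, r i
    have hs' : X - r k = ∑ i, r (k.succAbove i) := by
      simp only [X]
      rw [Fin.sum_univ_succAbove _ k]
      ring
    have hspos : 0 < X - r k := hs' ▸ Finset.sum_pos (fun i _ => hr _) ⟨0, Finset.mem_univ 0⟩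
    have hle : ∀ i, r (k.succAbove i) ≤ r (k.succAbove i) * (n (k.succAbove i) : ℝ) ^ 2 := fun i =>
      le_mul_of_one_le_right (hr _).le (hnsq (hk i))
    have hB0 : ∑ i, r i * (n i : ℝ) ^ 2 = r k * (n k : ℝ) ^ 2
        + ∑ i, r (k.succAbove i) * (n (k.succAbove i) : ℝ) ^ 2 := Fin.sum_univ_succAbove _ k
    have hle' : X - r k ≤ ∑ i, r (k.succAbove i) * (n (k.succAbove i) : ℝ) ^ 2 := by
      rw [hs']
      exact Finset.sum_le_sum fun i _ => hle i
    have hk0 : 0 ≤ r k * (n k : ℝ) ^ 2 := mul_nonneg (hr k).le (sq_nonneg _)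
    have hB : X - r k ≤ ∑ i, r i * (n i : ℝ) ^ 2 := by linarith
    have h1 := five_prod_mul_sum_le hr k
    have h1' := eq_of_five_prod_mul_sum_eq hr k
    set B := ∑ i, r i * (n i : ℝ) ^ 2
    set e := (∏ i, r i) * ∑ i, 1 ^ 2 / r i
    change 256 * e ≤ (X - r k) ^ 4 + 16 * (r k * (X - r k) ^ 3) at h1
    set s := X - r k with hsdef
    have hrk : r k = X - s := by rw [hsdef]; ring
    -- In terms of `s = X - r k` the difference has the double root `s = 32 / 45 * X`. This root
    -- explains the constants and gives the lengths `13 / 45 * X` and `8 / 45 * X` in the case of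
    -- equality.
    have hpoly : 1024 * (s * X ^ 3) - 97200 / 256 * (s ^ 4 + 16 * (r k * s ^ 3)) =
        97200 / 256 * 15 * s * ((s - 32 / 45 * X) ^ 2 * (s + 16 / 45 * X)) := by
      rw [hrk]; ring
    have hp0 : 0 ≤ 97200 / 256 * 15 * s * ((s - 32 / 45 * X) ^ 2 * (s + 16 / 45 * X)) := by
      positivity
    have hBX : s * X ^ 3 ≤ B * X ^ 3 := by gcongr
    refine ⟨by linarith, fun heq => ?_⟩
    have q0 : 97200 / 256 * 15 * s * ((s - 32 / 45 * X) ^ 2 * (s + 16 / 45 * X)) = 0 := by linarith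
    have q1 : 256 * e = s ^ 4 + 16 * (r k * s ^ 3) := by linarith
    have q2 : s * X ^ 3 = B * X ^ 3 := by linarith
    have q3 : s = B := mul_right_cancel₀ (by positivity) q2
    have q4 : s = 32 / 45 * X := by
      have : (s - 32 / 45 * X) ^ 2 * (s + 16 / 45 * X) = 0 :=
        (mul_eq_zero.1 q0).resolve_left (by positivity)
      have := (mul_eq_zero.1 this).resolve_right (by positivity)
      linarith [pow_eq_zero_iff two_ne_zero |>.1 this]
    have hkz : n k = 0 := by
      have : r k * (n k : ℝ) ^ 2 = 0 := by linarith
      have := (mul_eq_zero.1 this).resolve_left (hr k).ne'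
      exact_mod_cast pow_eq_zero_iff two_ne_zero |>.1 this
    have hall : ∀ i, r (k.succAbove i) = r (k.succAbove i) * (n (k.succAbove i) : ℝ) ^ 2 := by
      have : ∑ i, r (k.succAbove i) = ∑ i, r (k.succAbove i) * (n (k.succAbove i) : ℝ) ^ 2 := by
        linarith
      exact fun i => (Finset.sum_eq_sum_iff_of_le fun i _ => hle i).1 this i (Finset.mem_univ i)
    refine ⟨k, hkz, by linarith, fun i => ⟨?_, ?_⟩⟩
    · rw [h1' q1 i]
      linarith
    · have h2 := hall i
      have h3 : (n (k.succAbove i) : ℝ) ^ 2 = 1 := by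
        have h4 := (hr (k.succAbove i)).ne'
        exact mul_left_cancel₀ h4 (by linarith)
      have h5 : n (k.succAbove i) ^ 2 = 1 := by exact_mod_cast h3
      have h6 : (n (k.succAbove i) - 1) * (n (k.succAbove i) + 1) = 0 := by linarith
      rcases mul_eq_zero.1 h6 with h | h <;> omega

/-- The integers `n` are the coefficients of an affine dependence. Their sum is zero, so a
dependence supported on two points has opposite coefficients there and makes the two points equal.
-/
theorem affMinor_support {x : Fin 5 → E3} (hx : Function.Injective x) {V : ℝ} (hV : V ≠ 0)
    {n : Fin 5 → ℤ} (hn : ∀ i, affMinor x (fun _ => 1) i = n i * V) (h0 : ∃ i, n i ≠ 0)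
    (i j : Fin 5) (hij : ∀ k, k ≠ i → k ≠ j → n k = 0) : False := by
  have hrel : ∀ a, ∑ k, affMat x (fun _ => 1) a k * (n k : ℝ) = 0 := by
    intro a
    have := sum_mul_affMinor x (fun _ => 1) a
    simp_rw [hn, ← mul_assoc] at this
    rw [← Finset.sum_mul] at this
    exact (mul_eq_zero.1 this).resolve_right hV
  have hsum : ∀ f : Fin 5 → ℝ, i ≠ j → ∑ k, f k * (n k : ℝ) = f i * n i + f j * n j := by
    intro f hne
    rw [← Finset.sum_subset (Finset.subset_univ {i, j}), Finset.sum_pair hne]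
    intro k _ hk
    simp only [Finset.mem_insert, Finset.mem_singleton, not_or] at hk
    rw [hij k hk.1 hk.2, Int.cast_zero, mul_zero]
  by_cases hne : i = j
  · subst hne
    have h1 : ∑ k, affMat x (fun _ => 1) 3 k * (n k : ℝ) = 1 * n i := by
      rw [Finset.sum_eq_single i]
      · rfl
      · intro k _ hk
        rw [hij k hk hk, Int.cast_zero, mul_zero]
      · simp
    rw [hrel 3, one_mul] at h1
    have hi : n i = 0 := by exact_mod_cast h1.symm
    obtain ⟨k, hk⟩ := h0
    by_cases hki : k = i
    · exact hk (hki ▸ hi)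
    · exact hk (hij k hki hki)
  · have h3 := hrel 3
    rw [hsum _ hne] at h3
    change 1 * (n i : ℝ) + 1 * n j = 0 at h3
    have hji : (n j : ℝ) = -n i := by linarith
    have hni : (n i : ℝ) ≠ 0 := by
      intro hi
      have hi' : n i = 0 := by exact_mod_cast hi
      have hj' : n j = 0 := by
        rw [hi, neg_zero] at hji
        exact_mod_cast hji
      obtain ⟨k, hk⟩ := h0
      by_cases hki : k = i
      · exact hk (hki ▸ hi')
      · by_cases hkj : k = j
        · exact hk (hkj ▸ hj')
        · exact hk (hij k hki hkj)
    have hco : ∀ a, affMat x (fun _ => 1) a i = affMat x (fun _ => 1) a j := by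
      intro a
      have ha := hrel a
      rw [hsum _ hne, hji] at ha
      have : (affMat x (fun _ => 1) a i - affMat x (fun _ => 1) a j) * n i = 0 := by linarith
      linarith [(mul_eq_zero.1 this).resolve_right hni]
    exact hne (hx (ext_E3 (hco 0) (hco 1) (hco 2)))

/-- The zero sum forces two signs of each kind. The chosen order matches the relation of `sqpVec`,
in which the sum of the first two vectors is the sum of the next two. -/
theorem exists_perm_of_signs {n : Fin 5 → ℤ} (hs : ∑ i, n i = 0) {k : Fin 5} (hk : n k = 0)
    (hrest : ∀ i, n (k.succAbove i) = 1 ∨ n (k.succAbove i) = -1) :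
    ∃ σ : Equiv.Perm (Fin 5), σ 4 = k ∧ n (σ 0) = 1 ∧
      n (σ 1) = 1 ∧ n (σ 2) = -1 ∧ n (σ 3) = -1 := by
  have hinj : ∀ f : Fin 4 → Fin 4, Function.Injective f → Function.Injective
      ![k.succAbove (f 0), k.succAbove (f 1), k.succAbove (f 2), k.succAbove (f 3), k] := by
    intro f hf
    have : ![k.succAbove (f 0), k.succAbove (f 1), k.succAbove (f 2), k.succAbove (f 3), k] =
        Fin.snoc (α := fun _ => Fin 5) (fun i => k.succAbove (f i)) k := by
      funext i
      fin_cases i <;> rfl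
    rw [this, Fin.snoc_injective_iff]
    exact ⟨Fin.succAbove_right_injective.comp hf, fun ⟨i, hi⟩ => Fin.succAbove_ne k _ hi⟩
  rw [Fin.sum_univ_succAbove _ k, hk, Fin.sum_univ_four] at hs
  have key : ∃ f : Fin 4 → Fin 4, Function.Injective f ∧ n (k.succAbove (f 0)) = 1 ∧
      n (k.succAbove (f 1)) = 1 ∧ n (k.succAbove (f 2)) = -1 ∧ n (k.succAbove (f 3)) = -1 := by
    rcases hrest 0 with h0 | h0 <;> rcases hrest 1 with h1 | h1 <;>
      rcases hrest 2 with h2 | h2 <;> rcases hrest 3 with h3 | h3 <;>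
      first
      | (exfalso; omega)
      | exact ⟨![0, 1, 2, 3], by decide, h0, h1, h2, h3⟩
      | exact ⟨![0, 2, 1, 3], by decide, h0, h2, h1, h3⟩
      | exact ⟨![0, 3, 1, 2], by decide, h0, h3, h1, h2⟩
      | exact ⟨![1, 2, 0, 3], by decide, h1, h2, h0, h3⟩
      | exact ⟨![1, 3, 0, 2], by decide, h1, h3, h0, h2⟩
      | exact ⟨![2, 3, 0, 1], by decide, h2, h3, h0, h1⟩
  obtain ⟨f, hf, f0, f1, f2, f3⟩ := key
  obtain ⟨σ, t0, t1, t2, t3, t4⟩ := exists_perm_of_injective (hinj f hf)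
  exact ⟨σ, t4, by rwa [t0], by rwa [t1], by rwa [t2], by rwa [t3]⟩

/-- The hypothesis `g` is the relation of `inner_eq_of_sum_mul_affMinor_sq_eq` with the extremal
lengths inserted. The vectors `sqpVec` have total length `45 / 2`, hence the scale `2 * X / 45`. -/
theorem inner_of_gram_relation {X V I : ℝ} (hX : 0 < X) (hV : 0 < V) {r : Fin 5 → ℝ}
    {n : Fin 5 → ℤ} (hrs : ∀ i, i ≠ 4 → r i = 8 / 45 * X) (hr4 : r 4 = 13 / 45 * X)
    (s0 : n 0 = 1) (s1 : n 1 = 1) (s2 : n 2 = -1) (s3 : n 3 = -1) (s4 : n 4 = 0) {i j : Fin 5}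
    (g : I / (X / 3) + 1 * 1 / (45 / X * (15 / 26)) = (if i = j then r i else 0) -
      r i * r j * (n i * V * (n j * V)) / (V ^ 2 * (32 / 45 * X))) :
    I = (2 * X / 45) ^ 2 * ⟪sqpVec i, sqpVec j⟫ := by
  have g' : I = (X / 3) * ((if i = j then r i else 0) -
      r i * r j * (n i * n j) / (32 / 45 * X) - 26 / 675 * X) := by
    have h1 : r i * r j * (n i * V * (n j * V)) / (V ^ 2 * (32 / 45 * X)) =
      r i * r j * (n i * n j) / (32 / 45 * X) := by field_simp
    have h2 : 1 * 1 / (45 / X * (15 / 26)) = 26 / 675 * X := by field_simp; norm_num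
    rw [h1, h2] at g
    rw [← g]
    field_simp
    ring
  rw [g']
  have hr0 := hrs 0 (by decide)
  have hr1 := hrs 1 (by decide)
  have hr2 := hrs 2 (by decide)
  have hr3 := hrs 3 (by decide)
  have h15 : √15 * √15 = 15 := Real.mul_self_sqrt (by norm_num)
  rw [inner_E3 (sqpVec i)]
  fin_cases i <;> fin_cases j <;>
    simp [sqpVec, s0, s1, s2, s3, s4, hr0, hr1, hr2, hr3, hr4, h15] <;>
    field_simp <;> norm_num

/-- The lower bound for the length of five distinct vectors whose affine minors are integer
multiples of `V`. -/
theorem five_vectors_bound {x : Fin 5 → E3} (hx0 : ∀ i, x i ≠ 0) (hx : Function.Injective x)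
    {V : ℝ} (hV : 0 < V) {n : Fin 5 → ℤ} (hn : ∀ i, affMinor x (fun _ => 1) i = n i * V)
    (h0 : ∃ i, n i ≠ 0) :
    405 / 8 * V ≤ (∑ i, ‖x i‖) ^ 3 ∧ (405 / 8 * V = (∑ i, ‖x i‖) ^ 3 →
      ∃ σ : Equiv.Perm (Fin 5), ∀ i j, ⟪x (σ i), x (σ j)⟫ =
        (2 * (∑ i, ‖x i‖) / 45) ^ 2 * ⟪sqpVec i, sqpVec j⟫) := by
  have hr : ∀ i, 0 < ‖x i‖ := fun i => norm_pos_iff.2 (hx0 i)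
  have hs : ∑ i, n i = 0 := by
    have := sum_mul_affMinor x (fun _ => 1) 3
    simp_rw [hn, ← mul_assoc] at this
    rw [← Finset.sum_mul] at this
    have := (mul_eq_zero.1 this).resolve_right hV.ne'
    simp only [affMat, Matrix.of_apply, Matrix.cons_val, one_mul] at this
    exact_mod_cast this
  obtain ⟨hb, heq⟩ := weighted_minor_bound hr hs (affMinor_support hx hV.ne' hn h0)
  have hm := sum_mul_affMinor_sq_le x (fun _ => 1) (fun i => ‖x i‖) hr
  have hin := inner_eq_of_sum_mul_affMinor_sq_eq x (fun _ => 1) (fun i => ‖x i‖) hr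
  have hBV : ∑ i, ‖x i‖ * affMinor x (fun _ => 1) i ^ 2 =
      V ^ 2 * ∑ i, ‖x i‖ * (n i : ℝ) ^ 2 := by
    rw [Finset.mul_sum]
    refine Finset.sum_congr rfl fun i _ => ?_
    rw [hn i]
    ring
  rw [sum_norm_sq_div_norm hx0, hBV, mul_left_comm] at hm
  rw [sum_norm_sq_div_norm hx0, hBV, mul_left_comm] at hin
  have hX : 0 < ∑ i, ‖x i‖ := Finset.sum_pos (fun i _ => hr i) ⟨0, Finset.mem_univ 0⟩
  have hB : 0 < ∑ i, ‖x i‖ * (n i : ℝ) ^ 2 := by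
    obtain ⟨i, hi⟩ := h0
    refine Finset.sum_pos' (fun i _ => mul_nonneg (hr i).le (sq_nonneg _))
      ⟨i, Finset.mem_univ i, ?_⟩
    have : (n i : ℝ) ≠ 0 := by exact_mod_cast hi
    exact mul_pos (hr i) (by positivity)
  set X := ∑ i, ‖x i‖
  set B := ∑ i, ‖x i‖ * (n i : ℝ) ^ 2
  set W := ∑ i, 1 ^ 2 / ‖x i‖
  set e := (∏ i, ‖x i‖) * W
  have hXc : 0 < X ^ 3 := by positivity
  -- The determinant bound and the integer weighted bound combine; after cancellation of `B` the
  -- constant is `27 * 97200 / 1024 = (405 / 8) ^ 2`.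
  have h1 : V ^ 2 * B * 97200 ≤ (X / 3) ^ 3 * (1024 * (B * X ^ 3)) := by
    calc V ^ 2 * B * 97200 ≤ (X / 3) ^ 3 * e * 97200 := by gcongr
      _ = (X / 3) ^ 3 * (97200 * e) := by ring
      _ ≤ _ := by gcongr
  have h2 : (405 / 8 * V) ^ 2 ≤ (X ^ 3) ^ 2 := by
    have : B * ((405 / 8 * V) ^ 2) ≤ B * (X ^ 3) ^ 2 := by nlinarith
    exact le_of_mul_le_mul_left this hB
  refine ⟨abs_le_of_sq_le_sq' h2 hXc.le |>.2, fun hVX => ?_⟩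
  have e1 : V ^ 2 * B * 97200 = (X / 3) ^ 3 * (1024 * (B * X ^ 3)) := by
    have : (405 / 8 * V) ^ 2 = (X ^ 3) ^ 2 := by rw [hVX]
    have : B * ((405 / 8 * V) ^ 2) = B * (X ^ 3) ^ 2 := by rw [this]
    nlinarith
  have hX3 : 0 < (X / 3) ^ 3 := by positivity
  have e2 : 97200 * e = 1024 * (B * X ^ 3) := by
    refine le_antisymm hb (le_of_mul_le_mul_left ?_ hX3)
    calc (X / 3) ^ 3 * (1024 * (B * X ^ 3)) = V ^ 2 * B * 97200 := e1.symm
      _ ≤ (X / 3) ^ 3 * e * 97200 := by gcongr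
      _ = _ := by ring
  have e3 : V ^ 2 * B = (X / 3) ^ 3 * e := by
    linear_combination e1 / 97200 - (X / 3) ^ 3 / 97200 * e2
  obtain ⟨k, hk, hrk, hrest⟩ := heq e2
  have hin' := hin (mul_pos (pow_pos hV 2) hB).ne' e3
  have hW : W = 45 / X * (15 / 26) := by
    simp only [W]
    rw [Fin.sum_univ_succAbove _ k, hrk]
    simp_rw [(hrest _).1]
    simp only [Finset.sum_const, Finset.card_univ, Fintype.card_fin, nsmul_eq_mul]
    field_simp
    norm_num
  have hBX : B = 32 / 45 * X := by
    have h5 : ∀ i, (n (k.succAbove i) : ℝ) ^ 2 = 1 := by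
      intro i
      rcases (hrest i).2 with h | h <;> rw [h] <;> norm_num
    simp only [B]
    rw [Fin.sum_univ_succAbove _ k, hk]
    simp_rw [h5, (hrest _).1]
    simp
    ring
  obtain ⟨σ, s4, s0, s1, s2, s3⟩ := exists_perm_of_signs hs hk fun i => (hrest i).2
  have hrs : ∀ i, i ≠ 4 → ‖x (σ i)‖ = 8 / 45 * X := by
    intro i hi
    have : σ i ≠ k := fun h => hi (σ.injective (h.trans s4.symm))
    obtain ⟨j, hj⟩ := Fin.exists_succAbove_eq this
    rw [← hj]
    exact (hrest j).1
  have hr4 : ‖x (σ 4)‖ = 13 / 45 * X := by rw [s4, hrk]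
  refine ⟨σ, fun i j => ?_⟩
  have s4' : n (σ 4) = 0 := s4 ▸ hk
  have g := hin' (σ i) (σ j)
  rw [hn, hn, hW, hBX] at g
  simp only [σ.injective.eq_iff] at g
  exact inner_of_gram_relation hX hV (r := fun i => ‖x (σ i)‖) (n := fun i => n (σ i)) hrs hr4
    s0 s1 s2 s3 s4' g

/-! ### Lower bounds for the length of generating configurations -/

/-- The determinants of vectors from `Λ` are integer multiples of `V`. -/
def DetIntegral (Λ : Submodule ℤ E3) (V : ℝ) : Prop :=
  ∀ a ∈ Λ, ∀ b ∈ Λ, ∀ c ∈ Λ, ∃ n : ℤ, det3 a b c = n * V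

/-- The differences of the closed walks in a double bouquet with the given edge vectors. -/
def edgeGens {ℓ k : ℕ} (y z : Fin ℓ → E3) (x : Fin k → E3) : Set E3 :=
  Set.range y ∪ Set.range z ∪ {v | ∃ i j, v = x i - x j}

theorem DetIntegral.le_abs {Λ : Submodule ℤ E3} {V : ℝ} (hΛ : DetIntegral Λ V) (hV : 0 < V)
    {a b c : E3} (ha : a ∈ Λ) (hb : b ∈ Λ) (hc : c ∈ Λ) (h : det3 a b c ≠ 0) :
    V ≤ |det3 a b c| := by
  obtain ⟨n, hn⟩ := hΛ a ha b hb c hc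
  rw [hn] at h ⊢
  have hn0 : n ≠ 0 := by
    rintro rfl
    simp at h
  rw [abs_mul, abs_of_pos hV]
  have : (1 : ℝ) ≤ |(n : ℝ)| := by exact_mod_cast Int.one_le_abs hn0
  nlinarith

theorem DetIntegral.le_norms {Λ : Submodule ℤ E3} {V : ℝ} (hΛ : DetIntegral Λ V) (hV : 0 < V)
    {a b c : E3} (ha : a ∈ Λ) (hb : b ∈ Λ) (hc : c ∈ Λ) (h : det3 a b c ≠ 0) :
    V ≤ ‖a‖ * ‖b‖ * ‖c‖ :=
  (hΛ.le_abs hV ha hb hc h).trans (abs_det3_le a b c)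

/-- A basis and one further nonzero vector. -/
theorem DetIntegral.four_bound {Λ : Submodule ℤ E3} {V : ℝ} (hΛ : DetIntegral Λ V) (hV : 0 < V)
    {a b c w : E3} (ha : a ∈ Λ) (hb : b ∈ Λ) (hc : c ∈ Λ) (hw : w ∈ Λ) (h : det3 a b c ≠ 0)
    (hw0 : w ≠ 0) : 54 * V ≤ (‖a‖ + ‖b‖ + ‖c‖ + ‖w‖) ^ 3 := by
  have h0 := hΛ.le_norms hV ha hb hc h
  -- By Cramer's rule the nonzero vector `w` can replace some member of the basis. The two resulting
  -- products of norms share two factors and are both at least `V`, so the mean inequality with the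
  -- third factors added gives twice the constant 27.
  have hor : det3 w b c ≠ 0 ∨ det3 a w c ≠ 0 ∨ det3 a b w ≠ 0 := by
    by_contra! hn
    have := det3_smul_eq a b c w
    rw [hn.1, hn.2.1, hn.2.2] at this
    simp [h, hw0] at this
  rcases hor with h1 | h1 | h1
  · have h2 := hΛ.le_norms hV hw hb hc h1
    have h3 := mul_mul_le_cube (a := ‖a‖ + ‖w‖) (b := ‖b‖) (c := ‖c‖) (by positivity)
      (by positivity) (by positivity)
    calc 54 * V ≤ 27 * ((‖a‖ + ‖w‖) * ‖b‖ * ‖c‖) := by linarith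
      _ ≤ _ := h3
      _ = _ := by ring
  · have h2 := hΛ.le_norms hV ha hw hc h1
    have h3 := mul_mul_le_cube (a := ‖a‖) (b := ‖b‖ + ‖w‖) (c := ‖c‖) (by positivity)
      (by positivity) (by positivity)
    calc 54 * V ≤ 27 * (‖a‖ * (‖b‖ + ‖w‖) * ‖c‖) := by linarith
      _ ≤ _ := h3
      _ = _ := by ring
  · have h2 := hΛ.le_norms hV ha hb hw h1
    have h3 := mul_mul_le_cube (a := ‖a‖) (b := ‖b‖) (c := ‖c‖ + ‖w‖) (by positivity)
      (by positivity) (by positivity)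
    calc 54 * V ≤ 27 * (‖a‖ * ‖b‖ * (‖c‖ + ‖w‖)) := by linarith
      _ ≤ _ := h3
      _ = _ := by ring

theorem sum_comp_le_sum {m k : ℕ} (f : Fin k → ℝ) (hf : ∀ i, 0 ≤ f i) {g : Fin m → Fin k}
    (hg : Function.Injective g) : ∑ j, f (g j) ≤ ∑ i, f i := by
  calc ∑ j, f (g j) = ∑ i ∈ Finset.univ.map ⟨g, hg⟩, f i := (Finset.sum_map _ ⟨g, hg⟩ f).symm
    _ ≤ _ := Finset.sum_le_univ_sum_of_nonneg hf

theorem exists_det3_ne_zero_of_ne_zero {a : E3} (ha : a ≠ 0) {S : Set E3}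
    (hS : Submodule.span ℝ S = ⊤) : ∃ b ∈ S, ∃ c ∈ S, det3 a b c ≠ 0 := by
  obtain ⟨u, hu, v, hv, w, hw, h⟩ := exists_det3_ne_zero_triple hS
  by_contra! hn
  have h1 := det3_smul_eq u v w a
  rw [hn v hv w hw, ← det3_rotate u a w, hn w hw u hu, det3_rotate a u v, hn u hu v hv] at h1
  simp [h, ha] at h1

theorem det3_ne_zero_of_span {a b c : E3} (h : Submodule.span ℝ {a, b, c} = ⊤) :
    det3 a b c ≠ 0 := by
  obtain ⟨u, hu, v, hv, w, hw, h1⟩ := exists_det3_ne_zero_triple h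
  intro h0
  apply h1
  simp only [Set.mem_insert_iff, Set.mem_singleton_iff] at hu hv hw
  rcases hu with rfl | rfl | rfl <;> rcases hv with rfl | rfl | rfl <;>
    rcases hw with rfl | rfl | rfl <;> simp only [det3] at h0 ⊢ <;>
    first | linear_combination h0 | linear_combination -h0 | ring

/-- The bound for bouquets with three loops. -/
theorem three_loops_bound {Λ : Submodule ℤ E3} {V : ℝ} (hΛ : DetIntegral Λ V) (hV : 0 < V)
    {y : Fin 3 → E3} (hy : ∀ i, y i ∈ Λ) (hs : Submodule.span ℝ (Set.range y) = ⊤) :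
    27 * V ≤ (∑ i, ‖y i‖) ^ 3 ∧ (27 * V = (∑ i, ‖y i‖) ^ 3 →
      ∀ i j, ⟪y i, y j⟫ = ((∑ i, ‖y i‖) / 3) ^ 2 * if i = j then 1 else 0) := by
  have hs' : Submodule.span ℝ {y 0, y 1, y 2} = ⊤ := by
    rw [← hs]
    congr 1
    ext v
    simp [Fin.exists_fin_succ, eq_comm]
  have hd := det3_ne_zero_of_span hs'
  have h1 := hΛ.le_abs hV (hy 0) (hy 1) (hy 2) hd
  have h2 := abs_det3_le (y 0) (y 1) (y 2)
  have h3 := mul_mul_le_cube (norm_nonneg (y 0)) (norm_nonneg (y 1)) (norm_nonneg (y 2))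
  rw [Fin.sum_univ_three]
  refine ⟨by linarith, fun he => ?_⟩
  have hp : 0 < ‖y 0‖ * ‖y 1‖ * ‖y 2‖ := by linarith
  have p0 : 0 < ‖y 0‖ := lt_of_le_of_ne (norm_nonneg _) fun h => by simp [← h] at hp
  have p1 : 0 < ‖y 1‖ := lt_of_le_of_ne (norm_nonneg _) fun h => by simp [← h] at hp
  have p2 : 0 < ‖y 2‖ := lt_of_le_of_ne (norm_nonneg _) fun h => by simp [← h] at hp
  obtain ⟨e1, e2⟩ := eq_of_mul_mul_eq_cube p0 p1 p2 (by linarith)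
  obtain ⟨o1, o2, o3⟩ := inner_eq_zero_of_abs_det3_eq hd (by linarith)
  intro i j
  have q0 := real_inner_self_eq_norm_sq (y 0)
  have q1 := real_inner_self_eq_norm_sq (y 1)
  have q2 := real_inner_self_eq_norm_sq (y 2)
  have r1 := real_inner_comm (y 0) (y 1)
  have r2 := real_inner_comm (y 1) (y 2)
  have r3 := real_inner_comm (y 0) (y 2)
  fin_cases i <;> fin_cases j <;> simp <;> first | linarith | skip
  · rw [e1, e2]; ring
  · rw [e1, e2]; ring
  · rw [e1, e2]; ring

/-- The edge vectors of the network `cds`. -/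
noncomputable def cdsVec (t : ℝ) : Fin 1 ⊕ Fin 1 ⊕ Fin 2 → E3 :=
  Sum.elim ![!₂[1, 0, 0]] (Sum.elim ![!₂[0, 1, 0]] ![!₂[0, 0, t], !₂[0, 0, t - 1]])

theorem span_insert_eq_top_of_edgeGens {k : ℕ} {y z : Fin 1 → E3} {x : Fin (k + 1) → E3}
    (hs : Submodule.span ℝ (edgeGens y z x) = ⊤) :
    Submodule.span ℝ ({y 0, z 0} ∪ Set.range fun i => x i - x 0) = ⊤ := by
  rw [eq_top_iff, ← hs, Submodule.span_le]
  rintro v ((⟨i, rfl⟩ | ⟨i, rfl⟩) | ⟨i, j, rfl⟩)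
  · rw [Subsingleton.elim i 0]
    exact Submodule.subset_span (by simp)
  · rw [Subsingleton.elim i 0]
    exact Submodule.subset_span (by simp)
  · rw [← sub_sub_sub_cancel_right _ _ (x 0)]
    exact Submodule.sub_mem _ (Submodule.subset_span (Or.inr ⟨i, rfl⟩))
      (Submodule.subset_span (Or.inr ⟨j, rfl⟩))

/-- The links enter the determinant only through their difference, whose norm is at most the sum of
their lengths. Equality forces the links to be opposite but leaves the ratio of their lengths free,
which is the parameter `t`. -/
theorem loop_loop_two_bound {Λ : Submodule ℤ E3} {V : ℝ} (hΛ : DetIntegral Λ V) (hV : 0 < V)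
    {y z : Fin 1 → E3} {x : Fin 2 → E3} (hx : ∀ i, x i ≠ 0)
    (hg : edgeGens y z x ⊆ Λ) (hs : Submodule.span ℝ (edgeGens y z x) = ⊤) :
    27 * V ≤ (∑ i, ‖y i‖ + ∑ i, ‖z i‖ + ∑ i, ‖x i‖) ^ 3 ∧
    (27 * V = (∑ i, ‖y i‖ + ∑ i, ‖z i‖ + ∑ i, ‖x i‖) ^ 3 →
      ∃ t ∈ Set.Ioo (0 : ℝ) 1, ∃ c : ℝ, 0 < c ∧ ∀ i j, ⟪Sum.elim y (Sum.elim z x) i,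
        Sum.elim y (Sum.elim z x) j⟫ = c ^ 2 * ⟪cdsVec t i, cdsVec t j⟫) := by
  have hs' : Submodule.span ℝ {y 0, z 0, x 0 - x 1} = ⊤ := by
    rw [eq_top_iff, ← span_insert_eq_top_of_edgeGens hs, Submodule.span_le]
    rintro v ((rfl | rfl) | ⟨i, rfl⟩)
    · exact Submodule.subset_span (by simp)
    · exact Submodule.subset_span (by simp)
    · fin_cases i
      · simp
      · change x 1 - x 0 ∈ Submodule.span ℝ _
        have h : x 0 - x 1 ∈ Submodule.span ℝ {y 0, z 0, x 0 - x 1} :=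
          Submodule.subset_span (by simp)
        simpa using Submodule.neg_mem _ h
  have hd := det3_ne_zero_of_span hs'
  have hy0 : y 0 ∈ Λ := hg (Or.inl (Or.inl ⟨0, rfl⟩))
  have hz0 : z 0 ∈ Λ := hg (Or.inl (Or.inr ⟨0, rfl⟩))
  have hf0 : x 0 - x 1 ∈ Λ := hg (Or.inr ⟨0, 1, rfl⟩)
  have h1 := hΛ.le_abs hV hy0 hz0 hf0 hd
  have h2 := abs_det3_le (y 0) (z 0) (x 0 - x 1)
  have h3 := mul_mul_le_cube (norm_nonneg (y 0)) (norm_nonneg (z 0)) (norm_nonneg (x 0 - x 1))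
  have h4 := norm_sub_le (x 0) (x 1)
  rw [Fin.sum_univ_one, Fin.sum_univ_one, Fin.sum_univ_two]
  have hn : 0 ≤ ‖y 0‖ + ‖z 0‖ + ‖x 0 - x 1‖ := by positivity
  have h5 : (‖y 0‖ + ‖z 0‖ + ‖x 0 - x 1‖) ^ 3 ≤ (‖y 0‖ + ‖z 0‖ + (‖x 0‖ + ‖x 1‖)) ^ 3 := by
    gcongr
  refine ⟨by linarith, fun he => ?_⟩
  have hp : 0 < ‖y 0‖ * ‖z 0‖ * ‖x 0 - x 1‖ := by linarith
  have p0 : 0 < ‖y 0‖ := lt_of_le_of_ne (norm_nonneg _) fun h => by simp [← h] at hp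
  have p1 : 0 < ‖z 0‖ := lt_of_le_of_ne (norm_nonneg _) fun h => by simp [← h] at hp
  have p2 : 0 < ‖x 0 - x 1‖ := lt_of_le_of_ne (norm_nonneg _) fun h => by
    rw [← h, mul_zero] at hp
    exact hp.false
  obtain ⟨e1, e2⟩ := eq_of_mul_mul_eq_cube p0 p1 p2 (by linarith)
  obtain ⟨o1, o2, o3⟩ := inner_eq_zero_of_abs_det3_eq hd (by linarith)
  have h6 : ‖x 0 - x 1‖ = ‖x 0‖ + ‖x 1‖ := by
    by_contra hne
    have hlt : ‖x 0 - x 1‖ < ‖x 0‖ + ‖x 1‖ := lt_of_le_of_ne h4 hne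
    have : (‖y 0‖ + ‖z 0‖ + ‖x 0 - x 1‖) ^ 3 < (‖y 0‖ + ‖z 0‖ + (‖x 0‖ + ‖x 1‖)) ^ 3 := by
      gcongr
    linarith
  have n0 := norm_pos_iff.2 (hx 0)
  have n1 := norm_pos_iff.2 (hx 1)
  have h7 : ‖x 0‖ • (-x 1) = ‖x 1‖ • x 0 := by
    have h8 : SameRay ℝ (x 0) (-x 1) := by
      rw [sameRay_iff_norm_add, norm_neg, ← sub_eq_add_neg]
      exact h6
    have := h8.norm_smul_eq
    rwa [norm_neg] at this
  have h8 : ⟪x 0, x 1⟫ = -(‖x 0‖ * ‖x 1‖) := by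
    have := norm_sub_sq_real (x 0) (x 1)
    rw [h6] at this
    linarith
  -- The links point in opposite directions, so a vector orthogonal to their difference is
  -- orthogonal to each of them.
  have oy : ∀ v : E3, ⟪v, x 0 - x 1⟫ = 0 → ⟪v, x 0⟫ = 0 ∧ ⟪v, x 1⟫ = 0 := by
    intro v hv
    have h9 := congrArg (fun u => ⟪v, u⟫) h7
    simp only [inner_smul_right, inner_neg_right] at h9
    rw [inner_sub_right] at hv
    have h10 : ⟪v, x 0⟫ = ⟪v, x 1⟫ := by linarith
    rw [h10] at h9 ⊢
    have : ⟪v, x 1⟫ * (‖x 0‖ + ‖x 1‖) = 0 := by linarith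
    have := (mul_eq_zero.1 this).resolve_right (by positivity)
    exact ⟨this, this⟩
  obtain ⟨a1, a2⟩ := oy _ o2
  obtain ⟨a3, a4⟩ := oy _ o3
  have hc : 0 < ‖x 0‖ + ‖x 1‖ := by positivity
  have e3 : ‖z 0‖ = ‖x 0‖ + ‖x 1‖ := e2.trans h6
  refine ⟨‖x 0‖ / (‖x 0‖ + ‖x 1‖), ⟨by positivity, ?_⟩, ‖x 0‖ + ‖x 1‖, hc, ?_⟩
  · rw [div_lt_one hc]
    linarith
  have r1 : ⟪z 0, y 0⟫ = 0 := by rw [real_inner_comm, o1]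
  have r2 : ⟪x 0, y 0⟫ = 0 := by rw [real_inner_comm, a3]
  have r3 : ⟪x 1, y 0⟫ = 0 := by rw [real_inner_comm, a4]
  have r4 : ⟪x 0, z 0⟫ = 0 := by rw [real_inner_comm, a1]
  have r5 : ⟪x 1, z 0⟫ = 0 := by rw [real_inner_comm, a2]
  have r6 : ⟪x 1, x 0⟫ = -(‖x 0‖ * ‖x 1‖) := by rw [real_inner_comm, h8]
  rintro (i | i | i) (j | j | j) <;> fin_cases i <;> fin_cases j <;>
    rw [inner_E3 (cdsVec _ _)] <;>
    simp [cdsVec, o1, a1, a2, a3, a4, h8, e1, e3, r1, r2, r3, r4, r5, r6] <;>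
    field_simp <;> ring

/-- Since `(12 * √3) ^ 2 = 432`, this is the square root of `det3_sub_sq_le` with the determinant
bounded below by `V`. -/
theorem four_vectors_bound {Λ : Submodule ℤ E3} {V : ℝ} (hΛ : DetIntegral Λ V) (hV : 0 < V)
    {y z : Fin 0 → E3} {x : Fin 4 → E3} (hx : ∀ i, x i ≠ 0)
    (hg : edgeGens y z x ⊆ Λ) (hs : Submodule.span ℝ (edgeGens y z x) = ⊤) :
    12 * √3 * V ≤ (∑ i, ‖y i‖ + ∑ i, ‖z i‖ + ∑ i, ‖x i‖) ^ 3 ∧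
    (12 * √3 * V = (∑ i, ‖y i‖ + ∑ i, ‖z i‖ + ∑ i, ‖x i‖) ^ 3 →
      ∃ c : ℝ, 0 < c ∧ ∀ i j, ⟪Sum.elim y (Sum.elim z x) i, Sum.elim y (Sum.elim z x) j⟫ =
        c ^ 2 * ⟪Sum.elim ![] (Sum.elim ![] diaVec) i, Sum.elim ![] (Sum.elim ![] diaVec) j⟫) := by
  have hs' : Submodule.span ℝ {x 0 - x 3, x 1 - x 3, x 2 - x 3} = ⊤ := by
    have h3 : ∀ i, x i - x 3 ∈ Submodule.span ℝ {x 0 - x 3, x 1 - x 3, x 2 - x 3} := by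
      intro i
      fin_cases i
      · exact Submodule.subset_span (by simp)
      · exact Submodule.subset_span (by simp)
      · exact Submodule.subset_span (by simp)
      · simp
    rw [eq_top_iff, ← hs, Submodule.span_le]
    rintro v ((⟨i, rfl⟩ | ⟨i, rfl⟩) | ⟨i, j, rfl⟩)
    · exact i.elim0
    · exact i.elim0
    · have hij : x i - x j = (x i - x 3) - (x j - x 3) := by abel
      rw [hij]
      exact Submodule.sub_mem _ (h3 i) (h3 j)
  have hd := det3_ne_zero_of_span hs'
  have h1 := hΛ.le_abs hV (hg (Or.inr ⟨0, 3, rfl⟩)) (hg (Or.inr ⟨1, 3, rfl⟩))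
    (hg (Or.inr ⟨2, 3, rfl⟩)) hd
  have h2 := det3_sub_sq_le hx
  have h3 : √3 * √3 = 3 := Real.mul_self_sqrt (by norm_num)
  have h4 : V ^ 2 ≤ det3 (x 0 - x 3) (x 1 - x 3) (x 2 - x 3) ^ 2 := by
    rw [← sq_abs (det3 _ _ _)]
    gcongr
  have hX : 0 < ∑ i, ‖x i‖ :=
    Finset.sum_pos (fun i _ => norm_pos_iff.2 (hx i)) ⟨0, Finset.mem_univ 0⟩
  simp only [Finset.univ_eq_empty, Finset.sum_empty, zero_add]
  have h5 : (12 * √3 * V) ^ 2 = 432 * V ^ 2 := by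
    linear_combination 144 * V ^ 2 * h3
  refine ⟨?_, fun he => ⟨(∑ i, ‖x i‖) / √48, by positivity, ?_⟩⟩
  · refine (abs_le_of_sq_le_sq' ?_ (by positivity)).2
    calc _ = 432 * V ^ 2 := h5
      _ ≤ (∑ i, ‖x i‖) ^ 6 := by linarith
      _ = _ := by ring
  · have h6 : 432 * det3 (x 0 - x 3) (x 1 - x 3) (x 2 - x 3) ^ 2 = (∑ i, ‖x i‖) ^ 6 := by
      refine le_antisymm h2 ?_
      calc (∑ i, ‖x i‖) ^ 6 = (12 * √3 * V) ^ 2 := by rw [he]; ring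
        _ ≤ _ := by linarith
    have h7 := inner_eq_of_det3_sub_sq_eq hx hd h6
    rintro (i | i | i) (j | j | j)
    · exact i.elim0
    · exact i.elim0
    · exact i.elim0
    · exact i.elim0
    · exact i.elim0
    · exact i.elim0
    · exact j.elim0
    · exact j.elim0
    · simp only [Sum.elim_inr]
      rw [h7, div_pow, Real.sq_sqrt (by norm_num)]

theorem affMinor_eq_det3 (x : Fin 5 → E3) (i : Fin 5) : affMinor x (fun _ => 1) i =
    (-1) ^ (i : ℕ) * det3 (x (i.succAbove 0) - x (i.succAbove 3))
      (x (i.succAbove 1) - x (i.succAbove 3)) (x (i.succAbove 2) - x (i.succAbove 3)) := by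
  rw [affMinor, det_affMat_one]

theorem DetIntegral.five_vectors_bound {Λ : Submodule ℤ E3} {V : ℝ} (hΛ : DetIntegral Λ V)
    (hV : 0 < V) {x : Fin 5 → E3} (hx0 : ∀ i, x i ≠ 0) (hx : Function.Injective x)
    (hg : ∀ i j, x i - x j ∈ Λ) (hd : ∃ i, affMinor x (fun _ => 1) i ≠ 0) :
    405 / 8 * V ≤ (∑ i, ‖x i‖) ^ 3 ∧ (405 / 8 * V = (∑ i, ‖x i‖) ^ 3 →
      ∃ σ : Equiv.Perm (Fin 5), ∀ i j, ⟪x (σ i), x (σ j)⟫ =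
        (2 * (∑ i, ‖x i‖) / 45) ^ 2 * ⟪sqpVec i, sqpVec j⟫) := by
  have h : ∀ i, ∃ n : ℤ, affMinor x (fun _ => 1) i = n * V := by
    intro i
    obtain ⟨n, hn⟩ := hΛ _ (hg (i.succAbove 0) (i.succAbove 3)) _
      (hg (i.succAbove 1) (i.succAbove 3)) _ (hg (i.succAbove 2) (i.succAbove 3))
    refine ⟨(-1) ^ (i : ℕ) * n, ?_⟩
    rw [affMinor_eq_det3, hn]
    push_cast
    ring
  choose n hn using h
  refine _root_.five_vectors_bound hx0 hx hV hn ?_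
  obtain ⟨i, hi⟩ := hd
  refine ⟨i, fun h0 => hi ?_⟩
  rw [hn, h0]
  simp

/-- Three independent differences to a common vector `x o` use four indices. An arbitrary fifth
index is put in the last place, so the minor omitting it is the determinant of these differences. -/
theorem exists_injective_affMinor_ne_zero {k : ℕ} (hk : 5 ≤ k) {y z : Fin 0 → E3}
    {x : Fin k → E3} (hs : Submodule.span ℝ (edgeGens y z x) = ⊤) :
    ∃ g : Fin 5 → Fin k, Function.Injective g ∧ affMinor (x ∘ g) (fun _ => 1) 4 ≠ 0 := by
  let o : Fin k := ⟨0, by omega⟩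
  have hs' : Submodule.span ℝ (Set.range fun i => x i - x o) = ⊤ := by
    rw [eq_top_iff, ← hs, Submodule.span_le]
    rintro v ((⟨i, rfl⟩ | ⟨i, rfl⟩) | ⟨i, j, rfl⟩)
    · exact i.elim0
    · exact i.elim0
    · have hij : x i - x j = (x i - x o) - (x j - x o) := by abel
      rw [hij]
      exact Submodule.sub_mem _ (Submodule.subset_span ⟨i, rfl⟩)
        (Submodule.subset_span ⟨j, rfl⟩)
  obtain ⟨_, ⟨i, rfl⟩, _, ⟨j, rfl⟩, _, ⟨l, rfl⟩, h⟩ := exists_det3_ne_zero_triple hs'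
  obtain ⟨m, -, hm⟩ := Finset.exists_mem_notMem_of_card_lt_card
    (s := ({i, j, l, o} : Finset (Fin k))) (t := Finset.univ)
    (Finset.card_le_four.trans_lt (by simp; omega))
  simp only [Finset.mem_insert, Finset.mem_singleton, not_or] at hm
  obtain ⟨m1, m2, m3, m4⟩ := hm
  have hij : i ≠ j := by
    rintro rfl
    exact h (by simp only [det3]; ring)
  have hil : i ≠ l := by
    rintro rfl
    exact h (by simp only [det3]; ring)
  have hjl : j ≠ l := by
    rintro rfl
    exact h (by simp only [det3]; ring)
  have hio : i ≠ o := fun e => h (by simp [det3, e])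
  have hjo : j ≠ o := fun e => h (by simp [det3, e])
  have hlo : l ≠ o := fun e => h (by simp [det3, e])
  refine ⟨![i, j, l, o, m], ?_, ?_⟩
  · intro a b hab
    fin_cases a <;> fin_cases b <;> first | rfl | (exfalso; simp at hab; simp_all)
  · rw [affMinor_eq_det3]
    exact mul_ne_zero (by norm_num) h

theorem exists_perm_five_bound {Λ : Submodule ℤ E3} {V : ℝ} (hΛ : DetIntegral Λ V) (hV : 0 < V)
    {y z : Fin 0 → E3} {x : Fin 5 → E3} (hx0 : ∀ i, x i ≠ 0) (hx : Function.Injective x)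
    (hg : edgeGens y z x ⊆ Λ) (hs : Submodule.span ℝ (edgeGens y z x) = ⊤) :
    405 / 8 * V ≤ (∑ i, ‖y i‖ + ∑ i, ‖z i‖ + ∑ i, ‖x i‖) ^ 3 ∧
    (405 / 8 * V = (∑ i, ‖y i‖ + ∑ i, ‖z i‖ + ∑ i, ‖x i‖) ^ 3 →
      ∃ (σ : Equiv.Perm (Fin 5)) (c : ℝ), 0 < c ∧ ∀ i j,
        ⟪Sum.elim y (Sum.elim z (x ∘ σ)) i, Sum.elim y (Sum.elim z (x ∘ σ)) j⟫ =
        c ^ 2 * ⟪Sum.elim ![] (Sum.elim ![] sqpVec) i, Sum.elim ![] (Sum.elim ![] sqpVec) j⟫) := by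
  obtain ⟨g, hginj, hd⟩ := exists_injective_affMinor_ne_zero le_rfl hs
  let τ : Equiv.Perm (Fin 5) := Equiv.ofBijective g (Finite.injective_iff_bijective.1 hginj)
  obtain ⟨h1, h2⟩ := hΛ.five_vectors_bound hV (x := x ∘ g) (fun i => hx0 _) (hx.comp hginj)
    (fun i j => hg (Or.inr ⟨_, _, rfl⟩)) ⟨4, hd⟩
  have hsum : ∑ i, ‖(x ∘ g) i‖ = ∑ i, ‖x i‖ := Equiv.sum_comp τ fun i => ‖x i‖
  rw [hsum] at h1 h2
  have hX : 0 < ∑ i, ‖x i‖ :=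
    Finset.sum_pos (fun i _ => norm_pos_iff.2 (hx0 i)) ⟨0, Finset.mem_univ 0⟩
  simp only [Finset.univ_eq_empty, Finset.sum_empty, zero_add]
  refine ⟨h1, fun he => ?_⟩
  obtain ⟨σ, hσ⟩ := h2 he
  refine ⟨σ.trans τ, 2 * (∑ i, ‖x i‖) / 45, by positivity, ?_⟩
  rintro (i | i | i) (j | j | j)
  · exact i.elim0
  · exact i.elim0
  · exact i.elim0
  · exact i.elim0
  · exact i.elim0
  · exact i.elim0
  · exact j.elim0
  · exact j.elim0
  · exact hσ i j

/-! ### Three vectors and two loops -/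

/-- The edge vectors of the network `bnn`. -/
noncomputable def bnnVec : Fin 1 ⊕ Fin 1 ⊕ Fin 3 → E3 :=
  Sum.elim ![!₂[0, 0, 3 / 4]] (Sum.elim ![!₂[0, 0, 3 / 4]]
    ![!₂[1, 0, 0], !₂[-(1 / 2), √3 / 2, 0], !₂[-(1 / 2), -(√3 / 2), 0]])

theorem det_affMat_prism (y : E3) (x : Fin 3 → E3) :
    (affMat ![y, x 0, x 1, x 2] ![0, 1, 1, 1]).det = det3 y (x 1 - x 0) (x 2 - x 0) := by
  simp [Matrix.det_succ_row_zero, Fin.sum_univ_succ, affMat, det3, Fin.succAbove,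
    Matrix.submatrix]
  ring

/-- The weight of `y` is chosen such that `y` contributes `X / 2`. In the extremal prism the links
contribute `X / 2` to each of the two rows orthogonal to the axis, so the three coordinate rows are
balanced and the mean inequality is sharp. -/
theorem prism_weights {y : E3} (hy : y ≠ 0) {x : Fin 3 → E3} (hx : ∀ i, x i ≠ 0) :
    let X := ∑ i, ‖x i‖
    let ρ : Fin 4 → ℝ := ![2 * ‖y‖ ^ 2 / X, ‖x 0‖, ‖x 1‖, ‖x 2‖]
    (∀ i, 0 < ρ i) ∧ ∑ i, ‖(![y, x 0, x 1, x 2] : Fin 4 → E3) i‖ ^ 2 / ρ i = 3 * (X / 2) ∧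
    (∏ i, ρ i) * ∑ i, (![0, 1, 1, 1] : Fin 4 → ℝ) i ^ 2 / ρ i =
      2 * ‖y‖ ^ 2 / X * (‖x 0‖ * ‖x 1‖ + ‖x 0‖ * ‖x 2‖ + ‖x 1‖ * ‖x 2‖) := by
  have h0 := norm_pos_iff.2 (hx 0)
  have h1 := norm_pos_iff.2 (hx 1)
  have h2 := norm_pos_iff.2 (hx 2)
  have hy' := norm_pos_iff.2 hy
  simp only [Fin.sum_univ_three]
  refine ⟨?_, ?_, ?_⟩
  · intro i
    fin_cases i <;> simp <;> first | positivity | exact hx _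
  · simp [Fin.sum_univ_four]
    field_simp
    ring
  · simp [Fin.sum_univ_four, Fin.prod_univ_four]
    field_simp
    ring

theorem prism_det_sq_le {y : E3} (hy : y ≠ 0) {x : Fin 3 → E3} (hx : ∀ i, x i ≠ 0) :
    12 * det3 y (x 1 - x 0) (x 2 - x 0) ^ 2 ≤ ‖y‖ ^ 2 * (∑ i, ‖x i‖) ^ 4 := by
  have h0 := norm_pos_iff.2 (hx 0)
  have h1 := norm_pos_iff.2 (hx 1)
  have h2 := norm_pos_iff.2 (hx 2)
  obtain ⟨p1, p2, p3⟩ := prism_weights hy hx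
  have h := det_affMat_sq_le ![y, x 0, x 1, x 2] ![0, 1, 1, 1] _ p1
  rw [det_affMat_prism, p2, mul_left_comm, p3] at h
  have hX : 0 < ∑ i, ‖x i‖ := Finset.sum_pos (fun i _ => norm_pos_iff.2 (hx i)) ⟨0, by simp⟩
  have h3 : 3 * (‖x 0‖ * ‖x 1‖ + ‖x 0‖ * ‖x 2‖ + ‖x 1‖ * ‖x 2‖) ≤ (∑ i, ‖x i‖) ^ 2 := by
    rw [Fin.sum_univ_three]
    nlinarith [sq_nonneg (‖x 0‖ - ‖x 1‖), sq_nonneg (‖x 0‖ - ‖x 2‖), sq_nonneg (‖x 1‖ - ‖x 2‖)]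
  generalize ∑ i, ‖x i‖ = X at h hX h3 ⊢
  generalize ‖x 0‖ * ‖x 1‖ + ‖x 0‖ * ‖x 2‖ + ‖x 1‖ * ‖x 2‖ = e at h h3
  calc _ ≤ 12 * ((3 * (X / 2) / 3) ^ 3 * (2 * ‖y‖ ^ 2 / X * e)) :=
        mul_le_mul_of_nonneg_left h (by norm_num)
    _ = ‖y‖ ^ 2 * X ^ 2 * (3 * e) := by field_simp; ring
    _ ≤ ‖y‖ ^ 2 * X ^ 2 * X ^ 2 := mul_le_mul_of_nonneg_left h3 (by positivity)
    _ = _ := by ring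

theorem prism_inner_eq {y : E3} (hy : y ≠ 0) {x : Fin 3 → E3} (hx : ∀ i, x i ≠ 0)
    (hd : det3 y (x 1 - x 0) (x 2 - x 0) ≠ 0)
    (he : 12 * det3 y (x 1 - x 0) (x 2 - x 0) ^ 2 = ‖y‖ ^ 2 * (∑ i, ‖x i‖) ^ 4) :
    (∀ i, ⟪y, x i⟫ = 0) ∧
      ∀ i j, ⟪x i, x j⟫ = ((∑ i, ‖x i‖) / 3) ^ 2 * if i = j then 1 else -(1 / 2) := by
  have h0 := norm_pos_iff.2 (hx 0)
  have h1 := norm_pos_iff.2 (hx 1)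
  have h2 := norm_pos_iff.2 (hx 2)
  have hy' := norm_pos_iff.2 hy
  obtain ⟨p1, p2, p3⟩ := prism_weights hy hx
  have h := det_affMat_sq_le ![y, x 0, x 1, x 2] ![0, 1, 1, 1] _ p1
  have heq := inner_eq_of_det_affMat_sq_eq ![y, x 0, x 1, x 2] ![0, 1, 1, 1] _ p1
    (by rw [det_affMat_prism]; exact hd)
  rw [det_affMat_prism, p2, mul_left_comm, p3] at h heq
  have hX : 0 < ∑ i, ‖x i‖ := Finset.sum_pos (fun i _ => norm_pos_iff.2 (hx i)) ⟨0, by simp⟩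
  have hXs := Fin.sum_univ_three (fun i => ‖x i‖)
  have hW (X : ℝ) (hX : X ≠ 0) (r0 : ‖x 0‖ = X / 3) (r1 : ‖x 1‖ = X / 3) (r2 : ‖x 2‖ = X / 3) :
      ∑ i, (![0, 1, 1, 1] : Fin 4 → ℝ) i ^ 2 /
      (![2 * ‖y‖ ^ 2 / X, ‖x 0‖, ‖x 1‖, ‖x 2‖] : Fin 4 → ℝ) i = 9 / X := by
    simp [Fin.sum_univ_four, r0, r1, r2]
    field_simp
    norm_num
  generalize ∑ i, ‖x i‖ = X at h heq hX he hXs ⊢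
  obtain ⟨e, hedef⟩ : ∃ e, e = ‖x 0‖ * ‖x 1‖ + ‖x 0‖ * ‖x 2‖ + ‖x 1‖ * ‖x 2‖ := ⟨_, rfl⟩
  rw [← hedef] at h heq
  have hr : (3 * (X / 2) / 3) ^ 3 * (2 * ‖y‖ ^ 2 / X * e) = ‖y‖ ^ 2 * X ^ 2 * e / 4 := by
    field_simp
    ring
  rw [hr] at h heq
  have hyX : 0 < ‖y‖ ^ 2 * X ^ 2 := by positivity
  have h4 : X ^ 2 ≤ 3 * e := by
    have : ‖y‖ ^ 2 * X ^ 2 * X ^ 2 ≤ ‖y‖ ^ 2 * X ^ 2 * (3 * e) := by linarith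
    exact le_of_mul_le_mul_left this hyX
  have h5 : (‖x 0‖ - ‖x 1‖) ^ 2 + (‖x 0‖ - ‖x 2‖) ^ 2 + (‖x 1‖ - ‖x 2‖) ^ 2 ≤ 0 := by
    rw [hedef, hXs] at h4
    linarith
  have h6 : (‖x 0‖ - ‖x 1‖) ^ 2 = 0 := by
    nlinarith [sq_nonneg (‖x 0‖ - ‖x 1‖), sq_nonneg (‖x 0‖ - ‖x 2‖), sq_nonneg (‖x 1‖ - ‖x 2‖)]
  have h7 : (‖x 0‖ - ‖x 2‖) ^ 2 = 0 := by
    nlinarith [sq_nonneg (‖x 0‖ - ‖x 1‖), sq_nonneg (‖x 0‖ - ‖x 2‖), sq_nonneg (‖x 1‖ - ‖x 2‖)]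
  have h8 := pow_eq_zero_iff two_ne_zero |>.1 h6
  have h9 := pow_eq_zero_iff two_ne_zero |>.1 h7
  have r0 : ‖x 0‖ = X / 3 := by linarith
  have r1 : ‖x 1‖ = X / 3 := by linarith
  have r2 : ‖x 2‖ = X / 3 := by linarith
  have hee : e = X ^ 2 / 3 := by rw [hedef, r0, r1, r2]; ring
  have key := heq (by rw [hee]; linarith)
  rw [hW X hX.ne' r0 r1 r2] at key
  constructor
  · intro i
    fin_cases i
    · simpa [hX.ne'] using key 0 1
    · simpa [hX.ne'] using key 0 2
    · simpa [hX.ne'] using key 0 3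
  · intro i j
    have := key i.succ j.succ
    fin_cases i <;> fin_cases j <;> simp [r0, r1, r2] at this ⊢ <;>
      field_simp at this ⊢ <;> linarith

/-! ### Tripods and loops parallel to the plane of the links -/

theorem sqrt_three_lt_two : √3 < 2 := by
  rw [Real.sqrt_lt' (by norm_num)]
  norm_num

/-- The length of a tripod is bounded below by the base and the height of the spanned triangle. -/
theorem tripod_length_ge {a b c w : E3} {s : ℝ} (hab : a ≠ b) (hw : w ≠ 0)
    (hc : c - a = s • (a - b) + w) (hort : ⟪a - b, w⟫ = 0) :
    ‖w‖ + √3 / 2 * ‖a - b‖ ≤ ‖a‖ + ‖b‖ + ‖c‖ := by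
  have hf : 0 < ‖a - b‖ := norm_pos_iff.2 (sub_ne_zero.2 hab)
  have hh : 0 < ‖w‖ := norm_pos_iff.2 hw
  have h3 : √3 * √3 = 3 := Real.mul_self_sqrt (by norm_num)
  set e : E3 := ‖a - b‖⁻¹ • (a - b)
  set n : E3 := ‖w‖⁻¹ • w
  have he : ⟪e, e⟫ = 1 := by
    simp only [e, real_inner_smul_left, real_inner_smul_right]
    rw [real_inner_self_eq_norm_sq]
    field_simp
  have hn : ⟪n, n⟫ = 1 := by
    simp only [n, real_inner_smul_left, real_inner_smul_right]
    rw [real_inner_self_eq_norm_sq]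
    field_simp
  have hen : ⟪e, n⟫ = 0 := by
    simp only [e, n, real_inner_smul_left, real_inner_smul_right, hort, mul_zero]
  have hu : ∀ t : ℝ, t * t = 3 / 4 → ‖t • e - (1 / 2 : ℝ) • n‖ = 1 := by
    intro t ht
    rw [← sq_eq_sq₀ (norm_nonneg _) zero_le_one, ← real_inner_self_eq_norm_sq]
    simp only [inner_sub_left, inner_sub_right, real_inner_smul_left, real_inner_smul_right,
      he, hn, hen, real_inner_comm e n]
    linear_combination ht
  have hn1 : ‖n‖ = 1 := by
    rw [← sq_eq_sq₀ (norm_nonneg _) zero_le_one, ← real_inner_self_eq_norm_sq, hn, one_pow]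
  -- The unit vectors `n` and `±(√3 / 2) • e - (1 / 2) • n` have sum zero and pairwise angles of 120
  -- degrees. Pairing them with `c`, `a`, `b` bounds the lengths below by an expression that depends
  -- only on differences, as in the calibration of a Steiner tree.
  have i1 := real_inner_le_norm a ((√3 / 2) • e - (1 / 2 : ℝ) • n)
  have i2 := real_inner_le_norm b ((-(√3 / 2)) • e - (1 / 2 : ℝ) • n)
  have i3 := real_inner_le_norm c n
  rw [hu _ (by linear_combination h3 / 4), mul_one] at i1
  rw [hu _ (by linear_combination h3 / 4), mul_one] at i2
  rw [hn1, mul_one] at i3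
  simp only [inner_sub_right, real_inner_smul_right] at i1 i2
  have k1 : ⟪a, e⟫ - ⟪b, e⟫ = ‖a - b‖ := by
    rw [← inner_sub_left]
    simp only [e, real_inner_smul_right, real_inner_self_eq_norm_sq]
    field_simp
  have k2 : ⟪a, n⟫ - ⟪b, n⟫ = 0 := by
    rw [← inner_sub_left]
    simp only [n, real_inner_smul_right, hort, mul_zero]
  have k3 : ⟪c, n⟫ - ⟪a, n⟫ = ‖w‖ := by
    rw [← inner_sub_left, hc, inner_add_left, real_inner_smul_left]
    simp only [n, real_inner_smul_right, hort, mul_zero, real_inner_self_eq_norm_sq]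
    field_simp
    ring
  have k4 : √3 / 2 * (⟪a, e⟫ - ⟪b, e⟫) = √3 / 2 * ‖a - b‖ := by rw [k1]
  linarith

/-- The case where a loop is parallel to the base of the triangle. -/
theorem parallel_loop_bound {Λ : Submodule ℤ E3} {V : ℝ} (hΛ : DetIntegral Λ V) (hV : 0 < V)
    {y z a b c : E3} (hy : y ∈ Λ) (hz : z ∈ Λ) (h1 : a - b ∈ Λ) (h2 : c - a ∈ Λ) (hab : a ≠ b)
    (d1 : det3 y z (a - b) = 0) (d2 : det3 y z (c - a) ≠ 0)
    (d3 : det3 z (a - b) (c - a) = 0) :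
    27 * √3 * V < (‖y‖ + ‖z‖ + (‖a‖ + ‖b‖ + ‖c‖)) ^ 3 := by
  obtain ⟨f, hf⟩ : ∃ f, f = a - b := ⟨_, rfl⟩
  have hfn : f ≠ 0 := hf ▸ sub_ne_zero.2 hab
  have hfp : 0 < ‖f‖ := norm_pos_iff.2 hfn
  -- `a - b` is a multiple of `z`
  have hcr := det3_smul_eq y z (c - a) f
  have e1 : det3 f z (c - a) = 0 := by
    rw [det3_swap, hf, d3, neg_zero]
  rw [e1, hf, d1, zero_smul, zero_smul, zero_add, add_zero, ← hf] at hcr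
  have hdf : det3 y f (c - a) ≠ 0 := by
    intro h0
    rw [h0, zero_smul] at hcr
    simp [d2, hfn] at hcr
  -- the component of `c - a` orthogonal to `f`
  set s := ⟪f, c - a⟫ / ‖f‖ ^ 2
  obtain ⟨w, hw⟩ : ∃ w, w = (c - a) - s • f := ⟨_, rfl⟩
  have hort : ⟪f, w⟫ = 0 := by
    rw [hw, inner_sub_right, real_inner_smul_right, real_inner_self_eq_norm_sq]
    simp only [s]
    rw [div_mul_cancel₀ _ (pow_ne_zero 2 hfp.ne'), sub_self]
  have hyf : det3 y f w = det3 y f (c - a) := by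
    rw [hw]
    simp only [det3, PiLp.sub_apply, PiLp.smul_apply, smul_eq_mul]
    ring
  have hyz : det3 y z w = det3 y z (c - a) := by
    have : det3 y z (s • f) = 0 := by
      have := (det3Lin y z).map_smul s f
      simp only [det3Lin, LinearMap.coe_mk, AddHom.coe_mk] at this
      rw [this, hf, d1, smul_zero]
    have h := (det3Lin y z).map_sub (c - a) (s • f)
    simp only [det3Lin, LinearMap.coe_mk, AddHom.coe_mk] at h
    rw [hw, h, this, sub_zero]
  have hw0 : w ≠ 0 := by
    rintro rfl
    apply hdf
    rw [← hyf]
    simp [det3]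
  have hX := tripod_length_ge (c := c) hab hw0 (s := s) (by rw [hw, ← hf]; abel) (by rw [← hf]; exact hort)
  rw [← hf] at hX
  -- The altitude `w` differs from `c - a` by a multiple of `f`, which is parallel to `z`. So `w`
  -- may replace `c - a` in both determinants, and each of `z` and `f` yields a bound with the same
  -- two other factors.
  have b1 : V ≤ ‖y‖ * ‖z‖ * ‖w‖ :=
    (hΛ.le_abs hV hy hz h2 d2).trans (hyz ▸ abs_det3_le y z w)
  have b2 : V ≤ ‖y‖ * ‖f‖ * ‖w‖ :=
    (hΛ.le_abs hV hy (hf ▸ h1) h2 hdf).trans (hyf ▸ abs_det3_le y f w)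
  have h3 := sqrt_three_lt_two
  have h30 : 0 ≤ √3 := Real.sqrt_nonneg 3
  have hcube := mul_mul_le_cube (norm_nonneg y) (norm_nonneg w)
    (c := ‖z‖ + √3 / 2 * ‖f‖) (by positivity)
  have b3 : √3 / 2 * V ≤ √3 / 2 * (‖y‖ * ‖f‖ * ‖w‖) := by gcongr
  -- This is where the estimate becomes strict: `√3 < 1 + √3 / 2` because `√3 < 2`.
  have hlt : √3 * V < (1 + √3 / 2) * V := by
    apply mul_lt_mul_of_pos_right _ hV
    linarith
  calc 27 * √3 * V < 27 * ((1 + √3 / 2) * V) := by linarith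
    _ ≤ 27 * (‖y‖ * ‖w‖ * (‖z‖ + √3 / 2 * ‖f‖)) := by linarith
    _ ≤ _ := hcube
    _ ≤ _ := by
      refine pow_le_pow_left₀ (by positivity) ?_ 3
      linarith

/-- The case of an even determinant. -/
theorem double_det_bound {V : ℝ} (hV : 0 < V) {y z a b : E3} {n : ℤ}
    (hn : det3 y z (a - b) = n * V) (h2 : 2 ≤ |n|) {r : ℝ} (hr : 0 ≤ r) :
    27 * √3 * V < (‖y‖ + ‖z‖ + (‖a‖ + ‖b‖ + r)) ^ 3 := by
  have h1 := abs_det3_le y z (a - b)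
  rw [hn, abs_mul, abs_of_pos hV] at h1
  have h3 : (2 : ℝ) ≤ |(n : ℝ)| := by exact_mod_cast h2
  have h4 := norm_sub_le a b
  have h5 := mul_mul_le_cube (norm_nonneg y) (norm_nonneg z) (norm_nonneg (a - b))
  have h6 := sqrt_three_lt_two
  calc 27 * √3 * V < 27 * (2 * V) := by nlinarith
    _ ≤ 27 * (‖y‖ * ‖z‖ * ‖a - b‖) := by nlinarith
    _ ≤ _ := h5
    _ ≤ _ := by
      refine pow_le_pow_left₀ (by positivity) ?_ 3
      linarith

/-- The integers `p`, `q`, `p - q` measure the three sides of the triangle against `y` and `z`. They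
do not all vanish, since the vectors span. If one of them is zero, that side is parallel to `z` and
`parallel_loop_bound` applies; if none is, one has absolute value at least 2 and `double_det_bound`
applies. -/
theorem degenerate_loop_bound {Λ : Submodule ℤ E3} {V : ℝ} (hΛ : DetIntegral Λ V) (hV : 0 < V)
    {y z a b c : E3} (hz0 : z ≠ 0) (hy : y ∈ Λ) (hz : z ∈ Λ) (hba : b - a ∈ Λ) (hca : c - a ∈ Λ)
    (hab : a ≠ b) (hac : a ≠ c) (hbc : b ≠ c)
    (hs : Submodule.span ℝ {y, z, b - a, c - a} = ⊤) (h0 : det3 z (b - a) (c - a) = 0) :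
    27 * √3 * V < (‖y‖ + ‖z‖ + (‖a‖ + ‖b‖ + ‖c‖)) ^ 3 := by
  obtain ⟨p, hp⟩ := hΛ y hy z hz _ hba
  obtain ⟨q, hq⟩ := hΛ y hy z hz _ hca
  have hpq : det3 y z (b - c) = ((p - q : ℤ) : ℝ) * V := by
    push_cast
    rw [sub_mul, ← hp, ← hq]
    simp [det3]
    ring
  have hab' : a - b ∈ Λ := by simpa using Λ.neg_mem hba
  have hbc' : b - c ∈ Λ := by
    have := Λ.sub_mem hba hca
    rwa [sub_sub_sub_cancel_right] at this
  by_cases hp0 : p = 0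
  · by_cases hq0 : q = 0
    · exfalso
      rw [hp0, Int.cast_zero, zero_mul] at hp
      rw [hq0, Int.cast_zero, zero_mul] at hq
      have hD : det3 y (b - a) (c - a) = 0 := by
        by_contra hD
        have := det3_smul_eq y (b - a) (c - a) z
        have e : det3 y (b - a) z = 0 := by
          rw [← det3_rotate y, det3_swap, ← det3_rotate, ← det3_rotate, hp, neg_zero]
        rw [h0, hq, e] at this
        simp [hD, hz0] at this
      -- Up to permutation and sign there are only four determinants of distinct generators, and all
      -- of them vanish.
      obtain ⟨u, hu, v, hv, w, hw, h1⟩ := exists_det3_ne_zero_triple hs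
      apply h1
      simp only [Set.mem_insert_iff, Set.mem_singleton_iff] at hu hv hw
      generalize b - a = f at *
      generalize c - a = g at *
      rcases hu with rfl | rfl | rfl | rfl <;> rcases hv with rfl | rfl | rfl | rfl <;>
        rcases hw with rfl | rfl | rfl | rfl <;> simp only [det3] at * <;>
        first
        | ring1
        | linear_combination h0
        | linear_combination hp
        | linear_combination hq
        | linear_combination hD
        | linear_combination -h0
        | linear_combination -hp
        | linear_combination -hq
        | linear_combination -hD
    · rw [hp0, Int.cast_zero, zero_mul] at hp
      have e : ‖a‖ + ‖b‖ + ‖c‖ = ‖b‖ + ‖a‖ + ‖c‖ := by ring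
      rw [e]
      have hcb : det3 y z (c - b) = (q : ℝ) * V := by
        rw [hp0] at hpq
        push_cast at hpq
        have : det3 y z (c - b) = -det3 y z (b - c) := by simp [det3]; ring
        rw [this, hpq]
        ring
      refine parallel_loop_bound hΛ hV hy hz hba (by simpa using Λ.neg_mem hbc') hab.symm hp ?_ ?_
      · rw [hcb]
        exact mul_ne_zero (by exact_mod_cast hq0) hV.ne'
      · rw [← h0]
        simp [det3]
        ring
  · by_cases hq0 : q = 0
    · rw [hq0, Int.cast_zero, zero_mul] at hq
      have e : ‖a‖ + ‖b‖ + ‖c‖ = ‖c‖ + ‖a‖ + ‖b‖ := by ring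
      rw [e]
      refine parallel_loop_bound hΛ hV hy hz hca hbc' hac.symm hq ?_ ?_
      · rw [hpq, hq0, sub_zero]
        exact mul_ne_zero (by exact_mod_cast hp0) hV.ne'
      · simp only [det3, PiLp.sub_apply] at h0 ⊢
        linear_combination -h0
    · by_cases hpq0 : p = q
      · rw [hpq0, sub_self, Int.cast_zero, zero_mul] at hpq
        have e : ‖a‖ + ‖b‖ + ‖c‖ = ‖b‖ + ‖c‖ + ‖a‖ := by ring
        rw [e]
        have hab2 : det3 y z (a - b) = -(p : ℝ) * V := by
          have : det3 y z (a - b) = -det3 y z (b - a) := by simp [det3]; ring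
          rw [this, hp]
          ring
        refine parallel_loop_bound hΛ hV hy hz hbc' hab' hbc hpq ?_ ?_
        · rw [hab2]
          exact mul_ne_zero (by simpa using hp0) hV.ne'
        · simp only [det3, PiLp.sub_apply] at h0 ⊢
          linear_combination -h0
      · have hbig : 2 ≤ |p| ∨ 2 ≤ |q| ∨ 2 ≤ |p - q| := by
          simp only [le_abs]
          omega
        rcases hbig with h | h | h
        · have := double_det_bound hV hp h (norm_nonneg c)
          have e : ‖a‖ + ‖b‖ + ‖c‖ = ‖b‖ + ‖a‖ + ‖c‖ := by ring
          rwa [e]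
        · have := double_det_bound hV hq h (norm_nonneg b)
          have e : ‖a‖ + ‖b‖ + ‖c‖ = ‖c‖ + ‖a‖ + ‖b‖ := by ring
          rwa [e]
        · have := double_det_bound hV hpq h (norm_nonneg a)
          have e : ‖a‖ + ‖b‖ + ‖c‖ = ‖b‖ + ‖c‖ + ‖a‖ := by ring
          rwa [e]

theorem prism_sqrt_bound {Λ : Submodule ℤ E3} {V : ℝ} (hΛ : DetIntegral Λ V) (hV : 0 < V)
    {y : E3} {x : Fin 3 → E3} (hy : y ∈ Λ) (h1 : x 1 - x 0 ∈ Λ) (h2 : x 2 - x 0 ∈ Λ)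
    (hx : ∀ i, x i ≠ 0) (hd : det3 y (x 1 - x 0) (x 2 - x 0) ≠ 0) :
    2 * √3 * V ≤ ‖y‖ * (∑ i, ‖x i‖) ^ 2 ∧ (2 * √3 * V = ‖y‖ * (∑ i, ‖x i‖) ^ 2 →
      |det3 y (x 1 - x 0) (x 2 - x 0)| = V ∧ (∀ i, ⟪y, x i⟫ = 0) ∧
      ∀ i j, ⟪x i, x j⟫ = ((∑ i, ‖x i‖) / 3) ^ 2 * if i = j then 1 else -(1 / 2)) := by
  have hy0 : y ≠ 0 := by
    rintro rfl
    simp [det3] at hd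
  have h3 := prism_det_sq_le hy0 hx
  have h4 := hΛ.le_abs hV hy h1 h2 hd
  have h5 : √3 * √3 = 3 := Real.mul_self_sqrt (by norm_num)
  have h6 : (2 * √3 * V) ^ 2 = 12 * V ^ 2 := by linear_combination 4 * V ^ 2 * h5
  have h7 : V ^ 2 ≤ det3 y (x 1 - x 0) (x 2 - x 0) ^ 2 := by
    rw [← sq_abs (det3 _ _ _)]
    gcongr
  refine ⟨(abs_le_of_sq_le_sq' ?_ (by positivity)).2, fun he => ?_⟩
  · calc _ = 12 * V ^ 2 := h6
      _ ≤ ‖y‖ ^ 2 * (∑ i, ‖x i‖) ^ 4 := by linarith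
      _ = _ := by ring
  · have h8 : ‖y‖ ^ 2 * (∑ i, ‖x i‖) ^ 4 = 12 * V ^ 2 := by
      rw [← h6, he]
      ring
    have h9 : det3 y (x 1 - x 0) (x 2 - x 0) ^ 2 = V ^ 2 := by linarith
    refine ⟨?_, prism_inner_eq hy0 hx hd (by linarith)⟩
    rw [← abs_of_pos hV]
    exact (sq_eq_sq_iff_abs_eq_abs _ _).1 h9

/-- If neither loop is parallel to the plane of the links, the two prism bounds add up to `4 * √3 *
V ≤ (‖y 0‖ + ‖z 0‖) * X ^ 2`, and the mean inequality for `X / 2`, `X / 2`, `‖y 0‖ + ‖z 0‖` gives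
the constant. Equality makes the loops equal up to sign; the sign `ε` reflects that loops have no
preferred orientation. -/
theorem loop_loop_three_bound {Λ : Submodule ℤ E3} {V : ℝ} (hΛ : DetIntegral Λ V) (hV : 0 < V)
    {y z : Fin 1 → E3} {x : Fin 3 → E3} (hy : ∀ i, y i ≠ 0) (hz : ∀ i, z i ≠ 0)
    (hx : ∀ i, x i ≠ 0) (hxi : Function.Injective x)
    (hg : edgeGens y z x ⊆ Λ) (hs : Submodule.span ℝ (edgeGens y z x) = ⊤) :
    27 * √3 * V ≤ (∑ i, ‖y i‖ + ∑ i, ‖z i‖ + ∑ i, ‖x i‖) ^ 3 ∧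
    (27 * √3 * V = (∑ i, ‖y i‖ + ∑ i, ‖z i‖ + ∑ i, ‖x i‖) ^ 3 →
      ∃ ε : ℝ, (ε = 1 ∨ ε = -1) ∧ ∃ c : ℝ, 0 < c ∧ ∀ i j,
        ⟪Sum.elim y (Sum.elim (ε • z) x) i, Sum.elim y (Sum.elim (ε • z) x) j⟫ =
          c ^ 2 * ⟪bnnVec i, bnnVec j⟫) := by
  have hs' : Submodule.span ℝ {y 0, z 0, x 1 - x 0, x 2 - x 0} = ⊤ := by
    rw [eq_top_iff, ← span_insert_eq_top_of_edgeGens hs, Submodule.span_le]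
    rintro v ((rfl | rfl) | ⟨i, rfl⟩)
    · exact Submodule.subset_span (by simp)
    · exact Submodule.subset_span (by simp)
    · fin_cases i
      · simp
      · exact Submodule.subset_span (by simp)
      · exact Submodule.subset_span (by simp)
  have hyΛ : y 0 ∈ Λ := hg (Or.inl (Or.inl ⟨0, rfl⟩))
  have hzΛ : z 0 ∈ Λ := hg (Or.inl (Or.inr ⟨0, rfl⟩))
  have h1Λ : x 1 - x 0 ∈ Λ := hg (Or.inr ⟨1, 0, rfl⟩)
  have h2Λ : x 2 - x 0 ∈ Λ := hg (Or.inr ⟨2, 0, rfl⟩)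
  have h01 : x 0 ≠ x 1 := fun h => absurd (hxi h) (by decide)
  have h02 : x 0 ≠ x 2 := fun h => absurd (hxi h) (by decide)
  have h12 : x 1 ≠ x 2 := fun h => absurd (hxi h) (by decide)
  simp only [Finset.univ_unique, Fin.default_eq_zero, Finset.sum_singleton]
  by_cases dz : det3 (z 0) (x 1 - x 0) (x 2 - x 0) = 0
  · have := degenerate_loop_bound hΛ hV (hz 0) hyΛ hzΛ h1Λ h2Λ h01 h02 h12 hs' dz
    rw [Fin.sum_univ_three]
    exact ⟨this.le, fun h => absurd h this.ne⟩
  by_cases dy : det3 (y 0) (x 1 - x 0) (x 2 - x 0) = 0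
  · have := degenerate_loop_bound hΛ hV (hy 0) hzΛ hyΛ h1Λ h2Λ h01 h02 h12
      (by rw [Set.insert_comm]; exact hs') dy
    rw [Fin.sum_univ_three, add_comm ‖y 0‖]
    exact ⟨this.le, fun h => absurd h this.ne⟩
  obtain ⟨by1, by2⟩ := prism_sqrt_bound hΛ hV hyΛ h1Λ h2Λ hx dy
  obtain ⟨bz1, bz2⟩ := prism_sqrt_bound hΛ hV hzΛ h1Λ h2Λ hx dz
  have hX : 0 < ∑ i, ‖x i‖ := Finset.sum_pos (fun i _ => norm_pos_iff.2 (hx i)) ⟨0, by simp⟩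
  have py := norm_pos_iff.2 (hy 0)
  have pz := norm_pos_iff.2 (hz 0)
  generalize hXdef : ∑ i, ‖x i‖ = X at *
  have hc := mul_mul_le_cube (a := X / 2) (b := X / 2) (c := ‖y 0‖ + ‖z 0‖) (by positivity)
    (by positivity) (by positivity)
  have hsum : X / 2 + X / 2 + (‖y 0‖ + ‖z 0‖) = ‖y 0‖ + ‖z 0‖ + X := by ring
  rw [hsum] at hc
  refine ⟨by linarith, fun he => ?_⟩
  have ey : 2 * √3 * V = ‖y 0‖ * X ^ 2 := by linarith
  have ez : 2 * √3 * V = ‖z 0‖ * X ^ 2 := by linarith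
  obtain ⟨ay, oy, gx⟩ := by2 ey
  obtain ⟨az, oz, -⟩ := bz2 ez
  have hyz : ‖y 0‖ = ‖z 0‖ := mul_right_cancel₀ (pow_ne_zero 2 hX.ne') (ey.symm.trans ez)
  obtain ⟨-, hXy⟩ := eq_of_mul_mul_eq_cube (a := X / 2) (b := X / 2) (c := ‖y 0‖ + ‖z 0‖)
    (by positivity) (by positivity) (by positivity) (by rw [hsum]; linarith)
  have hny : ‖y 0‖ = X / 4 := by linarith
  have hpm : det3 (y 0) (x 1 - x 0) (x 2 - x 0) = det3 (z 0) (x 1 - x 0) (x 2 - x 0) ∨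
      det3 (y 0) (x 1 - x 0) (x 2 - x 0) = -det3 (z 0) (x 1 - x 0) (x 2 - x 0) :=
    abs_eq_abs.1 (ay.trans az.symm)
  have hcr := det3_smul_eq (y 0) (x 1 - x 0) (x 2 - x 0) (z 0)
  have hpar : det3 (y 0) (x 1 - x 0) (x 2 - x 0) • z 0 =
      det3 (z 0) (x 1 - x 0) (x 2 - x 0) • y 0 := by
    rw [← sub_eq_zero]
    -- The difference of the two sides is a combination of link differences, yet orthogonal to all
    -- links. Hence it is orthogonal to itself.
    have hu : det3 (y 0) (x 1 - x 0) (x 2 - x 0) • z 0 -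
      det3 (z 0) (x 1 - x 0) (x 2 - x 0) • y 0 = det3 (y 0) (z 0) (x 2 - x 0) • (x 1 - x 0) +
        det3 (y 0) (x 1 - x 0) (z 0) • (x 2 - x 0) := by
      rw [hcr]
      abel
    rw [← inner_self_eq_zero (𝕜 := ℝ)]
    nth_rewrite 2 [hu]
    simp only [inner_sub_left, inner_add_right, inner_sub_right, real_inner_smul_left,
      real_inner_smul_right, oy, oz]
    ring
  obtain ⟨ε, hε, hzy⟩ : ∃ ε : ℝ, (ε = 1 ∨ ε = -1) ∧ ε • z 0 = y 0 := by
    rcases hpm with h | h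
    · refine ⟨1, Or.inl rfl, ?_⟩
      rw [h] at hpar
      rw [one_smul]
      exact smul_right_injective _ dz hpar
    · refine ⟨-1, Or.inr rfl, ?_⟩
      rw [h, neg_smul, ← smul_neg] at hpar
      rw [neg_smul, one_smul]
      exact smul_right_injective _ dz hpar
  refine ⟨ε, hε, X / 3, by positivity, ?_⟩
  have h3 : √3 * √3 = 3 := Real.mul_self_sqrt (by norm_num)
  have oy' : ∀ i, ⟪x i, y 0⟫ = 0 := fun i => by rw [real_inner_comm, oy]
  rintro (i | i | i) (j | j | j)
  all_goals
    first
    | rw [Subsingleton.elim i 0]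
    | skip
  all_goals
    first
    | rw [Subsingleton.elim j 0]
    | skip
  all_goals simp only [Sum.elim_inl, Sum.elim_inr, Pi.smul_apply, hzy, oy, oy', gx, inner_E3 (bnnVec _), 
    real_inner_self_eq_norm_sq, hny]
  · simp [bnnVec]; ring
  · simp [bnnVec]; ring
  · fin_cases j <;> simp [bnnVec]
  · simp [bnnVec]; ring
  · simp [bnnVec]; ring
  · fin_cases j <;> simp [bnnVec]
  · fin_cases i <;> simp [bnnVec]
  · fin_cases i <;> simp [bnnVec]
  · fin_cases i <;> fin_cases j <;> simp [bnnVec] <;> field_simp <;> nlinarith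

/-! ### Strict bounds for large degree -/

theorem exists_notMem_of_card_lt {k : ℕ} (s : Finset (Fin k)) (h : s.card < k) : ∃ m, m ∉ s := by
  obtain ⟨m, -, hm⟩ := Finset.exists_mem_notMem_of_card_lt_card (s := s) (t := Finset.univ)
    (by simpa using h)
  exact ⟨m, hm⟩

/-- Since 54 exceeds `405 / 8`, `DetIntegral.four_bound` suffices in large degree as soon as a basis
and a spare lattice vector can be built from disjoint sets of edges. Here both consist of loops. -/
theorem loops_bound {Λ : Submodule ℤ E3} {V : ℝ} (hΛ : DetIntegral Λ V) (hV : 0 < V)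
    {ℓ : ℕ} (hℓ : 4 ≤ ℓ) {y : Fin ℓ → E3} (hy : ∀ i, y i ≠ 0) (hg : ∀ i, y i ∈ Λ)
    (hs : Submodule.span ℝ (Set.range y) = ⊤) : 54 * V ≤ (∑ i, ‖y i‖) ^ 3 := by
  obtain ⟨_, ⟨i, rfl⟩, _, ⟨j, rfl⟩, _, ⟨l, rfl⟩, h⟩ := exists_det3_ne_zero_triple hs
  obtain ⟨m, hm⟩ := exists_notMem_of_card_lt {i, j, l}
    (lt_of_le_of_lt Finset.card_le_three (by omega))
  simp only [Finset.mem_insert, Finset.mem_singleton, not_or] at hm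
  have hij : i ≠ j := by
    rintro rfl
    exact h (by simp only [det3]; ring)
  have hil : i ≠ l := by
    rintro rfl
    exact h (by simp only [det3]; ring)
  have hjl : j ≠ l := by
    rintro rfl
    exact h (by simp only [det3]; ring)
  have h1 := hΛ.four_bound hV (hg i) (hg j) (hg l) (hg m) h (hy m)
  refine h1.trans (pow_le_pow_left₀ (by positivity) ?_ 3)
  have hinj : Function.Injective ![i, j, l, m] := by
    intro a b hab
    fin_cases a <;> fin_cases b <;> first | rfl | (exfalso; simp at hab; simp_all)
  have := sum_comp_le_sum (fun i => ‖y i‖) (fun i => norm_nonneg _) hinj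
  simpa [Fin.sum_univ_four] using this

/-- Total length of a configuration of edge vectors. -/
noncomputable def totalLength {ℓ k : ℕ} (y z : Fin ℓ → E3) (x : Fin k → E3) : ℝ :=
  ∑ i, ‖y i‖ + ∑ i, ‖z i‖ + ∑ i, ‖x i‖

/-- The two independent loops at one vertex are completed to a basis by a generator of the lattice,
and the spare vector is a loop at the other vertex which that generator does not use. -/
theorem two_loops_bound {Λ : Submodule ℤ E3} {V : ℝ} (hΛ : DetIntegral Λ V) (hV : 0 < V)
    {ℓ k : ℕ} {y z : Fin ℓ → E3} {x : Fin k → E3} (hz : ∀ i, z i ≠ 0) {i j : Fin ℓ}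
    (hy : LinearIndependent ℝ ![y i, y j])
    (hg : edgeGens y z x ⊆ Λ) (hs : Submodule.span ℝ (edgeGens y z x) = ⊤) :
    54 * V ≤ totalLength y z x ^ 3 := by
  have hij : i ≠ j := by
    rintro rfl
    have := hy.injective.eq_iff (a := 0) (b := 1)
    simp at this
  have hyΛ : ∀ i, y i ∈ Λ := fun i => hg (Or.inl (Or.inl ⟨i, rfl⟩))
  have hzΛ : ∀ i, z i ∈ Λ := fun i => hg (Or.inl (Or.inr ⟨i, rfl⟩))
  obtain ⟨c, hc⟩ := exists_det3_ne_zero_of_linearIndependent hy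
  obtain ⟨g, hgm, hd⟩ := exists_det3_ne_zero_of_span hc hs
  have hgΛ := hg hgm
  have hpair : ∀ (f : Fin ℓ → E3) (a b : Fin ℓ), a ≠ b → ‖f a‖ + ‖f b‖ ≤ ∑ i, ‖f i‖ := by
    intro f a b hab
    have hinj : Function.Injective ![a, b] := by
      intro u v huv
      fin_cases u <;> fin_cases v <;> simp_all
    simpa using sum_comp_le_sum (fun i => ‖f i‖) (fun i => norm_nonneg _) hinj
  have hyn : 0 ≤ ∑ i, ‖y i‖ := Finset.sum_nonneg fun i _ => norm_nonneg _
  have hzn : 0 ≤ ∑ i, ‖z i‖ := Finset.sum_nonneg fun i _ => norm_nonneg _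
  have hxn : 0 ≤ ∑ i, ‖x i‖ := Finset.sum_nonneg fun i _ => norm_nonneg _
  have hzi : ∀ a, ‖z a‖ ≤ ∑ i, ‖z i‖ := fun a =>
    Finset.single_le_sum (f := fun i => ‖z i‖) (fun i _ => norm_nonneg _) (Finset.mem_univ a)
  unfold totalLength
  rcases hgm with (⟨m, rfl⟩ | ⟨m, rfl⟩) | ⟨a, b, rfl⟩
  · refine (hΛ.four_bound hV (hyΛ i) (hyΛ j) hgΛ (hzΛ i) hd (hz i)).trans
      (pow_le_pow_left₀ (by positivity) ?_ 3)
    have hmi : m ≠ i := by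
      rintro rfl
      exact hd (by simp only [det3]; ring)
    have hmj : m ≠ j := by
      rintro rfl
      exact hd (by simp only [det3]; ring)
    have hinj : Function.Injective ![i, j, m] := by
      intro u v huv
      fin_cases u <;> fin_cases v <;> simp_all
    have h1 := sum_comp_le_sum (fun i => ‖y i‖) (fun i => norm_nonneg _) hinj
    simp [Fin.sum_univ_three] at h1
    linarith [hzi i]
  · obtain ⟨w, hw⟩ : ∃ w, w ≠ m := by
      by_cases him : i = m
      · exact ⟨j, fun h => hij (him.trans h.symm)⟩
      · exact ⟨i, him⟩
    refine (hΛ.four_bound hV (hyΛ i) (hyΛ j) hgΛ (hzΛ w) hd (hz w)).trans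
      (pow_le_pow_left₀ (by positivity) ?_ 3)
    linarith [hpair y i j hij, hpair z w m hw]
  · have hab : a ≠ b := by
      rintro rfl
      exact hd (by simp [det3])
    refine (hΛ.four_bound hV (hyΛ i) (hyΛ j) hgΛ (hzΛ i) hd (hz i)).trans
      (pow_le_pow_left₀ (by positivity) ?_ 3)
    have hinj : Function.Injective ![a, b] := by
      intro u v huv
      fin_cases u <;> fin_cases v <;> simp_all
    have h1 := sum_comp_le_sum (fun i => ‖x i‖) (fun i => norm_nonneg _) hinj
    simp at h1
    linarith [hpair y i j hij, hzi i, norm_sub_le (x a) (x b)]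

/-- Among four points which are not collinear modulo `y`, two disjoint pairs are independent
modulo `y`. -/
theorem exists_disjoint_pairs {y p q r s : E3} (h : det3 y (p - s) (q - s) ≠ 0) :
    det3 y (p - q) (r - s) ≠ 0 ∨ det3 y (p - r) (q - s) ≠ 0 ∨ det3 y (p - s) (q - r) ≠ 0 := by
  by_contra! hn
  obtain ⟨h1, h2, h3⟩ := hn
  apply h
  simp only [det3, PiLp.sub_apply] at *
  linear_combination (1 / 2) * h1 + (1 / 2) * h2 + (1 / 2) * h3

/-- The two differences involve four distinct links, so the triangle inequality does not count any
link twice. The spare vector is the other loop. -/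
theorem disjoint_pairs_bound {Λ : Submodule ℤ E3} {V : ℝ} (hΛ : DetIntegral Λ V) (hV : 0 < V)
    {k : ℕ} {y z : Fin 1 → E3} {x : Fin k → E3} {u v : E3}
    (huv : u = y 0 ∧ v = z 0 ∨ u = z 0 ∧ v = y 0) (hv : v ≠ 0)
    (hg : edgeGens y z x ⊆ Λ) {a b c e : Fin k} (hinj : Function.Injective ![a, b, c, e])
    (h : det3 u (x a - x b) (x c - x e) ≠ 0) : 54 * V ≤ totalLength y z x ^ 3 := by
  have hu : u ∈ Λ ∧ v ∈ Λ := by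
    rcases huv with ⟨rfl, rfl⟩ | ⟨rfl, rfl⟩
    · exact ⟨hg (Or.inl (Or.inl ⟨0, rfl⟩)), hg (Or.inl (Or.inr ⟨0, rfl⟩))⟩
    · exact ⟨hg (Or.inl (Or.inr ⟨0, rfl⟩)), hg (Or.inl (Or.inl ⟨0, rfl⟩))⟩
  refine (hΛ.four_bound hV hu.1 (hg (Or.inr ⟨a, b, rfl⟩)) (hg (Or.inr ⟨c, e, rfl⟩)) hu.2
    h hv).trans (pow_le_pow_left₀ (by positivity) ?_ 3)
  have h1 := sum_comp_le_sum (fun i => ‖x i‖) (fun i => norm_nonneg _) hinj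
  simp [Fin.sum_univ_four] at h1
  simp only [totalLength, Finset.univ_unique, Fin.default_eq_zero, Finset.sum_singleton]
  have h2 := norm_sub_le (x a) (x b)
  have h3 := norm_sub_le (x c) (x e)
  rcases huv with ⟨rfl, rfl⟩ | ⟨rfl, rfl⟩ <;> linarith

/-- If the loops and some link difference are independent, two further links provide the spare
vector. Otherwise the two loops are parallel; then a basis consists of one loop and two link
differences, and the other loop is spare. The two differences have to be taken over disjoint pairs,
which `exists_disjoint_pairs` allows. -/
theorem loop_loop_many_bound {Λ : Submodule ℤ E3} {V : ℝ} (hΛ : DetIntegral Λ V) (hV : 0 < V)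
    {k : ℕ} (hk : 4 ≤ k) {y z : Fin 1 → E3} {x : Fin k → E3} (hy : ∀ i, y i ≠ 0)
    (hz : ∀ i, z i ≠ 0) (hx : Function.Injective x)
    (hg : edgeGens y z x ⊆ Λ) (hs : Submodule.span ℝ (edgeGens y z x) = ⊤) :
    54 * V ≤ totalLength y z x ^ 3 := by
  have hyΛ : y 0 ∈ Λ := hg (Or.inl (Or.inl ⟨0, rfl⟩))
  have hzΛ : z 0 ∈ Λ := hg (Or.inl (Or.inr ⟨0, rfl⟩))
  by_cases hcase : ∃ i j, det3 (y 0) (z 0) (x i - x j) ≠ 0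
  · obtain ⟨i, j, hd⟩ := hcase
    have hij : i ≠ j := by
      rintro rfl
      exact hd (by simp [det3])
    obtain ⟨a, ha⟩ := exists_notMem_of_card_lt {i, j}
      (lt_of_le_of_lt Finset.card_le_two (by omega))
    obtain ⟨b, hb⟩ := exists_notMem_of_card_lt {i, j, a}
      (lt_of_le_of_lt Finset.card_le_three (by omega))
    simp only [Finset.mem_insert, Finset.mem_singleton, not_or] at ha hb
    have hw : x a - x b ≠ 0 := sub_ne_zero.2 fun h => hb.2.2 (hx h).symm
    refine (hΛ.four_bound hV hyΛ hzΛ (hg (Or.inr ⟨i, j, rfl⟩)) (hg (Or.inr ⟨a, b, rfl⟩)) hd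
      hw).trans (pow_le_pow_left₀ (by positivity) ?_ 3)
    have hinj : Function.Injective ![i, j, a, b] := by
      intro u v huv
      fin_cases u <;> fin_cases v <;> first | rfl | (exfalso; simp at huv; simp_all)
    have h1 := sum_comp_le_sum (fun i => ‖x i‖) (fun i => norm_nonneg _) hinj
    simp [Fin.sum_univ_four] at h1
    simp only [totalLength, Finset.univ_unique, Fin.default_eq_zero, Finset.sum_singleton]
    linarith [norm_sub_le (x i) (x j), norm_sub_le (x a) (x b)]
  · push Not at hcase
    have hyz : ∀ c, det3 (y 0) (z 0) c = 0 := by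
      have h0 : det3Lin (y 0) (z 0) = 0 := by
        refine LinearMap.ext_on hs ?_
        rintro v ((⟨i, rfl⟩ | ⟨i, rfl⟩) | ⟨i, j, rfl⟩)
        · rw [Subsingleton.elim i 0]
          simp [det3Lin, det3]
          ring
        · rw [Subsingleton.elim i 0]
          simp [det3Lin, det3]
          ring
        · exact hcase i j
      exact fun c => congrArg (fun f => f c) h0
    obtain ⟨o, ho⟩ : ∃ o : Fin k, o = ⟨0, by omega⟩ := ⟨_, rfl⟩
    have hs' : Submodule.span ℝ ({y 0, z 0} ∪ Set.range fun i => x i - x o) = ⊤ := by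
      rw [eq_top_iff, ← hs, Submodule.span_le]
      rintro v ((⟨i, rfl⟩ | ⟨i, rfl⟩) | ⟨i, j, rfl⟩)
      · rw [Subsingleton.elim i 0]
        exact Submodule.subset_span (by simp)
      · rw [Subsingleton.elim i 0]
        exact Submodule.subset_span (by simp)
      · have hij : x i - x j = (x i - x o) - (x j - x o) := by abel
        rw [hij]
        exact Submodule.sub_mem _ (Submodule.subset_span (Or.inr ⟨i, rfl⟩))
          (Submodule.subset_span (Or.inr ⟨j, rfl⟩))
    obtain ⟨b, hb, c, hc, hd⟩ := exists_det3_ne_zero_of_ne_zero (hy 0) hs'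
    obtain ⟨i, rfl⟩ : ∃ i, b = x i - x o := by
      rcases hb with (rfl | rfl) | ⟨i, rfl⟩
      · exact absurd (by simp only [det3]; ring) hd
      · exact absurd (hyz c) hd
      · exact ⟨i, rfl⟩
    obtain ⟨j, rfl⟩ : ∃ j, c = x j - x o := by
      rcases hc with (rfl | rfl) | ⟨i, rfl⟩
      · exact absurd (by simp only [det3]; ring) hd
      · refine absurd ?_ hd
        have := hyz (x i - x o)
        simp only [det3] at this ⊢
        linear_combination -this
      · exact ⟨i, rfl⟩
    obtain ⟨m, hm⟩ := exists_notMem_of_card_lt {i, j, o}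
      (lt_of_le_of_lt Finset.card_le_three (by omega))
    simp only [Finset.mem_insert, Finset.mem_singleton, not_or] at hm
    obtain ⟨m1, m2, m3⟩ := hm
    have hij : i ≠ j := by
      rintro rfl
      exact hd (by simp only [det3]; ring)
    have hio : i ≠ o := fun e => hd (by simp [det3, e])
    have hjo : j ≠ o := fun e => hd (by simp [det3, e])
    clear ho
    rcases exists_disjoint_pairs (r := x m) hd with h | h | h
    · refine disjoint_pairs_bound hΛ hV (Or.inl ⟨rfl, rfl⟩) (hz 0) hg ?_ h
      intro u v huv
      fin_cases u <;> fin_cases v <;> first | rfl | (exfalso; simp at huv; simp_all)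
    · refine disjoint_pairs_bound hΛ hV (Or.inl ⟨rfl, rfl⟩) (hz 0) hg ?_ h
      intro u v huv
      fin_cases u <;> fin_cases v <;> first | rfl | (exfalso; simp at huv; simp_all)
    · refine disjoint_pairs_bound hΛ hV (Or.inl ⟨rfl, rfl⟩) (hz 0) hg ?_ h
      intro u v huv
      fin_cases u <;> fin_cases v <;> first | rfl | (exfalso; simp at huv; simp_all)

/-- Five suitable links already satisfy the bound of `D_5`, and any further link makes it strict. -/
theorem dipole_many_bound {Λ : Submodule ℤ E3} {V : ℝ} (hΛ : DetIntegral Λ V) (hV : 0 < V)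
    {k : ℕ} (hk : 6 ≤ k) {y z : Fin 0 → E3} {x : Fin k → E3} (hx0 : ∀ i, x i ≠ 0)
    (hx : Function.Injective x)
    (hg : edgeGens y z x ⊆ Λ) (hs : Submodule.span ℝ (edgeGens y z x) = ⊤) :
    405 / 8 * V < totalLength y z x ^ 3 := by
  obtain ⟨g, hginj, hd⟩ := exists_injective_affMinor_ne_zero (by omega) hs
  obtain ⟨h1, -⟩ := hΛ.five_vectors_bound hV (x := x ∘ g) (fun i => hx0 _) (hx.comp hginj)
    (fun i j => hg (Or.inr ⟨_, _, rfl⟩)) ⟨4, hd⟩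
  refine h1.trans_lt ?_
  have hn : 0 ≤ ∑ i, ‖(x ∘ g) i‖ := Finset.sum_nonneg fun i _ => norm_nonneg _
  refine pow_lt_pow_left₀ ?_ hn three_ne_zero
  obtain ⟨m, hm⟩ := exists_notMem_of_card_lt (Finset.univ.map ⟨g, hginj⟩) (by simp; omega)
  have h2 : ∑ i, ‖(x ∘ g) i‖ = ∑ i ∈ Finset.univ.map ⟨g, hginj⟩, ‖x i‖ :=
    (Finset.sum_map Finset.univ ⟨g, hginj⟩ fun i => ‖x i‖).symm
  rw [h2]
  simp only [totalLength, Finset.univ_eq_empty, Finset.sum_empty, zero_add]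
  exact Finset.sum_lt_sum_of_subset (Finset.subset_univ _) (Finset.mem_univ m) hm
    (norm_pos_iff.2 (hx0 m)) fun j _ _ => norm_nonneg _

/-- The lower bound for all double bouquets of degree at least `7`. -/
theorem large_degree_bound {Λ : Submodule ℤ E3} {V : ℝ} (hΛ : DetIntegral Λ V) (hV : 0 < V)
    {ℓ k : ℕ} (hd : 7 ≤ 2 * ℓ + k) {y z : Fin ℓ → E3} {x : Fin k → E3} (hy : ∀ i, y i ≠ 0)
    (hz : ∀ i, z i ≠ 0) (hx0 : ∀ i, x i ≠ 0) (hx : Function.Injective x)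
    (hyi : ∀ i j, i ≠ j → LinearIndependent ℝ ![y i, y j])
    (hg : edgeGens y z x ⊆ Λ) (hs : Submodule.span ℝ (edgeGens y z x) = ⊤) :
    405 / 8 * V < totalLength y z x ^ 3 := by
  rcases Nat.lt_or_ge ℓ 2 with h | h
  · interval_cases ℓ
    · exact dipole_many_bound hΛ hV (by omega) hx0 hx hg hs
    · have := loop_loop_many_bound hΛ hV (by omega) hy hz hx hg hs
      linarith
  · have := two_loops_bound hΛ hV hz (hyi ⟨0, by omega⟩ ⟨1, by omega⟩ (by simp)) hg hs
    linarith

/-! ### The covolume of a lattice in Euclidean space -/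

theorem basisFun_det_eq_det3 (v : Fin 3 → E3) :
    (EuclideanSpace.basisFun (Fin 3) ℝ).toBasis.det v = det3 (v 0) (v 1) (v 2) := by
  rw [Module.Basis.det_apply, Matrix.det_fin_three]
  simp [Module.Basis.toMatrix_apply, det3]
  ring

theorem measureReal_fundamentalDomain_basisFun :
    MeasureTheory.volume.real
      (ZSpan.fundamentalDomain (EuclideanSpace.basisFun (Fin 3) ℝ).toBasis) = 1 := by
  rw [MeasureTheory.measureReal_def,
    MeasureTheory.measure_congr (ZSpan.fundamentalDomain_ae_parallelepiped _ _),
    OrthonormalBasis.coe_toBasis, OrthonormalBasis.volume_parallelepiped, ENNReal.toReal_one]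

theorem covolume_eq_abs_det3 (Λ : Submodule ℤ E3) [DiscreteTopology Λ] [IsZLattice ℝ Λ]
    (b : Module.Basis (Fin 3) ℤ Λ) :
    ZLattice.covolume Λ = |det3 (b 0) (b 1) (b 2)| := by
  have h := ZLattice.covolume_eq_det_mul_measureReal (L := Λ) (μ := MeasureTheory.volume)
    (b := b) (b₀ := (EuclideanSpace.basisFun (Fin 3) ℝ).toBasis)
  rw [measureReal_fundamentalDomain_basisFun, mul_one, basisFun_det_eq_det3] at h
  exact h

theorem exists_basis_fin_three (Λ : Submodule ℤ E3) [DiscreteTopology Λ] [IsZLattice ℝ Λ] :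
    Nonempty (Module.Basis (Fin 3) ℤ Λ) := by
  have h : Module.finrank ℤ Λ = 3 := by
    rw [ZLattice.rank ℝ Λ]
    simp
  have := ZLattice.module_free ℝ Λ
  have := ZLattice.module_finite ℝ Λ
  exact ⟨Module.finBasisOfFinrankEq ℤ Λ h⟩

theorem detIntegral_covolume (Λ : Submodule ℤ E3) [DiscreteTopology Λ] [IsZLattice ℝ Λ] :
    DetIntegral Λ (ZLattice.covolume Λ) := by
  obtain ⟨b⟩ := exists_basis_fin_three Λ
  intro u hu v hv w hw
  have key : ∀ g : Λ, (g : E3) = ∑ i, b.repr g i • (b i : E3) := fun g => by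
    have h := congrArg (Subtype.val) (b.sum_repr g).symm
    rw [h, AddSubmonoidClass.coe_finsetSum]
    rfl
  have h : ∃ n : ℤ, det3 u v w = n * det3 (b 0) (b 1) (b 2) := by
    have hu' := key ⟨u, hu⟩
    have hv' := key ⟨v, hv⟩
    have hw' := key ⟨w, hw⟩
    simp only [Fin.sum_univ_three] at hu' hv' hw'
    rw [hu', hv', hw']
    refine ⟨Matrix.det (Matrix.of ![fun i => b.repr ⟨u, hu⟩ i, fun i => b.repr ⟨v, hv⟩ i,
      fun i => b.repr ⟨w, hw⟩ i]), ?_⟩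
    rw [Matrix.det_fin_three]
    simp [det3]
    ring
  obtain ⟨n, hn⟩ := h
  rw [covolume_eq_abs_det3 Λ b]
  rcases abs_choice (det3 (b 0) (b 1) (b 2)) with h | h
  · exact ⟨n, by rw [h, hn]⟩
  · exact ⟨-n, by rw [h, hn]; push_cast; ring⟩

theorem span_real_eq_top_of_span_int {Λ : Submodule ℤ E3} [DiscreteTopology Λ] [IsZLattice ℝ Λ]
    {s : Set E3} (h : Submodule.span ℤ s = Λ) : Submodule.span ℝ s = ⊤ := by
  rw [← IsZLattice.span_top (K := ℝ) (L := Λ), ← h]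
  exact (Submodule.span_span_of_tower ℤ ℝ s).symm

/-- The basis of a lattice spanned by three independent vectors. -/
theorem exists_basis_of_det3_ne_zero {v : Fin 3 → E3} (h : det3 (v 0) (v 1) (v 2) ≠ 0) :
    ∃ b : Module.Basis (Fin 3) ℝ E3, ⇑b = v := by
  have hd : IsUnit ((EuclideanSpace.basisFun (Fin 3) ℝ).toBasis.det v) := by
    rw [basisFun_det_eq_det3]
    exact isUnit_iff_ne_zero.2 h
  obtain ⟨h1, h2⟩ := (Module.Basis.is_basis_iff_det _).2 hd
  exact ⟨Module.Basis.mk h1 h2.ge, Module.Basis.coe_mk _ _⟩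

theorem covolume_span_basis (b : Module.Basis (Fin 3) ℝ E3) :
    ZLattice.covolume (Submodule.span ℤ (Set.range b)) = |det3 (b 0) (b 1) (b 2)| := by
  rw [covolume_eq_abs_det3 _ (b.restrictScalars ℤ)]
  simp

/-! ### Presentations of periodic networks by voltage graphs -/

theorem graphIso_graphOfEnds_iff {α β α' β' : Type} {ends : β → Sym2 α} {ends' : β' → Sym2 α'} :
    GraphIso (graphOfEnds ends) (graphOfEnds ends') ↔
      ∃ (f : α ≃ α') (g : β ≃ β'), ∀ e, ends' (g e) = Sym2.map f (ends e) := by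
  constructor
  · rintro ⟨f, g, h⟩
    refine ⟨(Equiv.Set.univ α).symm.trans (f.trans (Equiv.Set.univ α')),
      (Equiv.Set.univ β).symm.trans (g.trans (Equiv.Set.univ β')), fun e => ?_⟩
    induction h' : ends e using Sym2.ind with
    | _ x y => exact (h ⟨e, trivial⟩ ⟨x, trivial⟩ ⟨y, trivial⟩).1 h'
  · rintro ⟨f, g, h⟩
    refine ⟨(Equiv.Set.univ α).trans (f.trans (Equiv.Set.univ α').symm),
      (Equiv.Set.univ β).trans (g.trans (Equiv.Set.univ β').symm), fun e x y => ?_⟩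
    change ends e.1 = s(x.1, y.1) ↔ ends' (g e.1) = s(f x.1, f y.1)
    rw [h, show s(f x.1, f y.1) = Sym2.map f s(x.1, y.1) from rfl,
      (Sym2.map.injective f.injective).eq_iff]

namespace PeriodicNetwork

variable {n d : ℕ} (N : PeriodicNetwork n d)

theorem vadd_right_cancel' {g h : N.lattice} {v : N.Vert} (e : g +ᵥ v = h +ᵥ v) : g = h := by
  have h1 := congrArg N.pos e
  rw [N.pos_vadd, N.pos_vadd] at h1
  exact Subtype.ext (add_right_cancel h1)

theorem proj_eq_iff {v w : N.Vert} : N.proj v = N.proj w ↔ ∃ g : N.lattice, g +ᵥ v = w := by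
  constructor
  · intro h
    obtain ⟨g, hg⟩ := Quotient.exact (s := AddAction.orbitRel N.lattice N.Vert) h.symm
    exact ⟨g, hg⟩
  · rintro ⟨g, rfl⟩
    exact (N.proj_vadd g v).symm

theorem adj_vadd_iff {g : N.lattice} {v w : N.Vert} :
    N.graph.Adj (g +ᵥ v) (g +ᵥ w) ↔ N.graph.Adj v w := by
  refine ⟨fun h => ?_, N.adj_vadd g v w⟩
  simpa using N.adj_vadd (-g) _ _ h

theorem adj_vadd_vadd_iff {g h : N.lattice} {v w : N.Vert} :
    N.graph.Adj (g +ᵥ v) (h +ᵥ w) ↔ N.graph.Adj v ((h - g) +ᵥ w) := by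
  rw [← N.adj_vadd_iff (g := g) (v := v), vadd_vadd, add_sub_cancel]

/-- A presentation of a periodic network: representatives `p i` of the vertices, and for each
edge `e` of the quotient an edge from `p (s e)` to `g e +ᵥ p (t e)`. The elements of `β ⊕ β` are
the oriented edges of the quotient. -/
structure Presentation {ι β : Type} (p : ι → N.Vert) (s t : β → ι) (g : β → N.lattice) :
    Prop where
  bij : Function.Bijective fun i => N.proj (p i)
  adj_iff : ∀ i j h, N.graph.Adj (p i) (h +ᵥ p j) ↔ ∃ δ : β ⊕ β, Sum.elim s t δ = i ∧
    Sum.elim t s δ = j ∧ Sum.elim g (-g) δ = h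
  -- Injectivity on oriented edges, not only on edges: it encodes that the covering has no multiple
  -- edges and that no loop of the quotient has voltage zero.
  inj : Function.Injective fun δ : β ⊕ β =>
    (Sum.elim s t δ, Sum.elim t s δ, Sum.elim g (-g) δ)

/-- The edge vectors of a presentation. -/
def edgeVec {ι β : Type} (p : ι → N.Vert) (s t : β → ι) (g : β → N.lattice) (e : β) :
    EuclideanSpace ℝ (Fin n) :=
  g e + N.pos (p (t e)) - N.pos (p (s e))

theorem vadd_eq_vadd_of_injective {N : PeriodicNetwork n d} {ι : Type} {p : ι → N.Vert}
    (hp : Function.Injective fun i => N.proj (p i)) {a b : N.lattice} {i j : ι}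
    (h : a +ᵥ p i = b +ᵥ p j) : a = b ∧ i = j := by
  have hij : i = j := hp (by
    change N.proj (p i) = N.proj (p j)
    rw [← N.proj_vadd a (p i), h, N.proj_vadd])
  subst hij
  exact ⟨N.vadd_right_cancel' h, rfl⟩

namespace Presentation

variable {N} {ι β : Type} {p : ι → N.Vert} {s t : β → ι} {g : β → N.lattice}

theorem vert_bijective (hP : N.Presentation p s t g) :
    Function.Bijective fun a : N.lattice × ι => a.1 +ᵥ p a.2 := by
  constructor
  · rintro ⟨a, i⟩ ⟨b, j⟩ h
    obtain ⟨rfl, rfl⟩ := vadd_eq_vadd_of_injective hP.bij.1 h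
    rfl
  · intro v
    obtain ⟨i, hi⟩ := hP.bij.2 (N.proj v)
    obtain ⟨a, ha⟩ := N.proj_eq_iff.1 hi
    exact ⟨(a, i), ha⟩

theorem exists_vadd_eq (hP : N.Presentation p s t g) (v : N.Vert) :
    ∃ (a : N.lattice) (i : ι), v = a +ᵥ p i := by
  obtain ⟨⟨a, i⟩, h⟩ := hP.vert_bijective.2 v
  exact ⟨a, i, h.symm⟩

theorem vadd_eq_vadd (hP : N.Presentation p s t g) {a b : N.lattice} {i j : ι}
    (h : a +ᵥ p i = b +ᵥ p j) : a = b ∧ i = j :=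
  vadd_eq_vadd_of_injective hP.bij.1 h

theorem adj (hP : N.Presentation p s t g) (e : β) :
    N.graph.Adj (p (s e)) (g e +ᵥ p (t e)) :=
  (hP.adj_iff _ _ _).2 ⟨Sum.inl e, rfl, rfl, rfl⟩

/-- The edges of the quotient given by a presentation. -/
def toQEdge (hP : N.Presentation p s t g) (e : β) : N.QEdge :=
  Quotient.mk _ ⟨s(p (s e), g e +ᵥ p (t e)), hP.adj e⟩

theorem toQEdge_bijective (hP : N.Presentation p s t g) : Function.Bijective hP.toQEdge := by
  constructor
  · intro e e' h
    obtain ⟨a, ha⟩ := Quotient.exact h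
    simp only [Sym2.map_mk, Sym2.eq_iff, vadd_vadd] at ha
    rcases ha with ⟨h1, h2⟩ | ⟨h1, h2⟩
    · rw [← zero_vadd N.lattice (p (s e'))] at h1
      obtain ⟨rfl, hs⟩ := hP.vadd_eq_vadd h1
      obtain ⟨hg, ht⟩ := hP.vadd_eq_vadd h2
      rw [zero_add] at hg
      simpa using hP.inj (a₁ := Sum.inl e) (a₂ := Sum.inl e') (by simp [hs, ht, hg])
    · rw [← zero_vadd N.lattice (p (s e'))] at h2
      obtain ⟨rfl, hs⟩ := hP.vadd_eq_vadd h1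
      obtain ⟨hg, ht⟩ := hP.vadd_eq_vadd h2
      have := hP.inj (a₁ := Sum.inl e) (a₂ := Sum.inr e')
        (by simp [hs, ht, eq_neg_of_add_eq_zero_right hg])
      simp at this
  · intro c
    induction c using Quotient.inductionOn with
    | h e =>
    obtain ⟨e, he⟩ := e
    induction e using Sym2.ind with
    | _ v w =>
    obtain ⟨a, i, rfl⟩ := hP.exists_vadd_eq v
    obtain ⟨b, j, rfl⟩ := hP.exists_vadd_eq w
    have he' : N.graph.Adj (a +ᵥ p i) (b +ᵥ p j) := he
    rw [N.adj_vadd_vadd_iff, hP.adj_iff] at he'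
    obtain ⟨δ | δ, h1, h2, h3⟩ := he'
    · refine ⟨δ, Quotient.sound ⟨a, ?_⟩⟩
      simp only [Sum.elim_inl] at h1 h2 h3
      simp [h1, h2, h3, vadd_vadd]
    · refine ⟨δ, Quotient.sound ⟨b, ?_⟩⟩
      simp only [Sum.elim_inr, Pi.neg_apply] at h1 h2 h3
      have h4 : b + g δ = a := by
        rw [neg_eq_iff_eq_neg] at h3
        rw [h3]
        abel
      simp [h1, h2, vadd_vadd, h4]

theorem qEnds_toQEdge (hP : N.Presentation p s t g) (e : β) :
    N.qEnds (hP.toQEdge e) = s(N.proj (p (s e)), N.proj (p (t e))) := by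
  change Sym2.map N.proj s(_, _) = _
  rw [Sym2.map_mk, N.proj_vadd]

theorem hasQuotient (hP : N.Presentation p s t g) :
    N.HasQuotient (graphOfEnds fun e => s(s e, t e)) := by
  refine graphIso_graphOfEnds_iff.2 ⟨(Equiv.ofBijective _ hP.bij).symm,
    (Equiv.ofBijective _ hP.toQEdge_bijective).symm, fun e => ?_⟩
  obtain ⟨e, rfl⟩ := hP.toQEdge_bijective.2 e
  rw [Equiv.ofBijective_symm_apply_apply, hP.qEnds_toQEdge, Sym2.map_mk]
  congr 2 <;> exact (Equiv.ofBijective_symm_apply_apply _ hP.bij _).symm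

theorem length_eq [Fintype β] (hP : N.Presentation p s t g) :
    N.length = ∑ e, ‖N.edgeVec p s t g e‖ := by
  have h1 := finsum_comp_equiv (Equiv.ofBijective _ hP.toQEdge_bijective) (f := N.qEdgeLength)
  rw [PeriodicNetwork.length, ← h1, finsum_eq_sum_of_fintype]
  refine Finset.sum_congr rfl fun e _ => ?_
  change dist (N.pos (p (s e))) (N.pos (g e +ᵥ p (t e))) = _
  rw [N.pos_vadd, dist_comm, dist_eq_norm, edgeVec]

theorem edgeVec_ne_zero (hP : N.Presentation p s t g) (e : β) : N.edgeVec p s t g e ≠ 0 := by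
  have := N.pos_ne _ _ (hP.adj e)
  rw [N.pos_vadd] at this
  exact fun h => this (sub_eq_zero.1 h).symm

/-- The neighbour of `a +ᵥ p i` along an oriented edge of the quotient. -/
def neighbor (hP : N.Presentation p s t g) (a : N.lattice) (i : ι)
    (δ : {δ : β ⊕ β // Sum.elim s t δ = i}) : N.graph.neighborSet (a +ᵥ p i) :=
  ⟨(a + Sum.elim g (-g) δ.1) +ᵥ p (Sum.elim t s δ.1), by
    rw [SimpleGraph.mem_neighborSet, N.adj_vadd_vadd_iff, add_sub_cancel_left]
    exact (hP.adj_iff _ _ _).2 ⟨δ.1, δ.2, rfl, rfl⟩⟩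

theorem neighbor_bijective (hP : N.Presentation p s t g) (a : N.lattice) (i : ι) :
    Function.Bijective (hP.neighbor a i) := by
  constructor
  · rintro ⟨δ, rfl⟩ ⟨δ', h'⟩ h
    obtain ⟨h1, h2⟩ := hP.vadd_eq_vadd (congrArg Subtype.val h)
    exact Subtype.ext (hP.inj (by
      simp only [Prod.mk.injEq]
      exact ⟨h'.symm, h2, add_left_cancel h1⟩))
  · rintro ⟨w, hw⟩
    obtain ⟨b, j, rfl⟩ := hP.exists_vadd_eq w
    have hw' := hw
    rw [SimpleGraph.mem_neighborSet, N.adj_vadd_vadd_iff, hP.adj_iff] at hw'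
    obtain ⟨δ, h1, h2, h3⟩ := hw'
    refine ⟨⟨δ, h1⟩, Subtype.ext ?_⟩
    simp only [neighbor, h2, h3, add_sub_cancel]

theorem pos_neighbor (hP : N.Presentation p s t g) (a : N.lattice) (i : ι)
    (δ : {δ : β ⊕ β // Sum.elim s t δ = i}) :
    N.pos (a +ᵥ p i) - N.pos (hP.neighbor a i δ).1 =
      -Sum.elim (N.edgeVec p s t g) (-N.edgeVec p s t g) δ.1 := by
  obtain ⟨δ | δ, rfl⟩ := δ <;>
  · simp only [neighbor, N.pos_vadd, Sum.elim_inl, Sum.elim_inr, edgeVec, Pi.neg_apply,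
      Submodule.coe_add, Submodule.coe_neg]
    abel

section Finite

variable [Fintype β] [DecidableEq ι]

theorem sum_darts {M : Type*} [AddCommMonoid M] (s t : β → ι) (i : ι) (F : β ⊕ β → M) :
    ∑ δ : {δ : β ⊕ β // Sum.elim s t δ = i}, F δ.1 =
      ∑ e, (if s e = i then F (Sum.inl e) else 0) +
      ∑ e, (if t e = i then F (Sum.inr e) else 0) := by
  rw [← Finset.sum_subtype (Finset.univ.filter fun δ : β ⊕ β => Sum.elim s t δ = i) (by simp) F,
    Finset.sum_filter, Fintype.sum_sum_type]
  rfl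

theorem degree_eq (hP : N.Presentation p s t g) (i : ι) :
    d = ∑ e, ((if s e = i then 1 else 0) + (if t e = i then 1 else 0)) := by
  rw [← N.degree_eq ((0 : N.lattice) +ᵥ p i), ← Nat.card_coe_set_eq,
    ← Nat.card_congr (Equiv.ofBijective _ (hP.neighbor_bijective 0 i)), Nat.card_eq_fintype_card,
    Finset.sum_add_distrib, ← sum_darts s t i fun _ => 1]
  simp

/-- The two ends of a loop pull in opposite directions, so loops enter with coefficient zero. -/
theorem force_eq (hP : N.Presentation p s t g) (a : N.lattice) (i : ι) :
    N.force (a +ᵥ p i) = ∑ e, ((if t e = i then 1 else 0) - (if s e = i then 1 else 0) : ℝ) •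
      ‖N.edgeVec p s t g e‖⁻¹ • N.edgeVec p s t g e := by
  rw [force, ← finsum_comp_equiv (Equiv.ofBijective _ (hP.neighbor_bijective a i)),
    finsum_eq_sum_of_fintype]
  simp only [Equiv.ofBijective_apply, hP.pos_neighbor]
  rw [sum_darts s t i fun δ => ‖-Sum.elim (N.edgeVec p s t g) (-N.edgeVec p s t g) δ‖⁻¹ •
    -Sum.elim (N.edgeVec p s t g) (-N.edgeVec p s t g) δ, ← Finset.sum_add_distrib]
  refine Finset.sum_congr rfl fun e _ => ?_
  simp only [Sum.elim_inl, Sum.elim_inr, Pi.neg_apply, neg_neg, norm_neg, sub_smul, ite_smul,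
    one_smul, zero_smul, smul_neg]
  split_ifs <;> simp

end Finite

/-- Connectedness as a principle of invariance: a property of vertices that is preserved along edges
in both directions, and holds at one vertex, holds everywhere. -/
theorem connected_induction (hP : N.Presentation p s t g) {Q : N.lattice → ι → Prop}
    (hQ : ∀ a e, Q a (s e) ↔ Q (a + g e) (t e)) {i₀ : ι} (h₀ : Q 0 i₀) (a : N.lattice) (i : ι) :
    Q a i := by
  have step : ∀ v w : N.Vert, N.graph.Adj v w →
      (∃ a i, v = a +ᵥ p i ∧ Q a i) → ∃ a i, w = a +ᵥ p i ∧ Q a i := by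
    rintro _ w hvw ⟨a, i, rfl, ha⟩
    obtain ⟨b, j, rfl⟩ := hP.exists_vadd_eq w
    refine ⟨b, j, rfl, ?_⟩
    rw [N.adj_vadd_vadd_iff, hP.adj_iff] at hvw
    obtain ⟨δ | δ, h1, h2, h3⟩ := hvw
    · simp only [Sum.elim_inl] at h1 h2 h3
      have h4 := (hQ a δ).1 (by rwa [h1])
      rwa [h2, h3, add_sub_cancel] at h4
    · simp only [Sum.elim_inr, Pi.neg_apply] at h1 h2 h3
      have h4 := (hQ b δ).2 (by rwa [h1, neg_eq_iff_eq_neg.1 h3, neg_sub, add_sub_cancel])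
      rwa [h2] at h4
  have h1 : ∃ a i, p i₀ = a +ᵥ p i ∧ Q a i := ⟨0, i₀, by simp, h₀⟩
  generalize p i₀ = u at h1
  obtain ⟨W⟩ := N.connected.preconnected u (a +ᵥ p i)
  generalize hv : a +ᵥ p i = v at W
  induction W with
  | nil =>
    obtain ⟨b, j, h2, h3⟩ := h1
    obtain ⟨rfl, rfl⟩ := hP.vadd_eq_vadd (hv.trans h2)
    exact h3
  | cons h _ ih => exact ih (step _ _ h h1) hv

theorem index_nonempty (hP : N.Presentation p s t g) : Nonempty ι := by
  obtain ⟨v⟩ := N.connected.nonempty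
  exact ⟨(hP.exists_vadd_eq v).choose_spec.choose⟩

/-- The sum of the voltages along a closed walk does not change when they are modified by a
potential `c`. By connectedness every lattice element is such a sum, so the modified voltages
generate the lattice. -/
theorem connected_closure (hP : N.Presentation p s t g) (c : ι → N.lattice)
    {H : AddSubgroup N.lattice} (hH : ∀ e, g e + c (t e) - c (s e) ∈ H) : H = ⊤ := by
  obtain ⟨i₀⟩ := hP.index_nonempty
  rw [eq_top_iff]
  intro a _
  have := hP.connected_induction (Q := fun a i => a + c i - c i₀ ∈ H) (i₀ := i₀) (fun a e => ?_)
    (by simp) a i₀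
  · simpa using this
  · have h1 : a + g e + c (t e) - c i₀ = (g e + c (t e) - c (s e)) + (a + c (s e) - c i₀) := by
      abel
    rw [h1, H.add_mem_cancel_left (hH e)]

theorem numVertices_eq [Fintype ι] (hP : N.Presentation p s t g) :
    N.numVertices = Fintype.card ι := by
  rw [numVertices, ← Nat.card_congr (Equiv.ofBijective _ hP.bij), Nat.card_eq_fintype_card]

theorem volt_shift {Λ : Type*} [AddCommGroup Λ] (s t : β → ι) (g : β → Λ) (b : ι → Λ)
    (δ : β ⊕ β) :
    Sum.elim (fun e => g e + b (s e) - b (t e)) (-fun e => g e + b (s e) - b (t e)) δ =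
      Sum.elim g (-g) δ + b (Sum.elim s t δ) - b (Sum.elim t s δ) := by
  cases δ with
  | inl e => rfl
  | inr e =>
    simp only [Sum.elim_inr, Pi.neg_apply]
    abel

/-- Other representatives of the vertex orbits change the voltages by a coboundary only. -/
theorem shift (hP : N.Presentation p s t g) (b : ι → N.lattice) :
    N.Presentation (fun i => b i +ᵥ p i) s t (fun e => g e + b (s e) - b (t e)) where
  bij := by
    simpa only [N.proj_vadd] using hP.bij
  adj_iff i j h := by
    rw [vadd_vadd, N.adj_vadd_vadd_iff, hP.adj_iff]
    refine exists_congr fun δ => and_congr_right fun h1 => and_congr_right fun h2 => ?_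
    rw [volt_shift, h1, h2]
    constructor <;> intro h3
    · rw [h3]
      abel
    · rw [← h3]
      abel
  inj := by
    intro δ δ' h
    simp only [Prod.mk.injEq, volt_shift] at h
    obtain ⟨h1, h2, h3⟩ := h
    rw [h1, h2, sub_left_inj, add_left_inj] at h3
    exact hP.inj (by simp only [h1, h2, h3])

end Presentation

/-- Representatives of the vertex orbits are chosen, and each quotient edge is lifted so as to start
at a representative. The delicate point is that an edge orbit cannot coincide with its own reverse.
-/
theorem exists_presentation {ι β : Type} {s t : β → ι}
    (h : N.HasQuotient (graphOfEnds fun e => s(s e, t e))) :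
    ∃ (p : ι → N.Vert) (g : β → N.lattice), N.Presentation p s t g := by
  obtain ⟨f, k, hfk⟩ := graphIso_graphOfEnds_iff.1 h
  choose p hp using fun i : ι => Quotient.exists_rep (f.symm i)
  change ∀ i, N.proj (p i) = f.symm i at hp
  have hfp : ∀ i v, N.proj v = f.symm i ↔ ∃ a : N.lattice, v = a +ᵥ p i := by
    intro i v
    rw [← hp, eq_comm, N.proj_eq_iff]
    simp only [eq_comm]
  have hg : ∀ e : β, ∃ (a : N.lattice) (ha : N.graph.Adj (p (s e)) (a +ᵥ p (t e))),
      k.symm e = Quotient.mk _ ⟨s(p (s e), a +ᵥ p (t e)), ha⟩ := by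
    intro e
    have h1 := hfk (k.symm e)
    rw [Equiv.apply_symm_apply] at h1
    generalize k.symm e = c at h1 ⊢
    induction c using Quotient.inductionOn with
    | h c =>
    obtain ⟨c, hc⟩ := c
    have aux : ∀ v w, N.proj v = f.symm (s e) → N.proj w = f.symm (t e) → c = s(v, w) →
        ∃ (a : N.lattice) (ha : N.graph.Adj (p (s e)) (a +ᵥ p (t e))),
          (Quotient.mk _ ⟨c, hc⟩ : N.QEdge) = Quotient.mk _ ⟨s(p (s e), a +ᵥ p (t e)), ha⟩ := by
      rintro v w hv hw rfl
      obtain ⟨a, rfl⟩ := (hfp _ _).1 hv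
      obtain ⟨b, rfl⟩ := (hfp _ _).1 hw
      have hc' : N.graph.Adj (a +ᵥ p (s e)) (b +ᵥ p (t e)) := hc
      refine ⟨b - a, N.adj_vadd_vadd_iff.1 hc', Quotient.sound ⟨-a, ?_⟩⟩
      simp [vadd_vadd, sub_eq_neg_add]
    induction c using Sym2.ind with
    | _ v w =>
    have h2 : s(s e, t e) = s(f (N.proj v), f (N.proj w)) := h1
    rcases Sym2.eq_iff.1 h2 with ⟨h3, h4⟩ | ⟨h3, h4⟩
    · exact aux v w (by rw [h3, f.symm_apply_apply]) (by rw [h4, f.symm_apply_apply]) rfl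
    · exact aux w v (by rw [h3, f.symm_apply_apply]) (by rw [h4, f.symm_apply_apply])
        Sym2.eq_swap
  choose g hadj hg using hg
  have hbij : Function.Bijective fun i => N.proj (p i) := by
    simp only [hp]
    exact f.symm.bijective
  -- Such edges lie in the same orbit, hence are equal. Then the voltage equals its own negative, so
  -- it is zero, and the lift would join a vertex to itself.
  have hne : ∀ e e', s e = t e' → t e = s e' → g e = -g e' → False := by
    intro e e' h1 h2 h3
    have he : e = e' := k.symm.injective (by
      rw [hg, hg]
      refine Quotient.sound ⟨g e', ?_⟩
      simp [h1, h2, h3])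
    subst he
    have h0 : g e = 0 := by
      have h4 : (g e : EuclideanSpace ℝ (Fin n)) = -g e := by exact_mod_cast congrArg Subtype.val h3
      have h5 : (2 : ℝ) • (g e : EuclideanSpace ℝ (Fin n)) = 0 := by
        rw [two_smul, ← sub_neg_eq_add, ← h4, sub_self]
      exact Subtype.ext ((smul_eq_zero.1 h5).resolve_left two_ne_zero)
    have h5 := hadj e
    rw [h0, zero_vadd, h1] at h5
    exact N.graph.loopless.irrefl _ h5
  have heq : ∀ e e', s e = s e' → t e = t e' → g e = g e' → e = e' := by
    intro e e' h1 h2 h3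
    refine k.symm.injective ?_
    rw [hg, hg]
    exact Quotient.sound ⟨0, by simp [h1, h2, h3]⟩
  refine ⟨p, g, hbij, fun i j a => ⟨fun ha => ?_, ?_⟩, ?_⟩
  · have h1 := hg (k (Quotient.mk _ ⟨s(p i, a +ᵥ p j), ha⟩))
    rw [Equiv.symm_apply_apply] at h1
    generalize k (Quotient.mk _ ⟨s(p i, a +ᵥ p j), ha⟩) = e at h1
    obtain ⟨b, hb⟩ := Quotient.exact h1.symm
    simp only [Sym2.map_mk, Sym2.eq_iff, vadd_vadd] at hb
    rcases hb with ⟨h2, h3⟩ | ⟨h2, h3⟩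
    · rw [← zero_vadd N.lattice (p i)] at h2
      obtain ⟨rfl, hi⟩ := vadd_eq_vadd_of_injective hbij.1 h2
      obtain ⟨ha, hj⟩ := vadd_eq_vadd_of_injective hbij.1 h3
      exact ⟨Sum.inl e, hi, hj, by simpa using ha⟩
    · rw [← zero_vadd N.lattice (p i)] at h3
      obtain ⟨rfl, hi⟩ := vadd_eq_vadd_of_injective hbij.1 h2
      obtain ⟨ha, hj⟩ := vadd_eq_vadd_of_injective hbij.1 h3
      exact ⟨Sum.inr e, hj, hi, (eq_neg_of_add_eq_zero_left ha).symm⟩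
  · rintro ⟨e | e, rfl, rfl, rfl⟩
    · exact hadj e
    · have h1 := N.adj_vadd (-g e) _ _ (hadj e)
      rw [vadd_vadd, neg_add_cancel, zero_vadd] at h1
      exact h1.symm
  · rintro (e | e) (e' | e') h <;> simp only [Sum.elim_inl, Sum.elim_inr, Prod.mk.injEq,
      Pi.neg_apply] at h <;> obtain ⟨h1, h2, h3⟩ := h
    · rw [heq e e' h1 h2 h3]
    · exact (hne e e' h1 h2 h3).elim
    · exact (hne e' e h1.symm h2.symm h3.symm).elim
    · rw [heq e e' h2 h1 (neg_injective h3)]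

end PeriodicNetwork

namespace PeriodicNetwork

/-! ### Networks with quotient graph a bouquet or a double bouquet -/

/-- The initial vertices of the edges of the double bouquet. -/
def doubleSrc (ℓ k : ℕ) : Fin 2 × Fin ℓ ⊕ Fin k → Fin 2 := Sum.elim Prod.fst fun _ => 0

/-- The terminal vertices of the edges of the double bouquet. -/
def doubleTgt (ℓ k : ℕ) : Fin 2 × Fin ℓ ⊕ Fin k → Fin 2 := Sum.elim Prod.fst fun _ => 1

theorem doubleBouquet_eq (ℓ k : ℕ) :
    doubleBouquet ℓ k = graphOfEnds fun e => s(doubleSrc ℓ k e, doubleTgt ℓ k e) := by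
  unfold doubleBouquet
  congr 1
  funext e
  cases e <;> rfl

theorem not_sameRay {n d : ℕ} (N : PeriodicNetwork n d) {v w w' : N.Vert}
    (h : N.graph.Adj v w) (h' : N.graph.Adj v w') (hw : w ≠ w') :
    ¬ SameRay ℝ (N.pos w - N.pos v) (N.pos w' - N.pos v) := by
  intro hr
  have h0 := sub_ne_zero.2 (N.pos_ne _ _ h).symm
  have h0' := sub_ne_zero.2 (N.pos_ne _ _ h').symm
  -- Normalizing to `a + b = 1` puts both coefficients into the unit interval, so that the common
  -- multiple is a second point on both segments.
  obtain ⟨a, b, ha, hb, hab, hsum⟩ : ∃ a b : ℝ, 0 < a ∧ 0 < b ∧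
      a • (N.pos w - N.pos v) = b • (N.pos w' - N.pos v) ∧ a + b = 1 := by
    obtain ⟨a, b, ha, hb, hab⟩ := hr.exists_pos h0 h0'
    refine ⟨a / (a + b), b / (a + b), by positivity, by positivity, ?_, by field_simp⟩
    rw [div_eq_inv_mul, div_eq_inv_mul, mul_smul, mul_smul, hab]
  have hmem : N.pos v + a • (N.pos w - N.pos v) ∈
      segment ℝ (N.pos v) (N.pos w) ∩ segment ℝ (N.pos v) (N.pos w') := by
    rw [segment_eq_image', segment_eq_image']
    refine ⟨⟨a, ⟨ha.le, by linarith⟩, rfl⟩, ⟨b, ⟨hb.le, by linarith⟩, ?_⟩⟩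
    simp only [hab]
  rw [N.immersed v w w' h h' hw, Set.mem_singleton_iff, add_eq_left, smul_eq_zero] at hmem
  exact hmem.elim ha.ne' h0

namespace Presentation

theorem not_sameRay {n d : ℕ} {N : PeriodicNetwork n d} {ι β : Type} {p : ι → N.Vert}
    {s t : β → ι} {g : β → N.lattice} (hP : N.Presentation p s t g) {δ δ' : β ⊕ β}
    (h : Sum.elim s t δ = Sum.elim s t δ') (hδ : δ ≠ δ') :
    ¬ SameRay ℝ (Sum.elim (N.edgeVec p s t g) (-N.edgeVec p s t g) δ)
      (Sum.elim (N.edgeVec p s t g) (-N.edgeVec p s t g) δ') := by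
  have h1 := hP.neighbor_bijective 0 (Sum.elim s t δ)
  have h2 := N.not_sameRay (hP.neighbor 0 _ ⟨δ, rfl⟩).2 (hP.neighbor 0 _ ⟨δ', h.symm⟩).2
    (fun he => hδ (congrArg Subtype.val (h1.1 (Subtype.ext he))))
  rwa [← sameRay_neg_iff, neg_sub, neg_sub, hP.pos_neighbor, hP.pos_neighbor,
    sameRay_neg_iff] at h2

section Double

variable {d ℓ k : ℕ} {N : PeriodicNetwork 3 d} {p : Fin 2 → N.Vert}
  {g : Fin 2 × Fin ℓ ⊕ Fin k → N.lattice}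

theorem edgeVec_loop {n d ℓ k : ℕ} {N : PeriodicNetwork n d} {p : Fin 2 → N.Vert}
    {g : Fin 2 × Fin ℓ ⊕ Fin k → N.lattice} (i : Fin 2) (j : Fin ℓ) :
    N.edgeVec p (doubleSrc ℓ k) (doubleTgt ℓ k) g (Sum.inl (i, j)) = g (Sum.inl (i, j)) := by
  simp [edgeVec, doubleSrc, doubleTgt]

/-- The vectors of the loops at a vertex of the double bouquet. -/
def loopVec (N : PeriodicNetwork 3 d) (p : Fin 2 → N.Vert)
    (g : Fin 2 × Fin ℓ ⊕ Fin k → N.lattice) (i : Fin 2) (j : Fin ℓ) : E3 :=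
  N.edgeVec p (doubleSrc ℓ k) (doubleTgt ℓ k) g (Sum.inl (i, j))

/-- The vectors of the edges joining the vertices of the double bouquet. -/
def linkVec (N : PeriodicNetwork 3 d) (p : Fin 2 → N.Vert)
    (g : Fin 2 × Fin ℓ ⊕ Fin k → N.lattice) (j : Fin k) : E3 :=
  N.edgeVec p (doubleSrc ℓ k) (doubleTgt ℓ k) g (Sum.inr j)

theorem linkVec_sub (i j : Fin k) :
    linkVec N p g i - linkVec N p g j = (g (Sum.inr i) - g (Sum.inr j) : N.lattice) := by
  simp [linkVec, edgeVec, doubleSrc, doubleTgt]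

theorem double_length (hP : N.Presentation p (doubleSrc ℓ k) (doubleTgt ℓ k) g) :
    N.length = totalLength (loopVec N p g 0) (loopVec N p g 1) (linkVec N p g) := by
  rw [hP.length_eq, Fintype.sum_sum_type, Fintype.sum_prod_type, Fin.sum_univ_two]
  rfl

theorem loopVec_ne_zero (hP : N.Presentation p (doubleSrc ℓ k) (doubleTgt ℓ k) g)
    (i : Fin 2) (j : Fin ℓ) : loopVec N p g i j ≠ 0 := hP.edgeVec_ne_zero _

theorem linkVec_ne_zero (hP : N.Presentation p (doubleSrc ℓ k) (doubleTgt ℓ k) g)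
    (j : Fin k) : linkVec N p g j ≠ 0 := hP.edgeVec_ne_zero _

theorem linkVec_injective (hP : N.Presentation p (doubleSrc ℓ k) (doubleTgt ℓ k) g) :
    Function.Injective (linkVec N p g) := by
  intro i j h
  by_contra hij
  have := hP.not_sameRay (δ := Sum.inl (Sum.inr i)) (δ' := Sum.inl (Sum.inr j)) rfl
    (by simpa using hij)
  apply this
  change SameRay ℝ (linkVec N p g i) (linkVec N p g j)
  rw [h]

/-- A loop of the quotient lifts to two edges at each vertex over it, with opposite vectors.
Embeddedness of the star therefore excludes both equal and opposite directions. -/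
theorem loopVec_linearIndependent (hP : N.Presentation p (doubleSrc ℓ k) (doubleTgt ℓ k) g)
    (m : Fin 2) (i j : Fin ℓ) (hij : i ≠ j) :
    LinearIndependent ℝ ![loopVec N p g m i, loopVec N p g m j] := by
  by_contra h
  rcases sameRay_or_sameRay_neg_iff_not_linearIndependent.2 h with h | h
  · exact hP.not_sameRay (δ := Sum.inl (Sum.inl (m, i))) (δ' := Sum.inl (Sum.inl (m, j))) rfl
      (by simpa using hij) h
  · exact hP.not_sameRay (δ := Sum.inl (Sum.inl (m, i))) (δ' := Sum.inr (Sum.inl (m, j))) rfl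
      (by simp) h

theorem link_pos (hP : N.Presentation p (doubleSrc ℓ k) (doubleTgt ℓ k) g) : 0 < k := by
  rcases Nat.eq_zero_or_pos k with rfl | h
  · have := hP.connected_induction (Q := fun _ i => i = 0) (i₀ := 0) (fun a e => ?_) rfl 0 1
    · simp at this
    · rcases e with ⟨i, j⟩ | e
      · rfl
      · exact e.elim0
  · exact h

theorem edgeGens_subset :
    edgeGens (loopVec N p g 0) (loopVec N p g 1) (linkVec N p g) ⊆ N.lattice := by
  rintro v ((⟨i, rfl⟩ | ⟨i, rfl⟩) | ⟨i, j, rfl⟩)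
  · rw [loopVec, edgeVec_loop]
    exact Subtype.prop _
  · rw [loopVec, edgeVec_loop]
    exact Subtype.prop _
  · rw [linkVec_sub]
    exact Subtype.prop _

theorem span_edgeGens (hP : N.Presentation p (doubleSrc ℓ k) (doubleTgt ℓ k) g) :
    Submodule.span ℤ (edgeGens (loopVec N p g 0) (loopVec N p g 1) (linkVec N p g)) =
      N.lattice := by
  refine le_antisymm (Submodule.span_le.2 edgeGens_subset) ?_
  -- This potential gives the first link voltage zero and turns the other link voltages into
  -- differences of link vectors.
  have h := hP.connected_closure ![0, -g (Sum.inr ⟨0, hP.link_pos⟩)]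
    (H := ((Submodule.span ℤ (edgeGens (loopVec N p g 0) (loopVec N p g 1)
      (linkVec N p g))).comap N.lattice.subtype).toAddSubgroup) ?_
  · intro v hv
    have h1 : (⟨v, hv⟩ : N.lattice) ∈ (⊤ : AddSubgroup N.lattice) := trivial
    rw [← h] at h1
    exact h1
  · rintro (⟨i, j⟩ | j)
    · have h1 : loopVec N p g i j ∈ Submodule.span ℤ (edgeGens (loopVec N p g 0)
          (loopVec N p g 1) (linkVec N p g)) := by
        fin_cases i
        · exact Submodule.subset_span (Or.inl (Or.inl ⟨j, rfl⟩))
        · exact Submodule.subset_span (Or.inl (Or.inr ⟨j, rfl⟩))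
      rw [loopVec, edgeVec_loop] at h1
      simpa [doubleSrc, doubleTgt] using h1
    · have h1 : linkVec N p g j - linkVec N p g ⟨0, hP.link_pos⟩ ∈ Submodule.span ℤ (edgeGens
          (loopVec N p g 0) (loopVec N p g 1) (linkVec N p g)) :=
        Submodule.subset_span (Or.inr ⟨_, _, rfl⟩)
      rw [linkVec_sub] at h1
      simpa [doubleSrc, doubleTgt, sub_eq_add_neg] using h1

theorem span_real_edgeGens (hP : N.Presentation p (doubleSrc ℓ k) (doubleTgt ℓ k) g) :
    Submodule.span ℝ (edgeGens (loopVec N p g 0) (loopVec N p g 1) (linkVec N p g)) = ⊤ :=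
  span_real_eq_top_of_span_int hP.span_edgeGens

/-- The loops exert no net force, so a single link would leave a force of norm one. -/
theorem one_lt_of_balanced (hP : N.Presentation p (doubleSrc ℓ k) (doubleTgt ℓ k) g)
    (hN : N.Balanced) : 1 < k := by
  by_contra h
  obtain rfl : k = 1 := by
    have := hP.link_pos
    omega
  have h1 := hP.force_eq 0 0
  rw [hN, Fintype.sum_sum_type, Finset.sum_eq_zero (fun e _ => by
    rw [show doubleTgt ℓ 1 (Sum.inl e) = doubleSrc ℓ 1 (Sum.inl e) from rfl, sub_self,
      zero_smul]), Finset.univ_unique, Finset.sum_singleton, zero_add] at h1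
  have h2 := hP.edgeVec_ne_zero (Sum.inr default)
  rw [eq_comm, smul_eq_zero, smul_eq_zero, inv_eq_zero, norm_eq_zero, or_iff_left h2,
    or_iff_left h2] at h1
  simp [doubleSrc, doubleTgt] at h1

end Double

section Single

variable {d ℓ : ℕ} {N : PeriodicNetwork 3 d} {p : Unit → N.Vert} {g : Fin ℓ → N.lattice}

theorem edgeVec_single {n d ℓ : ℕ} {N : PeriodicNetwork n d} {p : Unit → N.Vert}
    {g : Fin ℓ → N.lattice} (j : Fin ℓ) :
    N.edgeVec p (fun _ => ()) (fun _ => ()) g j = g j := by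
  simp [edgeVec]

theorem single_length
    (hP : N.Presentation p (fun _ : Fin ℓ => ()) (fun _ => ()) g) :
    N.length = ∑ i, ‖(g i : E3)‖ := by
  rw [hP.length_eq]
  simp only [edgeVec_single]

theorem single_degree {n d ℓ : ℕ} {N : PeriodicNetwork n d} {p : Unit → N.Vert}
    {g : Fin ℓ → N.lattice}
    (hP : N.Presentation p (fun _ : Fin ℓ => ()) (fun _ => ()) g) : 2 * ℓ = d := by
  have h := hP.degree_eq ()
  simp at h
  omega

theorem single_ne_zero (hP : N.Presentation p (fun _ : Fin ℓ => ()) (fun _ => ()) g)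
    (j : Fin ℓ) : (g j : E3) ≠ 0 := by
  rw [← edgeVec_single (p := p)]
  exact hP.edgeVec_ne_zero _

theorem span_single (hP : N.Presentation p (fun _ : Fin ℓ => ()) (fun _ => ()) g) :
    Submodule.span ℤ (Set.range fun i => (g i : E3)) = N.lattice := by
  refine le_antisymm (Submodule.span_le.2 ?_) ?_
  · rintro _ ⟨i, rfl⟩
    exact (g i).2
  have h := hP.connected_closure 0 (H := ((Submodule.span ℤ (Set.range fun i =>
    (g i : E3))).comap N.lattice.subtype).toAddSubgroup) ?_
  · intro v hv
    have h1 : (⟨v, hv⟩ : N.lattice) ∈ (⊤ : AddSubgroup N.lattice) := trivial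
    rw [← h] at h1
    exact h1
  · intro e
    have h1 : (g e : E3) ∈ Submodule.span ℤ (Set.range fun i => (g i : E3)) :=
      Submodule.subset_span ⟨e, rfl⟩
    simpa using h1

theorem span_real_single (hP : N.Presentation p (fun _ : Fin ℓ => ()) (fun _ => ()) g) :
    Submodule.span ℝ (Set.range fun i => (g i : E3)) = ⊤ :=
  span_real_eq_top_of_span_int hP.span_single

theorem three_le_single (hP : N.Presentation p (fun _ : Fin ℓ => ()) (fun _ => ()) g) :
    3 ≤ ℓ := by
  have h1 := finrank_range_le_card (R := ℝ) fun i => (g i : E3)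
  rw [Set.finrank, hP.span_real_single] at h1
  simpa using h1

end Single

end Presentation

/-! ### The possible quotient graphs -/

section Counting

variable {n d : ℕ} (N : PeriodicNetwork n d)

theorem numVertices_pos : 0 < N.numVertices := by
  have := N.finite_vert
  have := N.connected.nonempty.map N.proj
  exact Nat.card_pos

theorem hasQuotient_bouquet (h : N.numVertices = 1) :
    ∃ ℓ, 2 * ℓ = d ∧ N.HasQuotient (bouquet ℓ) := by
  have := N.finite_edge
  obtain ⟨f⟩ : Nonempty (N.QVert ≃ Unit) :=
    ⟨(Nat.equivFinOfCardPos (h.trans_ne one_ne_zero)).trans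
      ((finCongr h).trans (Equiv.ofUnique _ _))⟩
  have hQ : N.HasQuotient (bouquet (Nat.card N.QEdge)) :=
    graphIso_graphOfEnds_iff.2 ⟨f, Finite.equivFin _, fun e => Subsingleton.elim _ _⟩
  obtain ⟨p, g, hP⟩ := N.exists_presentation hQ
  exact ⟨_, hP.single_degree, hQ⟩

/-- Edges are counted by their unordered pair of ends. Both vertices have the same degree and the
same number of links, so they carry equally many loops. -/
theorem hasQuotient_doubleBouquet (h : N.numVertices = 2) :
    ∃ ℓ k, 2 * ℓ + k = d ∧ N.HasQuotient (doubleBouquet ℓ k) := by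
  have := N.finite_edge
  have := Fintype.ofFinite N.QEdge
  obtain ⟨f⟩ : Nonempty (N.QVert ≃ Fin 2) :=
    ⟨(Nat.equivFinOfCardPos (h.trans_ne two_ne_zero)).trans (finCongr h)⟩
  have hst : ∀ e, ∃ st : Fin 2 × Fin 2, s(st.1, st.2) = Sym2.map f (N.qEnds e) := fun e => by
    induction Sym2.map f (N.qEnds e) using Sym2.ind with
    | _ x y => exact ⟨(x, y), rfl⟩
  choose st hst using hst
  obtain ⟨p, g, hP⟩ := N.exists_presentation (s := fun e => (st e).1) (t := fun e => (st e).2)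
    (graphIso_graphOfEnds_iff.2 ⟨f, Equiv.refl _, fun e => hst e⟩)
  have hd := hP.degree_eq
  let E : Sym2 (Fin 2) → ℕ := fun c => ∑ e, if s((st e).1, (st e).2) = c then 1 else 0
  have h0 : d = 2 * E s(0, 0) + E s(0, 1) := by
    rw [hd 0, Finset.mul_sum, ← Finset.sum_add_distrib]
    refine Finset.sum_congr rfl fun e _ => ?_
    generalize st e = u
    revert u
    decide
  have h1 : d = 2 * E s(1, 1) + E s(0, 1) := by
    rw [hd 1, Finset.mul_sum, ← Finset.sum_add_distrib]
    refine Finset.sum_congr rfl fun e _ => ?_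
    generalize st e = u
    revert u
    decide
  refine ⟨E s(0, 0), E s(0, 1), h0.symm, ?_⟩
  rw [doubleBouquet_eq]
  -- The isomorphism is glued from bijections between the edge sets over each pair of ends.
  have hfib : ∀ c : Sym2 (Fin 2), Nonempty ({e // s((st e).1, (st e).2) = c} ≃
      {e // s(doubleSrc (E s(0, 0)) (E s(0, 1)) e, doubleTgt (E s(0, 0)) (E s(0, 1)) e) = c}) := by
    intro c
    refine Fintype.card_eq.1 ?_
    rw [Fintype.card_subtype, Fintype.card_subtype, Finset.card_filter, Finset.card_filter,
      Fintype.sum_sum_type, Fintype.sum_prod_type]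
    change E c = _
    have hc : c = s(0, 0) ∨ c = s(1, 1) ∨ c = s(0, 1) := by
      revert c
      decide
    rcases hc with rfl | rfl | rfl <;> simp [doubleSrc, doubleTgt]
    omega
  refine graphIso_graphOfEnds_iff.2 ⟨f, Equiv.ofFiberEquiv fun c => (hfib c).some, fun e => ?_⟩
  rw [← hst e]
  exact Equiv.ofFiberEquiv_map (f := fun e => s((st e).1, (st e).2))
    (g := fun e => s(doubleSrc (E s(0, 0)) (E s(0, 1)) e, doubleTgt (E s(0, 0)) (E s(0, 1)) e))
    (fun c => (hfib c).some) e

end Counting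

end PeriodicNetwork

/-! ### Construction of periodic networks -/

/-- The vertices of the covering with vertex orbits `ι` and group `Λ`. -/
@[ext]
structure CoverVert (Λ ι : Type) where
  /-- the translation -/
  shift : Λ
  /-- the orbit -/
  index : ι

/-- Data determining a periodic network: the lattice is generated by `basis`, the vertices are
the translates of the points `point i`, and each `e : β` gives the translates of the edge from
`point (src e)` to `volt e + point (tgt e)`. -/
structure CoverData (n d : ℕ) (ι β : Type) [DecidableEq ι] [Fintype β] where
  basis : Module.Basis (Fin n) ℝ (EuclideanSpace ℝ (Fin n))
  point : ι → EuclideanSpace ℝ (Fin n)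
  src : β → ι
  tgt : β → ι
  volt : β → EuclideanSpace ℝ (Fin n)
  base : ι
  two_le : 2 ≤ n
  three_le : 3 ≤ d
  span_volt : Submodule.span ℤ (Set.range volt) = Submodule.span ℤ (Set.range basis)
  degree : ∀ i, ∑ e, ((if src e = i then 1 else 0) + (if tgt e = i then 1 else 0)) = d
  edge_ne_zero : ∀ e, volt e + point (tgt e) - point (src e) ≠ 0
  -- Besides making the stars embedded, this condition separates the neighbours of a vertex and so
  -- yields the correct degree.
  ray : ∀ δ δ' : β ⊕ β, Sum.elim src tgt δ = Sum.elim src tgt δ' →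
    SameRay ℝ (Sum.elim (fun e => volt e + point (tgt e) - point (src e))
        (-fun e => volt e + point (tgt e) - point (src e)) δ)
      (Sum.elim (fun e => volt e + point (tgt e) - point (src e))
        (-fun e => volt e + point (tgt e) - point (src e)) δ') → δ = δ'
  -- A star-shaped spanning tree of voltage zero; together with `span_volt` it makes the covering
  -- connected.
  tree : ∀ i, i = base ∨ ∃ e, src e = base ∧ tgt e = i ∧ volt e = 0

namespace CoverData

variable {n d : ℕ} {ι β : Type} [DecidableEq ι] [Fintype β] (D : CoverData n d ι β)

/-- The lattice of the data. -/
abbrev lattice : Submodule ℤ (EuclideanSpace ℝ (Fin n)) := Submodule.span ℤ (Set.range D.basis)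

/-- The voltages as elements of the lattice. -/
def voltage (e : β) : D.lattice :=
  ⟨D.volt e, by
    rw [lattice, ← D.span_volt]
    exact Submodule.subset_span ⟨e, rfl⟩⟩

/-- The initial vertex of an oriented edge. -/
abbrev dartSrc : β ⊕ β → ι := Sum.elim D.src D.tgt

/-- The terminal vertex of an oriented edge. -/
abbrev dartTgt : β ⊕ β → ι := Sum.elim D.tgt D.src

/-- The voltage of an oriented edge. -/
abbrev dartVolt : β ⊕ β → D.lattice := Sum.elim D.voltage (-D.voltage)

/-- The vector of an oriented edge. -/
abbrev dartVec : β ⊕ β → EuclideanSpace ℝ (Fin n) :=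
  Sum.elim (fun e => D.volt e + D.point (D.tgt e) - D.point (D.src e))
    (-fun e => D.volt e + D.point (D.tgt e) - D.point (D.src e))

theorem dartVec_eq (δ : β ⊕ β) :
    D.dartVec δ = D.dartVolt δ + D.point (D.dartTgt δ) - D.point (D.dartSrc δ) := by
  cases δ with
  | inl e => rfl
  | inr e =>
    simp only [dartVec, dartVolt, dartTgt, dartSrc, Sum.elim_inr, Pi.neg_apply,
      Submodule.coe_neg, voltage]
    abel

theorem dartVec_ne_zero (δ : β ⊕ β) : D.dartVec δ ≠ 0 := by
  cases δ with
  | inl e => exact D.edge_ne_zero e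
  | inr e => exact neg_ne_zero.2 (D.edge_ne_zero e)

theorem dart_injective :
    Function.Injective fun δ => (D.dartSrc δ, D.dartTgt δ, D.dartVolt δ) := by
  intro δ δ' h
  simp only [Prod.mk.injEq] at h
  obtain ⟨h1, h2, h3⟩ := h
  refine D.ray δ δ' h1 ?_
  change SameRay ℝ (D.dartVec δ) (D.dartVec δ')
  rw [dartVec_eq, dartVec_eq, h1, h2, h3]

/-- The underlying graph of the covering. -/
def graph : SimpleGraph (CoverVert D.lattice ι) where
  Adj v w := ∃ δ, D.dartSrc δ = v.index ∧ D.dartTgt δ = w.index ∧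
    v.shift + D.dartVolt δ = w.shift
  symm := ⟨by
    rintro v w ⟨δ | δ, h1, h2, h3⟩
    · exact ⟨Sum.inr δ, h2, h1, by rw [← h3]; simp⟩
    · exact ⟨Sum.inl δ, h2, h1, by rw [← h3]; simp⟩⟩
  loopless := ⟨by
    rintro v ⟨δ, h1, h2, h3⟩
    apply D.dartVec_ne_zero δ
    rw [dartVec_eq, h1, h2, add_eq_left.1 h3]
    simp⟩

instance : AddAction D.lattice (CoverVert D.lattice ι) where
  vadd g v := ⟨g + v.shift, v.index⟩
  zero_vadd _ := CoverVert.ext (zero_add _) rfl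
  add_vadd _ _ _ := CoverVert.ext (add_assoc _ _ _) rfl

theorem vadd_def (g : D.lattice) (v : CoverVert D.lattice ι) :
    g +ᵥ v = ⟨g + v.shift, v.index⟩ := rfl

/-- The position of a vertex. -/
def pos (v : CoverVert D.lattice ι) : EuclideanSpace ℝ (Fin n) := v.shift + D.point v.index

theorem pos_sub_pos {v w : CoverVert D.lattice ι} {δ : β ⊕ β} (h1 : D.dartSrc δ = v.index)
    (h2 : D.dartTgt δ = w.index) (h3 : v.shift + D.dartVolt δ = w.shift) :
    D.pos w - D.pos v = D.dartVec δ := by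
  rw [pos, pos, dartVec_eq, h1, h2, ← h3, Submodule.coe_add]
  abel

theorem adj_vadd (g : D.lattice) (v w : CoverVert D.lattice ι) (h : D.graph.Adj v w) :
    D.graph.Adj (g +ᵥ v) (g +ᵥ w) := by
  obtain ⟨δ, h1, h2, h3⟩ := h
  exact ⟨δ, h1, h2, by rw [vadd_def, vadd_def, ← h3, add_assoc]⟩

theorem degree_eq (v : CoverVert D.lattice ι) : (D.graph.neighborSet v).ncard = d := by
  let F : {δ // D.dartSrc δ = v.index} → CoverVert D.lattice ι :=
    fun δ => ⟨v.shift + D.dartVolt δ.1, D.dartTgt δ.1⟩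
  have hF : D.graph.neighborSet v = Set.range F := by
    ext w
    constructor
    · rintro ⟨δ, h1, h2, h3⟩
      exact ⟨⟨δ, h1⟩, CoverVert.ext h3 h2⟩
    · rintro ⟨δ, rfl⟩
      exact ⟨δ.1, δ.2, rfl, rfl⟩
  have hinj : Function.Injective F := by
    intro δ δ' h
    refine Subtype.ext (D.dart_injective ?_)
    simp only [F, CoverVert.mk.injEq, add_right_inj] at h
    simp only [Prod.mk.injEq]
    exact ⟨δ.2.trans δ'.2.symm, h.2, h.1⟩
  refine Eq.trans ?_ (D.degree v.index)
  rw [hF, Set.ncard_range_of_injective hinj, Nat.card_eq_fintype_card, Finset.sum_add_distrib,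
    ← PeriodicNetwork.Presentation.sum_darts D.src D.tgt v.index fun _ => 1]
  simp

/-- The translations whose image of the base vertex is reachable from the base vertex form a
subgroup. The tree edges show that it contains every voltage, hence it is the whole lattice. -/
theorem connected : D.graph.Connected := by
  have tr : ∀ (g : D.lattice) {v w}, D.graph.Reachable v w →
      D.graph.Reachable (g +ᵥ v) (g +ᵥ w) := by
    rintro g v w ⟨W⟩
    induction W with
    | nil => rfl
    | cons h _ ih => exact (D.adj_vadd g _ _ h).reachable.trans ih
  have htree : ∀ i, D.graph.Reachable ⟨0, D.base⟩ ⟨0, i⟩ := by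
    intro i
    rcases D.tree i with rfl | ⟨e, h1, h2, h3⟩
    · rfl
    · refine SimpleGraph.Adj.reachable ⟨Sum.inl e, h1, h2, ?_⟩
      rw [zero_add]
      exact Subtype.ext h3
  have htree' : ∀ (g : D.lattice) i, D.graph.Reachable ⟨g, D.base⟩ ⟨g, i⟩ := by
    intro g i
    have := tr g (htree i)
    simpa only [vadd_def, add_zero] using this
  let H : AddSubgroup D.lattice :=
    { carrier := {g | D.graph.Reachable ⟨0, D.base⟩ ⟨g, D.base⟩}
      zero_mem' := SimpleGraph.Reachable.refl _
      add_mem' := by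
        intro g h hg hh
        have := tr g hh
        simp only [vadd_def, add_zero] at this
        exact SimpleGraph.Reachable.trans hg this
      neg_mem' := by
        intro g hg
        have := tr (-g) hg
        simp only [vadd_def, add_zero, neg_add_cancel] at this
        exact this.symm }
  have hv : ∀ e, D.voltage e ∈ H := by
    intro e
    have h1 : D.graph.Adj ⟨0, D.src e⟩ ⟨D.voltage e, D.tgt e⟩ :=
      ⟨Sum.inl e, rfl, rfl, zero_add _⟩
    exact (htree _).trans (h1.reachable.trans (htree' _ _).symm)
  have hH : ∀ g : D.lattice, g ∈ H := by
    rintro ⟨g, hg⟩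
    have h1 : Submodule.span ℤ (Set.range D.volt) ≤ H.toIntSubmodule.map D.lattice.subtype := by
      rw [Submodule.span_le]
      rintro _ ⟨e, rfl⟩
      exact ⟨D.voltage e, hv e, rfl⟩
    rw [D.span_volt] at h1
    obtain ⟨g', h2, h3⟩ := h1 hg
    obtain rfl : g' = ⟨g, hg⟩ := Subtype.ext h3
    exact h2
  have : Nonempty (CoverVert D.lattice ι) := ⟨⟨0, D.base⟩⟩
  refine SimpleGraph.Connected.mk fun v w => ?_
  have all : ∀ v, D.graph.Reachable ⟨0, D.base⟩ v := fun v => (hH v.shift).trans (htree' _ _)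
  exact (all v).symm.trans (all w)

theorem immersed (v w w' : CoverVert D.lattice ι) (h : D.graph.Adj v w) (h' : D.graph.Adj v w')
    (hw : w ≠ w') : segment ℝ (D.pos v) (D.pos w) ∩ segment ℝ (D.pos v) (D.pos w') =
      {D.pos v} := by
  obtain ⟨δ, h1, h2, h3⟩ := h
  obtain ⟨δ', h1', h2', h3'⟩ := h'
  refine Set.Subset.antisymm ?_ (by
    simpa using ⟨left_mem_segment ℝ _ _, left_mem_segment ℝ _ _⟩)
  rw [segment_eq_image', segment_eq_image', D.pos_sub_pos h1 h2 h3, D.pos_sub_pos h1' h2' h3']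
  rintro _ ⟨⟨a, ⟨ha, -⟩, rfl⟩, ⟨b, ⟨hb, -⟩, hab⟩⟩
  simp only [add_right_inj] at hab
  rw [Set.mem_singleton_iff, add_eq_left]
  rcases ha.eq_or_lt with rfl | ha
  · rw [zero_smul]
  rcases hb.eq_or_lt with rfl | hb
  · rw [← hab, zero_smul]
  obtain rfl := D.ray δ δ' (h1.trans h1'.symm) (Or.inr (Or.inr ⟨a, b, ha, hb, hab.symm⟩))
  exact (hw (CoverVert.ext (h3.symm.trans h3') (h2.symm.trans h2'))).elim

/-- The periodic network determined by the data. -/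
def network [Finite ι] : PeriodicNetwork n d where
  two_le := D.two_le
  three_le := D.three_le
  Vert := CoverVert D.lattice ι
  graph := D.graph
  connected := D.connected
  degree_eq := D.degree_eq
  pos := D.pos
  pos_ne := by
    rintro v w ⟨δ, h1, h2, h3⟩ h
    exact D.dartVec_ne_zero δ (by rw [← D.pos_sub_pos h1 h2 h3, h, sub_self])
  immersed := D.immersed
  lattice := D.lattice
  pos_vadd g v := add_assoc _ _ _
  adj_vadd := D.adj_vadd
  finite_vert := by
    refine Finite.of_surjective (fun i : ι => Quotient.mk (AddAction.orbitRel _ _)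
      (⟨0, i⟩ : CoverVert D.lattice ι)) ?_
    intro q
    induction q using Quotient.inductionOn with
    | h v =>
    refine ⟨v.index, Quotient.sound ⟨-v.shift, ?_⟩⟩
    simp [vadd_def]
  finite_edge := by
    refine Finite.of_surjective (fun e : β => Quotient.mk (edgeOrbitRel D.lattice D.graph)
      ⟨s(⟨0, D.src e⟩, ⟨D.voltage e, D.tgt e⟩), ⟨Sum.inl e, rfl, rfl, zero_add _⟩⟩) ?_
    intro q
    induction q using Quotient.inductionOn with
    | h c =>
    obtain ⟨c, hc⟩ := c
    induction c using Sym2.ind with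
    | _ v w =>
    obtain ⟨δ | δ, h1, h2, h3⟩ := id (show D.graph.Adj v w from hc)
    · refine ⟨δ, Quotient.sound ⟨v.shift, ?_⟩⟩
      simp only [Sum.elim_inl] at h1 h2 h3
      simp [vadd_def, h1, h2, h3]
    · refine ⟨δ, Quotient.sound ⟨w.shift, ?_⟩⟩
      simp only [Sum.elim_inr, Pi.neg_apply] at h1 h2 h3
      have h4 : w.shift + D.voltage δ = v.shift := by
        rw [← h3, neg_add_cancel_right]
      simp [vadd_def, h1, h2, h4]

theorem presentation [Finite ι] : D.network.Presentation
    (fun i => (⟨0, i⟩ : CoverVert D.lattice ι)) D.src D.tgt D.voltage where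
  bij := by
    constructor
    · intro i j h
      obtain ⟨g, hg⟩ := D.network.proj_eq_iff.1 h
      exact congrArg CoverVert.index hg
    · intro q
      induction q using Quotient.inductionOn with
      | h v =>
      refine ⟨v.index, (D.network.proj_eq_iff).2 ⟨v.shift, ?_⟩⟩
      exact CoverVert.ext (add_zero _) rfl
  adj_iff i j h := by
    refine exists_congr fun δ => and_congr_right fun h1 => and_congr_right fun h2 => ?_
    change (0 : D.lattice) + D.dartVolt δ = (show D.lattice from h) + 0 ↔ D.dartVolt δ = h
    rw [zero_add, add_zero]
  inj := D.dart_injective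

theorem edgeVec_presentation [Finite ι] (e : β) :
    D.network.edgeVec (fun i => (⟨0, i⟩ : CoverVert D.lattice ι)) D.src D.tgt D.voltage e =
      D.volt e + D.point (D.tgt e) - D.point (D.src e) := by
  change D.volt e + ((0 : D.lattice) + D.point (D.tgt e)) -
    ((0 : D.lattice) + D.point (D.src e)) = _
  simp

end CoverData

/-! ### Similarity of networks -/

/-- Families of vectors with proportional Gram matrices differ by a similarity. -/
theorem exists_isometry_of_gram {κ : Type*} [Fintype κ] {E : Type*} [NormedAddCommGroup E]
    [InnerProductSpace ℝ E] [FiniteDimensional ℝ E] {v w : κ → E} {c : ℝ} (hc : 0 < c)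
    (h : ∀ i j, ⟪w i, w j⟫ = c ^ 2 * ⟪v i, v j⟫) (hv : Submodule.span ℝ (Set.range v) = ⊤) :
    ∃ A : E ≃ₗᵢ[ℝ] E, ∀ i, w i = c • A (v i) := by
  classical
  let f := Fintype.linearCombination ℝ v
  let g := Fintype.linearCombination ℝ w
  have hf : LinearMap.range f = ⊤ := by rw [Fintype.range_linearCombination, hv]
  have hfg : ∀ a, ‖g a‖ = c * ‖f a‖ := by
    intro a
    have h1 : ‖g a‖ ^ 2 = (c * ‖f a‖) ^ 2 := by
      rw [mul_pow, ← real_inner_self_eq_norm_sq, ← real_inner_self_eq_norm_sq]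
      simp only [f, g, Fintype.linearCombination_apply, sum_inner, inner_sum, real_inner_smul_left,
        real_inner_smul_right, h, Finset.mul_sum]
      exact Finset.sum_congr rfl fun i _ => Finset.sum_congr rfl fun j _ => by ring
    exact (pow_left_inj₀ (norm_nonneg _) (by positivity) two_ne_zero).1 h1
  -- Since `hfg` makes the kernel of `f` contained in that of `g`, the map `g ∘ s` does not depend
  -- on the chosen section `s`, and it sends each `v i` to `w i`.
  obtain ⟨s, hs⟩ := f.exists_rightInverse_of_surjective hf
  have hs' : ∀ u, f (s u) = u := fun u => congrArg (fun F => F u) hs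
  let T : E →ₗᵢ[ℝ] E :=
    { toLinearMap := c⁻¹ • (g ∘ₗ s)
      norm_map' := fun u => by
        simp only [LinearMap.smul_apply, LinearMap.comp_apply, norm_smul, norm_inv, hfg, hs',
          Real.norm_eq_abs, abs_of_pos hc]
        field_simp }
  refine ⟨T.toLinearIsometryEquiv rfl, fun i => ?_⟩
  have h1 : g (s (v i) - Pi.single i 1) = 0 := by
    rw [← norm_eq_zero, hfg, map_sub, hs']
    simp [f]
  rw [map_sub, sub_eq_zero] at h1
  have h2 : g (Pi.single i 1) = w i := by simp [g]
  rw [LinearIsometry.coe_toLinearIsometryEquiv]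
  change w i = c • c⁻¹ • g (s (v i))
  rw [h1, h2, smul_inv_smul₀ hc.ne']

namespace PeriodicNetwork

namespace Presentation

variable {n d : ℕ} {N : PeriodicNetwork n d} {ι β : Type} {p : ι → N.Vert}
  {s t : β → ι} {g : β → N.lattice}

/-! ### Relabelling and reversal of edges, and similarity from edge vectors -/

theorem change_darts (hP : N.Presentation p s t g) {s' t' : β → ι} {g' : β → N.lattice}
    (τ : β ⊕ β ≃ β ⊕ β) (h : ∀ δ, Sum.elim s' t' δ = Sum.elim s t (τ δ) ∧
      Sum.elim t' s' δ = Sum.elim t s (τ δ) ∧ Sum.elim g' (-g') δ = Sum.elim g (-g) (τ δ)) :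
    N.Presentation p s' t' g' where
  bij := hP.bij
  adj_iff i j a := by
    rw [hP.adj_iff, ← τ.exists_congr_right]
    exact exists_congr fun δ => by rw [(h δ).1, (h δ).2.1, (h δ).2.2]
  inj := by
    have h1 := hP.inj.comp τ.injective
    convert! h1 using 1
    funext δ
    simp only [Function.comp, h δ]

theorem reindex (hP : N.Presentation p s t g) (σ : β ≃ β) (hs : ∀ e, s (σ e) = s e)
    (ht : ∀ e, t (σ e) = t e) : N.Presentation p s t (g ∘ σ) :=
  hP.change_darts (Equiv.sumCongr σ σ) fun δ => by cases δ <;> simp [hs, ht]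

/-- Reversing a loop keeps its ends and negates its voltage, so presentations determine loop vectors
only up to sign. -/
theorem flip_loops (hP : N.Presentation p s t g) (L : β → Bool)
    (hL : ∀ e, L e → s e = t e) :
    N.Presentation p s t (fun e => if L e then -g e else g e) := by
  let F : β ⊕ β → β ⊕ β := fun δ => if L (Sum.elim id id δ) then δ.swap else δ
  have hF : Function.Involutive F := by
    intro δ
    by_cases h : L (Sum.elim id id δ)
    · have h' : L (Sum.elim id id δ.swap) := by cases δ <;> exact h
      simp only [F, if_pos h, if_pos h', Sum.swap_swap]
    · simp only [F, if_neg h]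
  refine hP.change_darts hF.toPerm fun δ => ?_
  rw [Function.Involutive.coe_toPerm]
  cases δ with
  | inl e =>
    by_cases h : L e
    · simp [F, h, hL e h]
    · simp [F, h]
  | inr e =>
    by_cases h : L e
    · simp [F, h, hL e h]
    · simp [F, h]

/-- Presentations with the same voltages define similar networks. -/
theorem similar_of_map (hP : N.Presentation p s t g) {M : PeriodicNetwork n d}
    {p' : ι → M.Vert} {g' : β → M.lattice} (hM : M.Presentation p' s t g') {r : ℝ} (hr : 0 < r)
    (A : EuclideanSpace ℝ (Fin n) ≃ₗᵢ[ℝ] EuclideanSpace ℝ (Fin n))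
    (b : EuclideanSpace ℝ (Fin n)) (ψ : N.lattice ≃+ M.lattice)
    (hψ : ∀ a, (ψ a : EuclideanSpace ℝ (Fin n)) = r • A a)
    (hpos : ∀ i, M.pos (p' i) = r • A (N.pos (p i)) + b) (hg : ∀ e, ψ (g e) = g' e) :
    N.Similar M := by
  let eN := Equiv.ofBijective _ hP.vert_bijective
  let eM := Equiv.ofBijective _ hM.vert_bijective
  let φ : N.Vert ≃ M.Vert := eN.symm.trans ((ψ.toEquiv.prodCongr (Equiv.refl ι)).trans eM)
  have hφ : ∀ a i, φ (a +ᵥ p i) = ψ a +ᵥ p' i := by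
    intro a i
    have h1 : eN.symm (a +ᵥ p i) = (a, i) := eN.symm_apply_apply (a, i)
    change eM (ψ (eN.symm (a +ᵥ p i)).1, (eN.symm (a +ᵥ p i)).2) = _
    rw [h1]
    rfl
  have hadj : ∀ {v w}, M.graph.Adj (φ v) (φ w) ↔ N.graph.Adj v w := by
    intro v w
    obtain ⟨a, i, rfl⟩ := hP.exists_vadd_eq v
    obtain ⟨c, j, rfl⟩ := hP.exists_vadd_eq w
    rw [hφ, hφ, M.adj_vadd_vadd_iff, N.adj_vadd_vadd_iff, hP.adj_iff, hM.adj_iff, ← map_sub]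
    refine exists_congr fun δ => and_congr_right fun _ => and_congr_right fun _ => ?_
    have h1 : Sum.elim g' (-g') δ = ψ (Sum.elim g (-g) δ) := by
      cases δ <;> simp [hg]
    rw [h1, ψ.injective.eq_iff]
  refine ⟨r, A, b, ⟨φ, hadj⟩, ψ, hr, fun v => ?_, hψ, fun a v => ?_⟩
  · obtain ⟨a, i, rfl⟩ := hP.exists_vadd_eq v
    change M.pos (φ (a +ᵥ p i)) = _
    rw [hφ, M.pos_vadd, N.pos_vadd, hpos, hψ, map_add, smul_add, add_assoc]
  · obtain ⟨c, i, rfl⟩ := hP.exists_vadd_eq v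
    change φ (a +ᵥ c +ᵥ p i) = ψ a +ᵥ φ (c +ᵥ p i)
    rw [vadd_vadd, hφ, hφ, map_add, vadd_vadd]

/-- The image of the edges under a similarity of the edge vectors. -/
theorem exists_image (hP : N.Presentation p s t g) {M : PeriodicNetwork n d}
    {p' : ι → M.Vert} {g' : β → M.lattice} {r : ℝ}
    (A : EuclideanSpace ℝ (Fin n) ≃ₗᵢ[ℝ] EuclideanSpace ℝ (Fin n))
    (hX : ∀ e, M.edgeVec p' s t g' e = r • A (N.edgeVec p s t g e)) (i₀ : ι) (a : N.lattice)
    (i : ι) : ∃ a' : M.lattice, (a' : EuclideanSpace ℝ (Fin n)) + M.pos (p' i) - M.pos (p' i₀) =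
      r • A (a + N.pos (p i) - N.pos (p i₀)) := by
  refine hP.connected_induction (Q := fun a i => ∃ a' : M.lattice,
    (a' : EuclideanSpace ℝ (Fin n)) + M.pos (p' i) - M.pos (p' i₀) =
      r • A (a + N.pos (p i) - N.pos (p i₀))) (i₀ := i₀) (fun a e => ?_) ⟨0, by simp⟩ a i
  have hX' := hX e
  simp only [edgeVec] at hX'
  have h1 : r • A ((a + g e : N.lattice) + N.pos (p (t e)) - N.pos (p i₀)) =
      (g' e + M.pos (p' (t e)) - M.pos (p' (s e))) +
        r • A (a + N.pos (p (s e)) - N.pos (p i₀)) := by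
    rw [hX', ← smul_add, ← map_add, Submodule.coe_add]
    congr 2
    abel
  constructor
  · rintro ⟨a', ha'⟩
    refine ⟨a' + g' e, ?_⟩
    rw [h1, ← ha', Submodule.coe_add]
    abel
  · rintro ⟨a', ha'⟩
    refine ⟨a' - g' e, ?_⟩
    rw [h1, ← sub_eq_iff_eq_add'] at ha'
    rw [← ha', Submodule.coe_sub]
    abel

/-- Edge vectors determine a network up to translation. By `exists_image`, applied in both
directions, the linear similarity identifies the lattices. -/
theorem similar_of_edgeVec (hP : N.Presentation p s t g) {M : PeriodicNetwork n d}
    {p' : ι → M.Vert} {g' : β → M.lattice} (hM : M.Presentation p' s t g') {r : ℝ} (hr : 0 < r)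
    (A : EuclideanSpace ℝ (Fin n) ≃ₗᵢ[ℝ] EuclideanSpace ℝ (Fin n))
    (hX : ∀ e, M.edgeVec p' s t g' e = r • A (N.edgeVec p s t g e)) : N.Similar M := by
  obtain ⟨i₀⟩ := hP.index_nonempty
  have h1 := hP.exists_image A hX i₀
  have hX' : ∀ e, N.edgeVec p s t g e = r⁻¹ • A.symm (M.edgeVec p' s t g' e) := fun e => by
    rw [hX, map_smul, A.symm_apply_apply, inv_smul_smul₀ hr.ne']
  have h2 := hM.exists_image A.symm hX' i₀
  choose F hF using fun a => h1 a i₀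
  choose G hG using fun a => h2 a i₀
  simp only [add_sub_cancel_right] at hF hG
  let ψ : N.lattice ≃+ M.lattice :=
    { toFun := F
      invFun := G
      left_inv := fun a => Subtype.ext (by
        rw [hG, hF, map_smul, A.symm_apply_apply, inv_smul_smul₀ hr.ne'])
      right_inv := fun a => Subtype.ext (by
        rw [hF, hG, map_smul, A.apply_symm_apply, smul_inv_smul₀ hr.ne'])
      map_add' := fun a c => Subtype.ext (by
        rw [hF, Submodule.coe_add, Submodule.coe_add, hF, hF, map_add, smul_add]) }
  -- The images of the representatives differ from the representatives of `M` by lattice vectors `b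
  -- i`, which `shift` absorbs.
  choose b hb using fun i => h1 0 i
  have hψ : ∀ a, (ψ a : EuclideanSpace ℝ (Fin n)) = r • A a := hF
  refine hP.similar_of_map (hM.shift b) hr A (M.pos (p' i₀) - r • A (N.pos (p i₀))) ψ hψ
    (fun i => ?_) fun e => Subtype.ext ?_
  · have h3 := hb i
    rw [Submodule.coe_zero, zero_add, map_sub, smul_sub, sub_eq_iff_eq_add] at h3
    rw [M.pos_vadd, h3]
    abel
  · have h3 := hb (s e)
    have h4 := hb (t e)
    have h5 := hX e
    simp only [edgeVec, Submodule.coe_zero, zero_add, map_sub, map_add, smul_sub,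
      smul_add] at h3 h4 h5
    rw [hψ, Submodule.coe_sub, Submodule.coe_add]
    linear_combination (norm := module) h4 - h3 - h5

end Presentation

end PeriodicNetwork

namespace PeriodicNetwork

namespace Presentation

/-! ### Similarity of double bouquet and bouquet networks -/

section Double

variable {d ℓ k : ℕ} {N M : PeriodicNetwork 3 d} {p : Fin 2 → N.Vert}
  {g : Fin 2 × Fin ℓ ⊕ Fin k → N.lattice} {p' : Fin 2 → M.Vert}
  {g' : Fin 2 × Fin ℓ ⊕ Fin k → M.lattice}

theorem span_sum_elim_eq_top (hN : N.Presentation p (doubleSrc ℓ k) (doubleTgt ℓ k) g) :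
    Submodule.span ℝ (Set.range (Sum.elim (loopVec N p g 0)
      (Sum.elim (loopVec N p g 1) (linkVec N p g)))) = ⊤ := by
  rw [eq_top_iff, ← hN.span_real_edgeGens, Submodule.span_le]
  rintro v ((⟨i, rfl⟩ | ⟨i, rfl⟩) | ⟨i, j, rfl⟩)
  · exact Submodule.subset_span ⟨Sum.inl i, rfl⟩
  · exact Submodule.subset_span ⟨Sum.inr (Sum.inl i), rfl⟩
  · exact Submodule.sub_mem _ (Submodule.subset_span ⟨Sum.inr (Sum.inr i), rfl⟩)
      (Submodule.subset_span ⟨Sum.inr (Sum.inr j), rfl⟩)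

theorem similar_of_gram (hN : N.Presentation p (doubleSrc ℓ k) (doubleTgt ℓ k) g)
    (hM : M.Presentation p' (doubleSrc ℓ k) (doubleTgt ℓ k) g') {c : ℝ} (hc : 0 < c)
    (h : ∀ i j, ⟪Sum.elim (loopVec M p' g' 0) (Sum.elim (loopVec M p' g' 1) (linkVec M p' g')) i,
      Sum.elim (loopVec M p' g' 0) (Sum.elim (loopVec M p' g' 1) (linkVec M p' g')) j⟫ =
      c ^ 2 * ⟪Sum.elim (loopVec N p g 0) (Sum.elim (loopVec N p g 1) (linkVec N p g)) i,
      Sum.elim (loopVec N p g 0) (Sum.elim (loopVec N p g 1) (linkVec N p g)) j⟫) :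
    N.Similar M := by
  obtain ⟨A, hA⟩ := exists_isometry_of_gram hc h hN.span_sum_elim_eq_top
  refine hN.similar_of_edgeVec hM hc A ?_
  rintro (⟨i, j⟩ | j)
  · fin_cases i
    · exact hA (Sum.inl j)
    · exact hA (Sum.inr (Sum.inl j))
  · exact hA (Sum.inr (Sum.inr j))

/-- Equality cases determine the configuration only up to the order of the links and the orientation
of the loops at the second vertex. Neither affects the network. -/
theorem similar_of_gram_perm (hN : N.Presentation p (doubleSrc ℓ k) (doubleTgt ℓ k) g)
    (hM : M.Presentation p' (doubleSrc ℓ k) (doubleTgt ℓ k) g') (σ : Equiv.Perm (Fin k))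
    {ε : ℝ} (hε : ε = 1 ∨ ε = -1) {c : ℝ} (hc : 0 < c)
    (h : ∀ i j, ⟪Sum.elim (loopVec M p' g' 0) (Sum.elim (ε • loopVec M p' g' 1)
        (linkVec M p' g' ∘ σ)) i,
      Sum.elim (loopVec M p' g' 0) (Sum.elim (ε • loopVec M p' g' 1)
        (linkVec M p' g' ∘ σ)) j⟫ =
      c ^ 2 * ⟪Sum.elim (loopVec N p g 0) (Sum.elim (loopVec N p g 1) (linkVec N p g)) i,
      Sum.elim (loopVec N p g 0) (Sum.elim (loopVec N p g 1) (linkVec N p g)) j⟫) :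
    N.Similar M := by
  have hM1 := hM.reindex (Equiv.sumCongr (Equiv.refl _) σ) (by rintro (e | e) <;> rfl)
    (by rintro (e | e) <;> rfl)
  rcases hε with rfl | rfl
  · rw [one_smul] at h
    exact hN.similar_of_gram hM1 hc h
  · have hM2 := hM1.flip_loops (Sum.elim (fun e => decide (e.1 = 1)) fun _ => false)
      (by rintro (e | e) he <;> [rfl; simp at he])
    refine hN.similar_of_gram hM2 hc ?_
    have h1 : loopVec M p' g' 0 = loopVec M p' (fun e => if Sum.elim (fun e => decide (e.1 = 1))
        (fun _ => false) e then -(g' ∘ Equiv.sumCongr (Equiv.refl _) σ) e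
        else (g' ∘ Equiv.sumCongr (Equiv.refl _) σ) e) 0 := by
      funext j
      simp [loopVec, edgeVec_loop]
    have h2 : (-1 : ℝ) • loopVec M p' g' 1 = loopVec M p' (fun e => if Sum.elim
        (fun e => decide (e.1 = 1)) (fun _ => false) e
        then -(g' ∘ Equiv.sumCongr (Equiv.refl _) σ) e
        else (g' ∘ Equiv.sumCongr (Equiv.refl _) σ) e) 1 := by
      funext j
      simp [loopVec, edgeVec_loop]
    rw [h1, h2] at h
    exact h

end Double

section Single

variable {d ℓ : ℕ} {N M : PeriodicNetwork 3 d} {p : Unit → N.Vert} {g : Fin ℓ → N.lattice}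
  {p' : Unit → M.Vert} {g' : Fin ℓ → M.lattice}

theorem similar_of_gram_single (hN : N.Presentation p (fun _ : Fin ℓ => ()) (fun _ => ()) g)
    (hM : M.Presentation p' (fun _ : Fin ℓ => ()) (fun _ => ()) g') {c : ℝ} (hc : 0 < c)
    (h : ∀ i j, ⟪(g' i : E3), (g' j : E3)⟫ = c ^ 2 * ⟪(g i : E3), (g j : E3)⟫) :
    N.Similar M := by
  obtain ⟨A, hA⟩ := exists_isometry_of_gram hc h hN.span_real_single
  refine hN.similar_of_edgeVec hM hc A fun e => ?_
  rw [edgeVec_single, edgeVec_single]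
  exact hA e

theorem balanced_single (hN : N.Presentation p (fun _ : Fin ℓ => ()) (fun _ => ()) g) :
    N.Balanced := by
  intro v
  obtain ⟨a, i, rfl⟩ := hN.exists_vadd_eq v
  rw [hN.force_eq]
  simp

theorem hasLoopVectors (hN : N.Presentation p (fun _ : Fin ℓ => ()) (fun _ => ()) g) :
    N.HasLoopVectors fun i => (g i : E3) :=
  ⟨p (), fun i => ⟨g i, rfl, hN.adj i⟩⟩

end Single

section Double

variable {d ℓ k : ℕ} {N : PeriodicNetwork 3 d} {p : Fin 2 → N.Vert}
  {g : Fin 2 × Fin ℓ ⊕ Fin k → N.lattice}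

theorem balanced_double (hN : N.Presentation p (doubleSrc ℓ k) (doubleTgt ℓ k) g)
    (h : ∑ j, ‖linkVec N p g j‖⁻¹ • linkVec N p g j = 0) : N.Balanced := by
  intro v
  obtain ⟨a, i, rfl⟩ := hN.exists_vadd_eq v
  rw [hN.force_eq, Fintype.sum_sum_type, Finset.sum_eq_zero (fun e _ => by
    rw [show doubleTgt ℓ k (Sum.inl e) = doubleSrc ℓ k (Sum.inl e) from rfl, sub_self,
      zero_smul]), zero_add]
  change ∑ j : Fin k, ((if (1 : Fin 2) = i then 1 else 0) - (if (0 : Fin 2) = i then 1 else 0) : ℝ) •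
    ‖linkVec N p g j‖⁻¹ • linkVec N p g j = 0
  rw [← Finset.smul_sum, h, smul_zero]

theorem hasEdgeVectors (hN : N.Presentation p (doubleSrc ℓ k) (doubleTgt ℓ k) g) :
    N.HasEdgeVectors (loopVec N p g 0) (loopVec N p g 1) (linkVec N p g) := by
  refine ⟨p 0, p 1, fun h => ?_, fun i => ⟨g (Sum.inl (0, i)), ?_, hN.adj (Sum.inl (0, i))⟩,
    fun i => ⟨g (Sum.inl (1, i)), ?_, hN.adj (Sum.inl (1, i))⟩,
    fun j => ⟨g (Sum.inr j), ?_, hN.adj (Sum.inr j)⟩⟩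
  · exact absurd (hN.bij.1 h) (by simp)
  · exact (edgeVec_loop _ _).symm
  · exact (edgeVec_loop _ _).symm
  · rw [N.pos_vadd]
    rfl

theorem hasQuotient_double (hN : N.Presentation p (doubleSrc ℓ k) (doubleTgt ℓ k) g) :
    N.HasQuotient (doubleBouquet ℓ k) := by
  rw [doubleBouquet_eq]
  exact hN.hasQuotient

end Double

end Presentation

theorem exists_double_presentation {d ℓ k : ℕ} {N : PeriodicNetwork 3 d}
    (h : N.HasQuotient (doubleBouquet ℓ k)) : ∃ p g,
      N.Presentation p (doubleSrc ℓ k) (doubleTgt ℓ k) g := by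
  rw [doubleBouquet_eq] at h
  exact N.exists_presentation h

/-! ### The length quotient -/

section LengthQuotient

variable {d : ℕ} (N : PeriodicNetwork 3 d)

theorem volume_pos : 0 < N.volume := 
  ZLattice.covolume_pos N.lattice MeasureTheory.volume

theorem length_nonneg : 0 ≤ N.length := finsum_nonneg fun e => by
  induction e using Quotient.inductionOn with
  | h c =>
  obtain ⟨c, hc⟩ := c
  induction c using Sym2.ind with
  | _ v w => exact dist_nonneg (x := N.pos v) (y := N.pos w)

theorem lengthQuotient_nonneg : 0 ≤ N.lengthQuotient :=
  div_nonneg N.length_nonneg (Real.rpow_nonneg N.volume_pos.le _)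

theorem lengthQuotient_pow : N.lengthQuotient ^ 3 = N.length ^ 3 / N.volume := by
  rw [lengthQuotient, div_pow, ← Real.rpow_natCast, ← Real.rpow_natCast (N.volume ^ _),
    ← Real.rpow_mul N.volume_pos.le]
  norm_num

theorem rpow_third_pow {c : ℝ} (hc : 0 ≤ c) : (c ^ (1 / 3 : ℝ)) ^ 3 = c := by
  rw [← Real.rpow_natCast, ← Real.rpow_mul hc]
  norm_num

theorem rpow_third_twentySeven : (27 : ℝ) ^ (1 / 3 : ℝ) = 3 := by
  rw [show (27 : ℝ) = 3 ^ (3 : ℝ) by norm_num, ← Real.rpow_mul (by norm_num)]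
  norm_num

theorem rpow_le_lengthQuotient {c : ℝ} (hc : 0 ≤ c) (h : c * N.volume ≤ N.length ^ 3) :
    c ^ (1 / 3 : ℝ) ≤ N.lengthQuotient := by
  refine le_of_pow_le_pow_left₀ three_ne_zero N.lengthQuotient_nonneg ?_
  rw [rpow_third_pow hc, lengthQuotient_pow, le_div_iff₀ N.volume_pos]
  exact h

theorem lt_lengthQuotient {a c : ℝ} (ha : a ^ 3 ≤ c) (h : c * N.volume < N.length ^ 3) :
    a < N.lengthQuotient := by
  refine lt_of_pow_lt_pow_left₀ 3 N.lengthQuotient_nonneg (ha.trans_lt ?_)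
  rw [lengthQuotient_pow, lt_div_iff₀ N.volume_pos]
  exact h

theorem lengthQuotient_eq_iff {c : ℝ} (hc : 0 ≤ c) :
    N.lengthQuotient = c ^ (1 / 3 : ℝ) ↔ c * N.volume = N.length ^ 3 := by
  rw [← pow_left_inj₀ N.lengthQuotient_nonneg (Real.rpow_nonneg hc _) three_ne_zero,
    rpow_third_pow hc, lengthQuotient_pow, div_eq_iff N.volume_pos.ne', eq_comm]

variable {N}

/-- Once the bound is attained, every minimizer attains it too, so uniqueness is reduced to the
equality case of the bound. -/
theorem isMinimizer_of_bound {α β : Type} {Γ : Graph α β} {c : ℝ} (hc : 0 ≤ c)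
    (hI : ∀ M : PeriodicNetwork 3 d, M.HasQuotient Γ → M.Irreducible)
    (hb : ∀ M : PeriodicNetwork 3 d, M.HasQuotient Γ → c * M.volume ≤ M.length ^ 3)
    (hN : N.HasQuotient Γ) (he : c * N.volume = N.length ^ 3) :
    N.IsMinimizer Γ ∧ N.lengthQuotient = c ^ (1 / 3 : ℝ) ∧
      ∀ M : PeriodicNetwork 3 d, M.IsMinimizer Γ → c * M.volume = M.length ^ 3 := by
  have h1 := (N.lengthQuotient_eq_iff hc).2 he
  refine ⟨⟨hI N hN, hN, fun M _ hM => ?_⟩, h1, fun M hM => ?_⟩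
  · rw [h1]
    exact M.rpow_le_lengthQuotient hc (hb M hM)
  · refine (M.lengthQuotient_eq_iff hc).1 (le_antisymm ?_ ?_)
    · rw [← h1]
      exact hM.2.2 N (hI N hN) hN
    · exact M.rpow_le_lengthQuotient hc (hb M hM.2.1)

end LengthQuotient

/-! ### Irreducibility -/

section Irreducibility

theorem numVertices_bouquet {d ℓ : ℕ} {N : PeriodicNetwork 3 d} (h : N.HasQuotient (bouquet ℓ)) :
    N.numVertices = 1 := by
  obtain ⟨p, g, hP⟩ := N.exists_presentation h
  exact hP.numVertices_eq

theorem numVertices_doubleBouquet {d ℓ k : ℕ} {N : PeriodicNetwork 3 d}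
    (h : N.HasQuotient (doubleBouquet ℓ k)) : N.numVertices = 2 := by
  obtain ⟨p, g, hP⟩ := exists_double_presentation h
  exact hP.numVertices_eq

/-- A quotient with one vertex is a bouquet whose loops span space, so there are at least three
loops and the degree is even and at least 6. -/
theorem two_le_numVertices {d : ℕ} (hd : d < 6 ∨ Odd d) (N : PeriodicNetwork 3 d) :
    2 ≤ N.numVertices := by
  by_contra h
  have h0 := N.numVertices_pos
  obtain ⟨ℓ, h1, h2⟩ := N.hasQuotient_bouquet (by omega)
  obtain ⟨p, g, hP⟩ := N.exists_presentation h2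
  have := hP.three_le_single
  rcases hd with hd | ⟨m, hm⟩ <;> omega

theorem irreducible_of_numVertices_eq_two {d : ℕ} (hd : d < 6 ∨ Odd d)
    {M : PeriodicNetwork 3 d} (hM : M.Balanced) (hM2 : M.numVertices = 2)
    {N : PeriodicNetwork 3 d} (hN : N.numVertices = 2) : N.Irreducible := by
  refine ⟨⟨M, hM, hM2.trans hN.symm⟩, ?_⟩
  rintro _ ⟨K, -, rfl⟩
  rw [hN]
  exact two_le_numVertices hd K

theorem irreducible_of_numVertices_eq_one {d : ℕ}
    {M : PeriodicNetwork 3 d} (hM : M.Balanced) (hM1 : M.numVertices = 1)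
    {N : PeriodicNetwork 3 d} (hN : N.numVertices = 1) : N.Irreducible := by
  refine ⟨⟨M, hM, hM1.trans hN.symm⟩, ?_⟩
  rintro _ ⟨K, -, rfl⟩
  rw [hN]
  exact K.numVertices_pos

theorem Irreducible.numVertices_le {n d : ℕ} {N M : PeriodicNetwork n d} (hN : N.Irreducible)
    (hM : M.Balanced) : N.numVertices ≤ M.numVertices := hN.2 ⟨M, hM, rfl⟩

theorem link_pos_of_hasQuotient {d ℓ k : ℕ} {N : PeriodicNetwork 3 d}
    (h : N.HasQuotient (doubleBouquet ℓ k)) : 0 < k := by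
  obtain ⟨p, g, hP⟩ := exists_double_presentation h
  exact hP.link_pos

end Irreducibility

end PeriodicNetwork

/-! ### The model networks -/

/-- A form of `SameRay` suited to linear arithmetic: zero vectors are included, and `0 < a + b`
rules out the trivial relation. -/
theorem SameRay.exists_coords {u v : E3} (h : SameRay ℝ u v) :
    ∃ a b : ℝ, 0 ≤ a ∧ 0 ≤ b ∧ 0 < a + b ∧ ∀ i, a * u i = b * v i := by
  rcases h with rfl | rfl | ⟨a, b, ha, hb, h⟩
  · exact ⟨1, 0, by simp⟩
  · exact ⟨0, 1, by simp⟩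
  · exact ⟨a, b, ha.le, hb.le, by positivity, fun i => congrArg (fun w : E3 => w i) h⟩

namespace PeriodicNetwork

open Presentation

/-- The vertices are placed at `0` and `x 0`, so link 0 has voltage zero and serves as spanning
tree. The hypotheses on `v` say that the voltages generate the lattice spanned by `v`. -/
theorem exists_network_double {ℓ k d : ℕ} (hd : 2 * ℓ + (k + 1) = d) (h3 : 3 ≤ d)
    {v : Fin 3 → E3} (hv : det3 (v 0) (v 1) (v 2) ≠ 0) (y : Fin 2 → Fin ℓ → E3)
    (x : Fin (k + 1) → E3)
    (hvol : ∀ i, (∃ m e, v i = y m e) ∨ ∃ j, v i = x j - x 0)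
    (hys : ∀ i j, y i j ∈ Submodule.span ℤ (Set.range v))
    (hxs : ∀ j, x j - x 0 ∈ Submodule.span ℤ (Set.range v) )
    (hx0 : ∀ j, x j ≠ 0)
    (hyy : ∀ i j j', SameRay ℝ (y i j) (y i j') → j = j')
    (hyn : ∀ i j j', ¬ SameRay ℝ (y i j) (-(y i j')))
    (hyx : ∀ i j m, ¬ SameRay ℝ (y i j) (x m) ∧ ¬ SameRay ℝ (-(y i j)) (x m))
    (hxx : ∀ m m', SameRay ℝ (x m) (x m') → m = m') :
    ∃ (N : PeriodicNetwork 3 d) (p : Fin 2 → N.Vert)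
      (g : Fin 2 × Fin ℓ ⊕ Fin (k + 1) → N.lattice),
      N.Presentation p (doubleSrc ℓ (k + 1)) (doubleTgt ℓ (k + 1)) g ∧ loopVec N p g = y ∧
        linkVec N p g = x ∧ N.volume = |det3 (v 0) (v 1) (v 2)| ∧
        N.lattice = Submodule.span ℤ (Set.range v) := by
  obtain ⟨b, rfl⟩ := exists_basis_of_det3_ne_zero hv
  have hX : (fun e => Sum.elim (fun e : Fin 2 × Fin ℓ => y e.1 e.2) (fun j => x j - x 0) e +
      ![0, x 0] (doubleTgt ℓ (k + 1) e) - ![0, x 0] (doubleSrc ℓ (k + 1) e)) =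
      Sum.elim (fun e : Fin 2 × Fin ℓ => y e.1 e.2) x := by
    funext e
    cases e <;> simp [doubleTgt, doubleSrc]
  let D : CoverData 3 d (Fin 2) (Fin 2 × Fin ℓ ⊕ Fin (k + 1)) :=
    { basis := b
      point := ![0, x 0]
      src := doubleSrc ℓ (k + 1)
      tgt := doubleTgt ℓ (k + 1)
      volt := Sum.elim (fun e => y e.1 e.2) fun j => x j - x 0
      base := 0
      two_le := by norm_num
      three_le := h3
      span_volt := by
        refine le_antisymm (Submodule.span_le.2 ?_) (Submodule.span_le.2 ?_)
        · rintro _ ⟨⟨i, j⟩ | j, rfl⟩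
          · exact hys i j
          · exact hxs j
        · rintro _ ⟨i, rfl⟩
          rcases hvol i with ⟨m, e, he⟩ | ⟨j, hj⟩
          · rw [he]
            exact Submodule.subset_span ⟨Sum.inl (m, e), rfl⟩
          · rw [hj]
            exact Submodule.subset_span ⟨Sum.inr j, rfl⟩
      degree := by
        intro i
        fin_cases i <;> simp [doubleSrc, doubleTgt, Fintype.sum_prod_type] <;> omega
      edge_ne_zero := by
        intro e
        rw [show _ + _ - _ = _ from congrFun hX e]
        rcases e with ⟨i, j⟩ | j
        · exact fun h => hyn i j j (by
            change y i j = 0 at h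
            rw [h]
            exact SameRay.zero_left _)
        · exact hx0 j
      ray := by
        rw [hX]
        rintro ((⟨i, j⟩ | m) | (⟨i, j⟩ | m)) ((⟨i', j'⟩ | m') | (⟨i', j'⟩ | m')) h hr <;>
          simp only [Sum.elim_inl, Sum.elim_inr, Pi.neg_apply, doubleSrc, doubleTgt] at h hr
        · subst h
          rw [hyy _ _ _ hr]
        · exact ((hyx _ _ _).1 hr).elim
        · subst h
          exact (hyn _ _ _ hr).elim
        · exact ((hyx _ _ _).2 (sameRay_neg_swap.2 hr)).elim
        · exact ((hyx _ _ _).1 hr.symm).elim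
        · rw [hxx _ _ hr]
        · exact ((hyx _ _ _).2 hr.symm).elim
        · exact absurd h (by simp)
        · subst h
          exact (hyn _ _ _ hr.symm).elim
        · exact ((hyx _ _ _).2 hr).elim
        · subst h
          rw [hyy _ _ _ (sameRay_neg_iff.1 hr)]
        · exact ((hyx _ _ _).1 (sameRay_neg_iff.1 hr)).elim
        · exact ((hyx _ _ _).2 (sameRay_neg_swap.1 hr).symm).elim
        · exact absurd h (by simp)
        · exact ((hyx _ _ _).1 (sameRay_neg_iff.1 hr).symm).elim
        · rw [hxx _ _ (sameRay_neg_iff.1 hr)]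
      tree := by
        intro i
        fin_cases i
        · exact Or.inl rfl
        · exact Or.inr ⟨Sum.inr 0, rfl, rfl, sub_self _⟩ }
  refine ⟨D.network, _, _, D.presentation, ?_, ?_, covolume_span_basis b, rfl⟩
  · funext i j
    exact (D.edgeVec_presentation _).trans (congrFun hX (Sum.inl (i, j)))
  · funext j
    exact (D.edgeVec_presentation _).trans (congrFun hX (Sum.inr j))

theorem exists_network_bouquet {ℓ d : ℕ} (hd : 2 * ℓ = d) (h3 : 3 ≤ d)
    {v : Fin 3 → E3} (hv : det3 (v 0) (v 1) (v 2) ≠ 0) (y : Fin ℓ → E3)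
    (hvol : ∀ i, ∃ e, v i = y e) (hys : ∀ j, y j ∈ Submodule.span ℤ (Set.range v))
    (hyy : ∀ j j', SameRay ℝ (y j) (y j') → j = j')
    (hyn : ∀ j j', ¬ SameRay ℝ (y j) (-(y j'))) :
    ∃ (N : PeriodicNetwork 3 d) (p : Unit → N.Vert) (g : Fin ℓ → N.lattice),
      N.Presentation p (fun _ => ()) (fun _ => ()) g ∧ (∀ i, (g i : E3) = y i) ∧
        N.volume = |det3 (v 0) (v 1) (v 2)| := by
  obtain ⟨b, rfl⟩ := exists_basis_of_det3_ne_zero hv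
  let D : CoverData 3 d Unit (Fin ℓ) :=
    { basis := b
      point := fun _ => 0
      src := fun _ => ()
      tgt := fun _ => ()
      volt := y
      base := ()
      two_le := by norm_num
      three_le := h3
      span_volt := by
        refine le_antisymm (Submodule.span_le.2 ?_) (Submodule.span_le.2 ?_)
        · rintro _ ⟨j, rfl⟩
          exact hys j
        · rintro _ ⟨i, rfl⟩
          obtain ⟨e, he⟩ := hvol i
          rw [he]
          exact Submodule.subset_span ⟨e, rfl⟩
      degree := by
        intro i
        simp
        omega
      edge_ne_zero := by
        intro e h
        simp only [add_zero, sub_zero] at h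
        exact hyn e e (by rw [h]; exact SameRay.zero_left _)
      ray := by
        simp only [add_zero, sub_zero]
        rintro (j | j) (j' | j') h hr <;> simp only [Sum.elim_inl, Sum.elim_inr, Pi.neg_apply] at hr
        · rw [hyy _ _ hr]
        · exact (hyn _ _ hr).elim
        · exact (hyn _ _ hr.symm).elim
        · rw [hyy _ _ (sameRay_neg_iff.1 hr)]
      tree := fun _ => Or.inl rfl }
  exact ⟨D.network, _, _, D.presentation, fun i => rfl, covolume_span_basis b⟩

theorem sqrt_three_sq : √3 * √3 = 3 := Real.mul_self_sqrt (by norm_num)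

theorem norm_diaVec (i : Fin 4) : ‖diaVec i‖ = √3 := by
  rw [EuclideanSpace.norm_eq]
  congr 1
  fin_cases i <;> simp [diaVec, Fin.sum_univ_three] <;> norm_num

theorem exists_dia : ∃ (N : PeriodicNetwork 3 4) (p : Fin 2 → N.Vert)
    (g : Fin 2 × Fin 0 ⊕ Fin 4 → N.lattice), N.Presentation p (doubleSrc 0 4) (doubleTgt 0 4) g ∧
      N.Balanced ∧ linkVec N p g = diaVec ∧ 12 * √3 * N.volume = N.length ^ 3 := by
  have hdet : det3 (diaVec 1 - diaVec 0) (diaVec 2 - diaVec 0) (diaVec 3 - diaVec 0) = -16 := by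
    simp [det3, diaVec]
    norm_num
  obtain ⟨N, p, g, hP, -, hx, hV, -⟩ := exists_network_double (ℓ := 0) (k := 3) (d := 4)
    rfl (by norm_num)
    (v := ![diaVec 1 - diaVec 0, diaVec 2 - diaVec 0, diaVec 3 - diaVec 0]) (by
      simp [hdet]) (fun _ => Fin.elim0) diaVec (by
      intro i
      right
      fin_cases i
      · exact ⟨1, rfl⟩
      · exact ⟨2, rfl⟩
      · exact ⟨3, rfl⟩) (fun _ j => j.elim0) (by
      intro j
      fin_cases j
      · simp
      · exact Submodule.subset_span ⟨0, rfl⟩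
      · exact Submodule.subset_span ⟨1, rfl⟩
      · exact Submodule.subset_span ⟨2, rfl⟩) (by
      intro j h
      have := norm_diaVec j
      rw [h, norm_zero] at this
      have h3 : (0 : ℝ) < √3 := by positivity
      linarith) (fun _ j => j.elim0) (fun _ j => j.elim0) (fun _ j => j.elim0) (by
      intro m m' h
      obtain ⟨a, b, ha, hb, hab, h⟩ := h.exists_coords
      have h0 := h 0
      have h1 := h 1
      have h2 := h 2
      clear h
      fin_cases m <;> fin_cases m' <;>
        first | rfl | (exfalso; simp [diaVec] at h0 h1 h2; linarith))
  have hsum : diaVec 0 + diaVec 1 + diaVec 2 + diaVec 3 = 0 := by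
    ext i
    fin_cases i <;> simp [diaVec]
  refine ⟨N, p, g, hP, hP.balanced_double ?_, hx, ?_⟩
  · rw [hx]
    simp only [norm_diaVec]
    rw [← Finset.smul_sum, Fin.sum_univ_four, hsum, smul_zero]
  · have hV' : N.volume = 16 := by
      rw [hV]
      change |det3 (diaVec 1 - diaVec 0) (diaVec 2 - diaVec 0) (diaVec 3 - diaVec 0)| = 16
      rw [hdet]
      norm_num
    rw [hP.double_length, hV', totalLength, hx]
    simp only [norm_diaVec]
    simp
    ring_nf
    rw [show √3 ^ 3 = √3 * √3 * √3 by ring, sqrt_three_sq]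
    ring

theorem norm_sqpVec (i : Fin 5) : ‖sqpVec i‖ = ![4, 4, 4, 4, 13 / 2] i := by
  rw [EuclideanSpace.norm_eq, Real.sqrt_eq_iff_mul_self_eq_of_pos (by fin_cases i <;> simp)]
  fin_cases i <;> simp [sqpVec, Fin.sum_univ_three] <;> norm_num

theorem exists_sqp : ∃ (N : PeriodicNetwork 3 5) (p : Fin 2 → N.Vert)
    (g : Fin 2 × Fin 0 ⊕ Fin 5 → N.lattice), N.Presentation p (doubleSrc 0 5) (doubleTgt 0 5) g ∧
      linkVec N p g = sqpVec ∧ 405 / 8 * N.volume = N.length ^ 3 := by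
  have hs : √15 * √15 = 15 := Real.mul_self_sqrt (by norm_num)
  have hpos : 0 < √15 := by positivity
  have hdet : |det3 (sqpVec 1 - sqpVec 0) (sqpVec 2 - sqpVec 0) (sqpVec 4 - sqpVec 0)| = 225 := by
    have : det3 (sqpVec 1 - sqpVec 0) (sqpVec 2 - sqpVec 0) (sqpVec 4 - sqpVec 0) = -225 := by
      simp [det3, sqpVec]
      linear_combination (-15) * hs
    rw [this]
    norm_num
  obtain ⟨N, p, g, hP, -, hx, hV, -⟩ := exists_network_double (ℓ := 0) (k := 4) (d := 5)
    rfl (by norm_num)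
    (v := ![sqpVec 1 - sqpVec 0, sqpVec 2 - sqpVec 0, sqpVec 4 - sqpVec 0]) (by
      intro h
      change det3 (sqpVec 1 - sqpVec 0) (sqpVec 2 - sqpVec 0) (sqpVec 4 - sqpVec 0) = 0 at h
      rw [h] at hdet
      norm_num at hdet) (fun _ => Fin.elim0) sqpVec (by
      intro i
      right
      fin_cases i
      · exact ⟨1, rfl⟩
      · exact ⟨2, rfl⟩
      · exact ⟨4, rfl⟩) (fun _ j => j.elim0) (by
      intro j
      fin_cases j
      · simp
      · exact Submodule.subset_span ⟨0, rfl⟩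
      · exact Submodule.subset_span ⟨1, rfl⟩
      -- The base of the pyramid is a square, so the fourth corner adds nothing to the lattice of
      -- the other differences.
      · have h : sqpVec 3 - sqpVec 0 = (sqpVec 1 - sqpVec 0) - (sqpVec 2 - sqpVec 0) := by
          ext i
          fin_cases i <;> simp [sqpVec]
        change sqpVec 3 - sqpVec 0 ∈ _
        rw [h]
        exact Submodule.sub_mem _ (Submodule.subset_span ⟨0, rfl⟩)
          (Submodule.subset_span ⟨1, rfl⟩)
      · exact Submodule.subset_span ⟨2, rfl⟩) (by
      intro j h
      have := norm_sqpVec j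
      rw [h, norm_zero] at this
      fin_cases j <;> norm_num at this) (fun _ j => j.elim0) (fun _ j => j.elim0)
      (fun _ j => j.elim0) (by
      intro m m' h
      obtain ⟨a, b, ha, hb, hab, h⟩ := h.exists_coords
      have h0 := h 0
      have h1 := h 1
      have h2 := h 2
      have h3 := mul_pos hab hpos
      clear h
      fin_cases m <;> fin_cases m' <;>
        first | rfl | (exfalso; simp [sqpVec] at h0 h1 h2; linarith))
  refine ⟨N, p, g, hP, hx, ?_⟩
  have hV' : N.volume = 225 := hV.trans hdet
  rw [hP.double_length, hV', totalLength, hx]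
  simp only [norm_sqpVec]
  simp [Fin.sum_univ_five]
  norm_num

theorem exists_cds (t : Set.Ioo (0 : ℝ) 1) : ∃ (N : PeriodicNetwork 3 4) (p : Fin 2 → N.Vert)
    (g : Fin 2 × Fin 1 ⊕ Fin 2 → N.lattice), N.Presentation p (doubleSrc 1 2) (doubleTgt 1 2) g ∧
      loopVec N p g = ![![!₂[1, 0, 0]], ![!₂[0, 1, 0]]] ∧
      linkVec N p g = ![!₂[0, 0, (t : ℝ)], !₂[0, 0, (t : ℝ) - 1]] ∧
      N.lattice = Submodule.span ℤ (Set.range ![!₂[1, 0, 0], !₂[0, 1, 0], !₂[0, 0, -1]]) ∧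
      27 * N.volume = N.length ^ 3 := by
  obtain ⟨t, ht0, ht1⟩ := t
  have hx1 : ∀ j : Fin 2, ∃ c : ℝ, c ≠ 0 ∧
      (![!₂[0, 0, t], !₂[0, 0, t - 1]] : Fin 2 → E3) j = !₂[0, 0, c] := by
    intro j
    fin_cases j
    · exact ⟨t, ht0.ne', rfl⟩
    · exact ⟨t - 1, by linarith, rfl⟩
  -- The second link minus the first is the negative third unit vector, hence this sign in the
  -- lattice basis.
  have hsub : (!₂[0, 0, -1] : E3) = !₂[0, 0, t - 1] - !₂[0, 0, t] := by
    ext i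
    fin_cases i <;> simp
  obtain ⟨N, p, g, hP, hy, hx, hV, hΛ⟩ := exists_network_double (ℓ := 1) (k := 1) (d := 4)
    rfl (by norm_num) (v := ![!₂[1, 0, 0], !₂[0, 1, 0], !₂[0, 0, -1]])
    (by simp [det3]) ![![!₂[1, 0, 0]], ![!₂[0, 1, 0]]]
    ![!₂[0, 0, t], !₂[0, 0, t - 1]] (by
      intro i
      fin_cases i
      · exact Or.inl ⟨0, 0, rfl⟩
      · exact Or.inl ⟨1, 0, rfl⟩
      · exact Or.inr ⟨1, hsub⟩) (by
      intro i j
      rw [Subsingleton.elim j 0]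
      fin_cases i
      · exact Submodule.subset_span ⟨0, rfl⟩
      · exact Submodule.subset_span ⟨1, rfl⟩) (by
      intro j
      fin_cases j
      · simp
      · exact Submodule.subset_span ⟨2, hsub⟩) (by
      intro j h
      obtain ⟨c, hc, hj⟩ := hx1 j
      rw [hj] at h
      exact hc (by simpa using congrArg (fun w : E3 => w 2) h))
    (fun _ _ _ _ => Subsingleton.elim _ _) (by
      intro i j j' h
      obtain ⟨a, b, ha, hb, hab, h⟩ := h.exists_coords
      have h0 := h 0
      have h1 := h 1
      rw [Subsingleton.elim j 0, Subsingleton.elim j' 0] at h0 h1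
      fin_cases i <;> simp at h0 h1 <;> linarith) (by
      intro i j m
      obtain ⟨c, hc, hm⟩ := hx1 m
      rw [hm, Subsingleton.elim j 0]
      refine ⟨fun h => ?_, fun h => ?_⟩ <;>
      · obtain ⟨a, b, ha, hb, hab, h⟩ := h.exists_coords
        have h0 := h 0
        have h1 := h 1
        have h2 := h 2
        fin_cases i <;> simp [hc] at h0 h1 h2 <;> linarith) (by
      intro m m' h
      obtain ⟨a, b, ha, hb, hab, h⟩ := h.exists_coords
      have h2 := h 2
      clear h
      have ht1' : 0 < 1 - t := by linarith
      fin_cases m <;> fin_cases m' <;> first | rfl | (exfalso; simp at h2)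
      · rcases ha.eq_or_lt with rfl | ha
        · nlinarith [mul_pos hab ht1']
        · nlinarith [mul_pos ha ht0, mul_nonneg hb ht1'.le]
      · rcases hb.eq_or_lt with rfl | hb
        · nlinarith [mul_pos hab ht1']
        · nlinarith [mul_pos hb ht0, mul_nonneg ha ht1'.le])
  refine ⟨N, p, g, hP, hy, hx, hΛ, ?_⟩
  have hV' : N.volume = 1 := by
    rw [hV]
    simp [det3]
  rw [hP.double_length, hV', totalLength, hx, hy]
  simp [EuclideanSpace.norm_eq, Fin.sum_univ_three, Real.sqrt_sq_eq_abs, abs_of_pos ht0,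
    abs_of_neg (show t - 1 < 0 by linarith)]
  norm_num

theorem norm_bnn_link (i : Fin 3) :
    ‖(![!₂[1, 0, 0], !₂[-(1 / 2), √3 / 2, 0], !₂[-(1 / 2), -(√3 / 2), 0]] : Fin 3 → E3) i‖ = 1 := by
  rw [EuclideanSpace.norm_eq, Real.sqrt_eq_one]
  fin_cases i <;> simp [Fin.sum_univ_three, div_pow] <;> norm_num

/-- Balanced networks with quotient graph `D_{ℓ,3}`; for `ℓ = 1` this is the network `bnn`. -/
theorem exists_balanced_double_three {ℓ : ℕ} (hℓ : 0 < ℓ) :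
    ∃ (N : PeriodicNetwork 3 (2 * ℓ + 3)) (p : Fin 2 → N.Vert)
      (g : Fin 2 × Fin ℓ ⊕ Fin 3 → N.lattice),
      N.Presentation p (doubleSrc ℓ 3) (doubleTgt ℓ 3) g ∧ N.Balanced ∧
      loopVec N p g = (fun (_ : Fin 2) (j : Fin ℓ) =>
        (!₂[-(3 / 2) * ((j : ℕ) : ℝ), √3 / 2 * ((j : ℕ) : ℝ), 3 / 4] : E3)) ∧
      linkVec N p g = ![!₂[1, 0, 0], !₂[-(1 / 2), √3 / 2, 0], !₂[-(1 / 2), -(√3 / 2), 0]] ∧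
      N.volume = 9 * √3 / 8 := by
  have hpos : 0 < √3 := by positivity
  have hx1 : ∀ j : Fin 3, ∃ c e : ℝ, c ≠ 0 ∧ (![!₂[1, 0, 0], !₂[-(1 / 2), √3 / 2, 0],
      !₂[-(1 / 2), -(√3 / 2), 0]] : Fin 3 → E3) j = !₂[c, e, 0] := by
    intro j
    fin_cases j
    · exact ⟨1, 0, by norm_num, rfl⟩
    · exact ⟨-(1 / 2), √3 / 2, by norm_num, rfl⟩
    · exact ⟨-(1 / 2), -(√3 / 2), by norm_num, rfl⟩
  have hf1 : (!₂[-(3 / 2), √3 / 2, 0] : E3) = !₂[-(1 / 2), √3 / 2, 0] - !₂[1, 0, 0] := by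
    ext i
    fin_cases i <;> simp
    norm_num
  have hf2 : (!₂[-(3 / 2), -(√3 / 2), 0] : E3) = !₂[-(1 / 2), -(√3 / 2), 0] - !₂[1, 0, 0] := by
    ext i
    fin_cases i <;> simp
    norm_num
  have hdet : det3 (!₂[0, 0, 3 / 4] : E3) !₂[-(3 / 2), √3 / 2, 0] !₂[-(3 / 2), -(√3 / 2), 0] =
      9 * √3 / 8 := by
    simp [det3]
    ring
  -- The loops are a vertical vector plus the multiples of one horizontal lattice vector. Their
  -- common nonzero height keeps them from being parallel to each other or to the horizontal links,
  -- and balance concerns the links only.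
  obtain ⟨N, p, g, hP, hy, hx, hV, -⟩ := exists_network_double (ℓ := ℓ) (k := 2)
    (d := 2 * ℓ + 3) rfl (by omega)
    (v := ![!₂[0, 0, 3 / 4], !₂[-(3 / 2), √3 / 2, 0], !₂[-(3 / 2), -(√3 / 2), 0]])
    (by
      change det3 (!₂[0, 0, 3 / 4] : E3) !₂[-(3 / 2), √3 / 2, 0] !₂[-(3 / 2), -(√3 / 2), 0] ≠ 0
      rw [hdet]
      positivity) (fun (_ : Fin 2) (j : Fin ℓ) =>
        (!₂[-(3 / 2) * ((j : ℕ) : ℝ), √3 / 2 * ((j : ℕ) : ℝ), 3 / 4] : E3))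
    ![!₂[1, 0, 0], !₂[-(1 / 2), √3 / 2, 0], !₂[-(1 / 2), -(√3 / 2), 0]] (by
      intro i
      fin_cases i
      · refine Or.inl ⟨0, ⟨0, hℓ⟩, ?_⟩
        simp
      · exact Or.inr ⟨1, hf1⟩
      · exact Or.inr ⟨2, hf2⟩) (by
      intro _ j
      have h : (!₂[-(3 / 2) * ((j : ℕ) : ℝ), √3 / 2 * ((j : ℕ) : ℝ), 3 / 4] : E3) =
          !₂[0, 0, 3 / 4] + (j : ℕ) • !₂[-(3 / 2), √3 / 2, 0] := by
        ext i
        fin_cases i <;> simp [mul_comm]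
      rw [h]
      exact Submodule.add_mem _ (Submodule.subset_span ⟨0, rfl⟩)
        (Submodule.smul_of_tower_mem _ _ (Submodule.subset_span ⟨1, rfl⟩))) (by
      intro j
      fin_cases j
      · simp
      · exact Submodule.subset_span ⟨1, hf1⟩
      · exact Submodule.subset_span ⟨2, hf2⟩) (by
      intro j h
      obtain ⟨c, e, hc, hj⟩ := hx1 j
      rw [hj] at h
      exact hc (by simpa using congrArg (fun w : E3 => w 0) h)) (by
      intro _ j j' h
      obtain ⟨a, b, ha, hb, hab, h⟩ := h.exists_coords
      have h0 := h 0
      have h2 := h 2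
      simp at h0 h2
      subst h2
      have ha' : a ≠ 0 := by linarith
      simpa [ha', Fin.ext_iff] using h0) (by
      intro _ j j' h
      obtain ⟨a, b, ha, hb, hab, h⟩ := h.exists_coords
      have h2 := h 2
      simp at h2
      linarith) (by
      intro _ j m
      obtain ⟨c, e, hc, hm⟩ := hx1 m
      rw [hm]
      refine ⟨fun h => ?_, fun h => ?_⟩ <;>
      · obtain ⟨a, b, ha, hb, hab, h⟩ := h.exists_coords
        have h0 := h 0
        have h2 := h 2
        simp at h2
        subst h2
        simp [hc] at h0
        linarith) (by
      intro m m' h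
      obtain ⟨a, b, ha, hb, hab, h⟩ := h.exists_coords
      have h0 := h 0
      have h1 := h 1
      have h3 := mul_pos hab hpos
      clear h
      fin_cases m <;> fin_cases m' <;>
        first | rfl | (exfalso; simp at h0 h1; linarith))
  refine ⟨N, p, g, hP, hP.balanced_double ?_, hy, hx, ?_⟩
  · rw [hx]
    simp only [norm_bnn_link]
    ext i
    fin_cases i <;> simp [Fin.sum_univ_three]
    norm_num
  · rw [hV]
    change |det3 (!₂[0, 0, 3 / 4] : E3) !₂[-(3 / 2), √3 / 2, 0] !₂[-(3 / 2), -(√3 / 2), 0]| = _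
    rw [hdet, abs_of_pos (by positivity)]

theorem exists_bnn : ∃ (N : PeriodicNetwork 3 5) (p : Fin 2 → N.Vert)
    (g : Fin 2 × Fin 1 ⊕ Fin 3 → N.lattice), N.Presentation p (doubleSrc 1 3) (doubleTgt 1 3) g ∧
      N.Balanced ∧ loopVec N p g = (fun _ => ![!₂[0, 0, 3 / 4]]) ∧
      linkVec N p g = ![!₂[1, 0, 0], !₂[-(1 / 2), √3 / 2, 0], !₂[-(1 / 2), -(√3 / 2), 0]] ∧
      27 * √3 * N.volume = N.length ^ 3 := by
  obtain ⟨N, p, g, hP, hb, hy, hx, hV⟩ := exists_balanced_double_three one_pos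
  refine ⟨N, p, g, hP, hb, ?_, hx, ?_⟩
  · rw [hy]
    funext _ j
    rw [Subsingleton.elim j 0]
    simp
  · have h34 : ‖(!₂[0, 0, 3 / 4] : E3)‖ = 3 / 4 := by
      rw [EuclideanSpace.norm_eq, Real.sqrt_eq_iff_mul_self_eq_of_pos (by norm_num)]
      simp [Fin.sum_univ_three]
      norm_num
    rw [hP.double_length, hV, totalLength, hx, hy]
    simp only [norm_bnn_link]
    simp
    rw [h34]
    linear_combination (243 / 8) * sqrt_three_sq

/-- Networks with quotient graph a bouquet; for `ℓ = 3` this is the network `pcu`. -/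
theorem exists_bouquet {ℓ : ℕ} (hℓ : 3 ≤ ℓ) : ∃ (N : PeriodicNetwork 3 (2 * ℓ)) (p : Unit → N.Vert)
    (g : Fin ℓ → N.lattice), N.Presentation p (fun _ => ()) (fun _ => ()) g ∧
      (∀ i, (g i : E3) = if (i : ℕ) = 0 then !₂[1, 0, 0] else if (i : ℕ) = 1 then !₂[0, 1, 0]
        else !₂[((i : ℕ) : ℝ) - 2, 0, 1]) ∧ N.volume = 1 := by
  -- From index 2 on the loops are distinct vectors with third coordinate 1, hence pairwise not
  -- parallel.
  obtain ⟨N, p, g, hP, hy, hV⟩ := exists_network_bouquet (ℓ := ℓ) rfl (by omega)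
    (v := ![!₂[1, 0, 0], !₂[0, 1, 0], !₂[0, 0, 1]]) (by simp [det3])
    (fun i => if (i : ℕ) = 0 then (!₂[1, 0, 0] : E3) else if (i : ℕ) = 1 then !₂[0, 1, 0]
        else !₂[((i : ℕ) : ℝ) - 2, 0, 1]) (by
      intro i
      fin_cases i
      · exact ⟨⟨0, by omega⟩, by simp⟩
      · exact ⟨⟨1, by omega⟩, by simp⟩
      · exact ⟨⟨2, by omega⟩, by simp⟩) (by
      intro j
      split_ifs
      · exact Submodule.subset_span ⟨0, rfl⟩
      · exact Submodule.subset_span ⟨1, rfl⟩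
      · have h : (!₂[((j : ℕ) : ℝ) - 2, 0, 1] : E3) =
            !₂[0, 0, 1] + ((j : ℤ) - 2) • !₂[1, 0, 0] := by
          ext i
          fin_cases i <;> simp
        rw [h]
        exact Submodule.add_mem _ (Submodule.subset_span ⟨2, rfl⟩)
          (Submodule.smul_mem _ _ (Submodule.subset_span ⟨0, rfl⟩))) (by
      intro j j' h
      obtain ⟨a, b, ha, hb, hab, h⟩ := h.exists_coords
      have h0 := h 0
      have h1 := h 1
      have h2 := h 2
      clear h
      ext
      split_ifs at h0 h1 h2 <;> simp at h0 h1 h2 <;> first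
        | omega
        | (exfalso; linarith)
        | (exfalso; rw [h2] at h0; linarith)
        | (exfalso; rw [← h2] at h0; linarith)
        | (have hb' : b ≠ 0 := by linarith
           rw [h2] at h0
           have h3 := mul_left_cancel₀ hb' h0
           exact_mod_cast (by linarith : ((j : ℕ) : ℝ) = (j' : ℕ)))) (by
      intro j j' h
      obtain ⟨a, b, ha, hb, hab, h⟩ := h.exists_coords
      have h0 := h 0
      have h1 := h 1
      have h2 := h 2
      clear h
      split_ifs at h0 h1 h2 <;> simp at h0 h1 h2 <;> first
        | linarith
        | (rw [h2] at h0; linarith))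
  refine ⟨N, p, g, hP, hy, ?_⟩
  rw [hV]
  simp [det3]

theorem exists_pcu : ∃ (N : PeriodicNetwork 3 6) (p : Unit → N.Vert)
    (g : Fin 3 → N.lattice), N.Presentation p (fun _ => ()) (fun _ => ()) g ∧
      (fun i => (g i : E3)) = ![!₂[1, 0, 0], !₂[0, 1, 0], !₂[0, 0, 1]] ∧
      27 * N.volume = N.length ^ 3 := by
  obtain ⟨N, p, g, hP, hy, hV⟩ := exists_bouquet le_rfl
  have hg : (fun i => (g i : E3)) = ![!₂[1, 0, 0], !₂[0, 1, 0], !₂[0, 0, 1]] := by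
    funext i
    rw [hy]
    fin_cases i <;> simp
  refine ⟨N, p, g, hP, hg, ?_⟩
  rw [hP.single_length, hV]
  have h : ∀ i, (g i : E3) = (![!₂[1, 0, 0], !₂[0, 1, 0], !₂[0, 0, 1]] : Fin 3 → E3) i :=
    fun i => congrFun hg i
  simp only [h]
  simp [Fin.sum_univ_three, EuclideanSpace.norm_eq]
  norm_num

end PeriodicNetwork

namespace PeriodicNetwork

open Presentation

/-! ### Similarities between the networks `cds` -/

theorem Presentation.exists_edge_length {n d : ℕ} {N : PeriodicNetwork n d} {ι β : Type}
    {p : ι → N.Vert} {s t : β → ι} {g : β → N.lattice} (hP : N.Presentation p s t g)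
    {v w : N.Vert} (h : N.graph.Adj v w) :
    ∃ e, ‖N.pos v - N.pos w‖ = ‖N.edgeVec p s t g e‖ := by
  obtain ⟨a, i, rfl⟩ := hP.exists_vadd_eq v
  obtain ⟨δ, hδ⟩ := (hP.neighbor_bijective a i).2 ⟨w, h⟩
  have h1 := hP.pos_neighbor a i δ
  rw [hδ] at h1
  change N.pos (a +ᵥ p i) - N.pos w = _ at h1
  rw [h1, norm_neg]
  obtain ⟨δ | δ, rfl⟩ := δ
  · exact ⟨δ, rfl⟩
  · exact ⟨δ, norm_neg _⟩

theorem one_le_norm_of_mem_cubic {v : E3} (hv : v ∈ Submodule.span ℤ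
    (Set.range (![!₂[1, 0, 0], !₂[0, 1, 0], !₂[0, 0, -1]] : Fin 3 → E3))) (h0 : v ≠ 0) :
    1 ≤ ‖v‖ := by
  obtain ⟨c, rfl⟩ := (Submodule.mem_span_range_iff_exists_fun ℤ).1 hv
  have h1 : ‖∑ i, c i • (![!₂[1, 0, 0], !₂[0, 1, 0], !₂[0, 0, -1]] : Fin 3 → E3) i‖ ^ 2 =
      ((c 0 ^ 2 + c 1 ^ 2 + c 2 ^ 2 : ℤ) : ℝ) := by
    rw [EuclideanSpace.norm_sq_eq]
    simp [Fin.sum_univ_three]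
  have h2 : 0 < ‖∑ i, c i • (![!₂[1, 0, 0], !₂[0, 1, 0], !₂[0, 0, -1]] : Fin 3 → E3) i‖ ^ 2 :=
    pow_pos (norm_pos_iff.2 h0) 2
  rw [h1] at h2
  have h3 : (1 : ℤ) ≤ c 0 ^ 2 + c 1 ^ 2 + c 2 ^ 2 := by exact_mod_cast h2
  refine (one_le_sq_iff₀ (norm_nonneg _)).1 ?_
  rw [h1]
  exact_mod_cast h3

section Cds

variable {s t : ℝ} {N M : PeriodicNetwork 3 4} {p : Fin 2 → N.Vert}
  {g : Fin 2 × Fin 1 ⊕ Fin 2 → N.lattice} {p' : Fin 2 → M.Vert}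
  {g' : Fin 2 × Fin 1 ⊕ Fin 2 → M.lattice}

/-- The first unit vector is mapped to a nonzero vector of the cubic lattice of norm `r`. Applied to
a similarity and to its inverse, this gives `r = 1`. -/
theorem le_scale_of_cubic
    (hΛ : M.lattice = Submodule.span ℤ (Set.range ![!₂[1, 0, 0], !₂[0, 1, 0], !₂[0, 0, -1]]))
    (hy : loopVec N p g = ![![!₂[1, 0, 0]], ![!₂[0, 1, 0]]]) {r : ℝ} (hr : 0 < r)
    {A : E3 ≃ₗᵢ[ℝ] E3} {ψ : N.lattice ≃+ M.lattice} (hψ : ∀ a, (ψ a : E3) = r • A a) :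
    1 ≤ r := by
  have h1 : (g (Sum.inl (0, 0)) : E3) = !₂[1, 0, 0] := by
    rw [← edgeVec_loop (p := p)]
    change loopVec N p g 0 0 = _
    rw [hy]
    rfl
  have h2 : ‖(g (Sum.inl (0, 0)) : E3)‖ = 1 := by
    rw [h1]
    simp [EuclideanSpace.norm_eq, Fin.sum_univ_three]
  have h3 := hψ (g (Sum.inl (0, 0)))
  have h4 : ‖(ψ (g (Sum.inl (0, 0))) : E3)‖ = r := by
    rw [h3, norm_smul, A.norm_map, h2, Real.norm_eq_abs, abs_of_pos hr, mul_one]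
  rw [← h4]
  refine one_le_norm_of_mem_cubic (hΛ ▸ (ψ (g (Sum.inl (0, 0)))).2) ?_
  rw [← norm_ne_zero_iff, h4]
  exact hr.ne'

/-- The scale is 1, so edge lengths are preserved. An edge of length `s < 1` must go to an edge of
length `t` or `1 - t`, the others having length 1. -/
theorem eq_or_eq_of_similar_cds (hs : s ∈ Set.Ioo (0 : ℝ) 1) (ht : t ∈ Set.Ioo (0 : ℝ) 1)
    (hN : N.Presentation p (doubleSrc 1 2) (doubleTgt 1 2) g)
    (hM : M.Presentation p' (doubleSrc 1 2) (doubleTgt 1 2) g')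
    (hNy : loopVec N p g = ![![!₂[1, 0, 0]], ![!₂[0, 1, 0]]])
    (hMy : loopVec M p' g' = ![![!₂[1, 0, 0]], ![!₂[0, 1, 0]]])
    (hNx : linkVec N p g = ![!₂[0, 0, s], !₂[0, 0, s - 1]])
    (hMx : linkVec M p' g' = ![!₂[0, 0, t], !₂[0, 0, t - 1]])
    (hNΛ : N.lattice = Submodule.span ℤ (Set.range ![!₂[1, 0, 0], !₂[0, 1, 0], !₂[0, 0, -1]]))
    (hMΛ : M.lattice = Submodule.span ℤ (Set.range ![!₂[1, 0, 0], !₂[0, 1, 0], !₂[0, 0, -1]]))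
    (h : N.Similar M) : s = t ∨ s = 1 - t := by
  obtain ⟨r, A, b, φ, ψ, hr, hpos, hψ, -⟩ := h
  have h1 : 1 ≤ r := le_scale_of_cubic hMΛ hNy hr hψ
  have h2 : 1 ≤ r⁻¹ := le_scale_of_cubic (A := A.symm) (ψ := ψ.symm) hNΛ hMy (inv_pos.2 hr)
    fun a => by
      have h := hψ (ψ.symm a)
      rw [ψ.apply_symm_apply] at h
      rw [h, map_smul, A.symm_apply_apply, inv_smul_smul₀ hr.ne']
  obtain rfl : r = 1 := le_antisymm ((one_le_inv₀ hr).1 h2) h1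
  have hadj := hN.adj (Sum.inr 0)
  have hlen : ‖N.pos (p (doubleSrc 1 2 (Sum.inr 0))) -
      N.pos (g (Sum.inr 0) +ᵥ p (doubleTgt 1 2 (Sum.inr 0)))‖ = s := by
    rw [norm_sub_rev, N.pos_vadd]
    change ‖linkVec N p g 0‖ = s
    rw [hNx]
    simp [EuclideanSpace.norm_eq, Fin.sum_univ_three, Real.sqrt_sq_eq_abs, abs_of_pos hs.1]
  obtain ⟨e, he⟩ := hM.exists_edge_length (φ.map_adj_iff.2 hadj)
  rw [hpos, hpos, one_smul, one_smul, add_sub_add_right_eq_sub, ← map_sub, A.norm_map,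
    hlen] at he
  rcases e with ⟨i, j⟩ | j
  · exfalso
    have h3 : ‖loopVec M p' g' i j‖ = 1 := by
      rw [hMy, Subsingleton.elim j 0]
      fin_cases i <;> simp [EuclideanSpace.norm_eq, Fin.sum_univ_three]
    exact hs.2.ne (he.trans h3)
  · have h3 : s = ‖linkVec M p' g' j‖ := he
    rw [hMx] at h3
    fin_cases j
    · left
      simpa [EuclideanSpace.norm_eq, Fin.sum_univ_three, Real.sqrt_sq_eq_abs, abs_of_pos ht.1]
        using h3
    · right
      have h4 : t - 1 < 0 := by linarith [ht.2]
      simpa [EuclideanSpace.norm_eq, Fin.sum_univ_three, Real.sqrt_sq_eq_abs, abs_of_neg h4]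
        using h3

/-- After exchange of the two links, the link vectors of one network are the negatives of those of
the other, so the Gram matrices agree. -/
theorem similar_cds_symm
    (hN : N.Presentation p (doubleSrc 1 2) (doubleTgt 1 2) g)
    (hM : M.Presentation p' (doubleSrc 1 2) (doubleTgt 1 2) g')
    (hNy : loopVec N p g = ![![!₂[1, 0, 0]], ![!₂[0, 1, 0]]])
    (hMy : loopVec M p' g' = ![![!₂[1, 0, 0]], ![!₂[0, 1, 0]]])
    (hNx : linkVec N p g = ![!₂[0, 0, s], !₂[0, 0, s - 1]])
    (hMx : linkVec M p' g' = ![!₂[0, 0, t], !₂[0, 0, t - 1]])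
    (h : s = 1 - t) : N.Similar M := by
  refine hN.similar_of_gram_perm hM (Equiv.swap 0 1) (Or.inl rfl) one_pos ?_
  rw [hNy, hMy, hNx, hMx, h]
  rintro (i | i | i) (j | j | j) <;> simp only [inner_E3] <;> fin_cases i <;> fin_cases j <;>
    simp <;> ring

end Cds

/-! ### Bounds in terms of the quotient graph -/

section Bounds

variable {d : ℕ} {M : PeriodicNetwork 3 d}

theorem bound_dipole_four {M : PeriodicNetwork 3 4} (h : M.HasQuotient (dipole 4)) :
    12 * √3 * M.volume ≤ M.length ^ 3 := by
  obtain ⟨p, g, hP⟩ := exists_double_presentation h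
  rw [hP.double_length]
  exact (four_vectors_bound (detIntegral_covolume M.lattice) M.volume_pos hP.linkVec_ne_zero
    edgeGens_subset hP.span_real_edgeGens).1

theorem bound_double_one_two {M : PeriodicNetwork 3 4} (h : M.HasQuotient (doubleBouquet 1 2)) :
    27 * M.volume ≤ M.length ^ 3 := by
  obtain ⟨p, g, hP⟩ := exists_double_presentation h
  rw [hP.double_length]
  exact (loop_loop_two_bound (detIntegral_covolume M.lattice) M.volume_pos hP.linkVec_ne_zero
    edgeGens_subset hP.span_real_edgeGens).1

theorem bound_dipole_five {M : PeriodicNetwork 3 5} (h : M.HasQuotient (dipole 5)) :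
    405 / 8 * M.volume ≤ M.length ^ 3 := by
  obtain ⟨p, g, hP⟩ := exists_double_presentation h
  rw [hP.double_length]
  exact (exists_perm_five_bound (detIntegral_covolume M.lattice) M.volume_pos hP.linkVec_ne_zero
    hP.linkVec_injective edgeGens_subset hP.span_real_edgeGens).1

theorem bound_double_one_three {M : PeriodicNetwork 3 5}
    (h : M.HasQuotient (doubleBouquet 1 3)) : 27 * √3 * M.volume ≤ M.length ^ 3 := by
  obtain ⟨p, g, hP⟩ := exists_double_presentation h
  rw [hP.double_length]
  exact (loop_loop_three_bound (detIntegral_covolume M.lattice) M.volume_pos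
    (hP.loopVec_ne_zero 0) (hP.loopVec_ne_zero 1) hP.linkVec_ne_zero
    hP.linkVec_injective edgeGens_subset hP.span_real_edgeGens).1

theorem bound_bouquet_three {M : PeriodicNetwork 3 6} (h : M.HasQuotient (bouquet 3)) :
    27 * M.volume ≤ M.length ^ 3 := by
  obtain ⟨p, g, hP⟩ := M.exists_presentation h
  rw [hP.single_length]
  exact (three_loops_bound (detIntegral_covolume M.lattice) M.volume_pos (fun i => (g i).2)
    hP.span_real_single).1

theorem bound_of_numVertices_le_two (hd : 7 ≤ d) (h : M.numVertices ≤ 2) :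
    405 / 8 * M.volume < M.length ^ 3 := by
  have h0 := M.numVertices_pos
  obtain h1 | h1 : M.numVertices = 1 ∨ M.numVertices = 2 := by omega
  · obtain ⟨ℓ, hℓ, hQ⟩ := M.hasQuotient_bouquet h1
    obtain ⟨p, g, hP⟩ := M.exists_presentation hQ
    have h2 := loops_bound (detIntegral_covolume M.lattice) M.volume_pos (by omega)
      hP.single_ne_zero (fun i => (g i).2) hP.span_real_single
    rw [hP.single_length]
    have h3 := M.volume_pos
    rw [volume] at h3 ⊢
    linarith
  · obtain ⟨ℓ, k, hℓ, hQ⟩ := M.hasQuotient_doubleBouquet h1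
    obtain ⟨p, g, hP⟩ := exists_double_presentation hQ
    rw [hP.double_length]
    exact large_degree_bound (detIntegral_covolume M.lattice) M.volume_pos (by omega)
      (hP.loopVec_ne_zero 0) (hP.loopVec_ne_zero 1) hP.linkVec_ne_zero hP.linkVec_injective
      (hP.loopVec_linearIndependent 0) edgeGens_subset hP.span_real_edgeGens

/-- Bouquets are always balanced and cover the even degrees; double bouquets with three links at 120
degrees cover the odd ones. -/
theorem numVertices_le_two_of_irreducible (hd : 7 ≤ d) (h : M.Irreducible) :
    M.numVertices ≤ 2 := by
  rcases Nat.even_or_odd' d with ⟨ℓ, rfl | rfl⟩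
  · obtain ⟨N, p, g, hP, -⟩ := exists_bouquet (ℓ := ℓ) (by omega)
    have h1 := h.numVertices_le hP.balanced_single
    rw [hP.numVertices_eq] at h1
    exact h1.trans (by simp)
  · obtain ⟨ℓ, rfl⟩ : ∃ m, ℓ = m + 1 := ⟨ℓ - 1, by omega⟩
    obtain ⟨N, p, g, hP, hb, -⟩ := exists_balanced_double_three (ℓ := ℓ) (by omega)
    have h1 := h.numVertices_le hb
    rw [hP.numVertices_eq] at h1
    exact h1.trans (by simp)

end Bounds

/-! ### Irreducible networks of degree at most six -/

/-- Balance enters only through one model, here the diamond network. The networks to be compared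
need not be balanced. -/
theorem irreducible_four_iff {N : PeriodicNetwork 3 4} : N.Irreducible ↔ N.numVertices = 2 := by
  obtain ⟨M, p, g, hP, hb, -⟩ := exists_dia
  have hM : M.numVertices = 2 := hP.numVertices_eq
  refine ⟨fun h => le_antisymm (hM ▸ h.numVertices_le hb)
    (two_le_numVertices (Or.inl (by norm_num)) N),
    irreducible_of_numVertices_eq_two (Or.inl (by norm_num)) hb hM⟩

theorem irreducible_five_iff {N : PeriodicNetwork 3 5} : N.Irreducible ↔ N.numVertices = 2 := by
  obtain ⟨M, p, g, hP, hb, -⟩ := exists_bnn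
  have hM : M.numVertices = 2 := hP.numVertices_eq
  refine ⟨fun h => le_antisymm (hM ▸ h.numVertices_le hb)
    (two_le_numVertices (Or.inl (by norm_num)) N),
    irreducible_of_numVertices_eq_two (Or.inl (by norm_num)) hb hM⟩

theorem irreducible_six_iff {N : PeriodicNetwork 3 6} : N.Irreducible ↔ N.numVertices = 1 := by
  obtain ⟨M, p, g, hP, -⟩ := exists_pcu
  have hM : M.numVertices = 1 := hP.numVertices_eq
  refine ⟨fun h => le_antisymm (hM ▸ h.numVertices_le hP.balanced_single)
    N.numVertices_pos,
    irreducible_of_numVertices_eq_one hP.balanced_single hM⟩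

theorem hasQuotient_four {N : PeriodicNetwork 3 4} (hN : N.Irreducible) :
    N.HasQuotient (dipole 4) ∨ N.HasQuotient (doubleBouquet 1 2) := by
  obtain ⟨ℓ, k, h, hQ⟩ := N.hasQuotient_doubleBouquet (irreducible_four_iff.1 hN)
  have hk := link_pos_of_hasQuotient hQ
  obtain ⟨rfl, rfl⟩ | ⟨rfl, rfl⟩ : ℓ = 0 ∧ k = 4 ∨ ℓ = 1 ∧ k = 2 := by omega
  · exact Or.inl hQ
  · exact Or.inr hQ

/-- Balance is needed to exclude `D_{2,1}`, whose single link cannot be balanced. -/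
theorem hasQuotient_five {N : PeriodicNetwork 3 5} (hN : N.Irreducible) (hb : N.Balanced) :
    N.HasQuotient (dipole 5) ∨ N.HasQuotient (doubleBouquet 1 3) := by
  obtain ⟨ℓ, k, h, hQ⟩ := N.hasQuotient_doubleBouquet (irreducible_five_iff.1 hN)
  obtain ⟨p, g, hP⟩ := exists_double_presentation hQ
  have hk := hP.one_lt_of_balanced hb
  obtain ⟨rfl, rfl⟩ | ⟨rfl, rfl⟩ : ℓ = 0 ∧ k = 5 ∨ ℓ = 1 ∧ k = 3 := by omega
  · exact Or.inl hQ
  · exact Or.inr hQ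

theorem hasQuotient_six {N : PeriodicNetwork 3 6} (hN : N.Irreducible) :
    N.HasQuotient (bouquet 3) := by
  obtain ⟨ℓ, h, hQ⟩ := N.hasQuotient_bouquet (irreducible_six_iff.1 hN)
  obtain rfl : ℓ = 3 := by omega
  exact hQ

/-! ### The minimizers -/

theorem exists_minimizer_dia : ∃ N₀ : PeriodicNetwork 3 4, N₀.IsDia ∧
    N₀.IsMinimizer (dipole 4) ∧ N₀.lengthQuotient = (12 * √3) ^ (1 / 3 : ℝ) ∧
      ∀ N : PeriodicNetwork 3 4, N.IsMinimizer (dipole 4) → N₀.Similar N := by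
  obtain ⟨N₀, p, g, hP, hb, hx, he⟩ := exists_dia
  have hy : loopVec N₀ p g = fun _ => ![] := by
    funext i j
    exact j.elim0
  obtain ⟨h1, h2, h3⟩ := isMinimizer_of_bound (N := N₀) (by positivity)
    (fun M hM => irreducible_four_iff.2 (numVertices_doubleBouquet hM))
    (fun M hM => bound_dipole_four hM) hP.hasQuotient_double he
  refine ⟨N₀, ⟨hP.hasQuotient_double, ?_⟩, h1, h2, fun M hM => ?_⟩
  · have := hP.hasEdgeVectors
    rw [hx, hy] at this
    exact this
  · have h4 := h3 M hM
    obtain ⟨p', g', hP'⟩ := exists_double_presentation hM.2.1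
    rw [hP'.double_length] at h4
    obtain ⟨c, hc, hG⟩ := (four_vectors_bound (detIntegral_covolume M.lattice) M.volume_pos
      hP'.linkVec_ne_zero edgeGens_subset hP'.span_real_edgeGens).2 h4
    refine hP.similar_of_gram hP' hc ?_
    rw [hx, hy]
    exact hG

theorem exists_minimizer_bnn : ∃ N₀ : PeriodicNetwork 3 5, N₀.IsBnn ∧
    N₀.IsMinimizer (doubleBouquet 1 3) ∧ N₀.lengthQuotient = (27 * √3) ^ (1 / 3 : ℝ) ∧
      ∀ N : PeriodicNetwork 3 5, N.IsMinimizer (doubleBouquet 1 3) → N₀.Similar N := by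
  obtain ⟨N₀, p, g, hP, hb, hy, hx, he⟩ := exists_bnn
  obtain ⟨h1, h2, h3⟩ := isMinimizer_of_bound (N := N₀) (by positivity)
    (fun M hM => irreducible_five_iff.2 (numVertices_doubleBouquet hM))
    (fun M hM => bound_double_one_three hM) hP.hasQuotient_double he
  refine ⟨N₀, ⟨hP.hasQuotient_double, ?_⟩, h1, h2, fun M hM => ?_⟩
  · have := hP.hasEdgeVectors
    rw [hx, hy] at this
    exact this
  · have h4 := h3 M hM
    obtain ⟨p', g', hP'⟩ := exists_double_presentation hM.2.1
    rw [hP'.double_length] at h4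
    obtain ⟨ε, hε, c, hc, hG⟩ := (loop_loop_three_bound (detIntegral_covolume M.lattice)
      M.volume_pos (hP'.loopVec_ne_zero 0) (hP'.loopVec_ne_zero 1) hP'.linkVec_ne_zero
      hP'.linkVec_injective edgeGens_subset hP'.span_real_edgeGens).2 h4
    refine hP.similar_of_gram_perm hP' (Equiv.refl _) hε hc ?_
    rw [hx, hy]
    exact hG

theorem exists_minimizer_sqp : ∃ N₀ : PeriodicNetwork 3 5, N₀.IsSqp ∧
    N₀.IsMinimizer (dipole 5) ∧ N₀.lengthQuotient = (405 / 8) ^ (1 / 3 : ℝ) ∧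
      ∀ N : PeriodicNetwork 3 5, N.IsMinimizer (dipole 5) → N₀.Similar N := by
  obtain ⟨N₀, p, g, hP, hx, he⟩ := exists_sqp
  have hy : loopVec N₀ p g = fun _ => ![] := by
    funext i j
    exact j.elim0
  obtain ⟨h1, h2, h3⟩ := isMinimizer_of_bound (N := N₀) (by positivity)
    (fun M hM => irreducible_five_iff.2 (numVertices_doubleBouquet hM))
    (fun M hM => bound_dipole_five hM) hP.hasQuotient_double he
  refine ⟨N₀, ⟨hP.hasQuotient_double, ?_⟩, h1, h2, fun M hM => ?_⟩
  · have := hP.hasEdgeVectors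
    rw [hx, hy] at this
    exact this
  · have h4 := h3 M hM
    obtain ⟨p', g', hP'⟩ := exists_double_presentation hM.2.1
    rw [hP'.double_length] at h4
    obtain ⟨σ, c, hc, hG⟩ := (exists_perm_five_bound (detIntegral_covolume M.lattice)
      M.volume_pos hP'.linkVec_ne_zero hP'.linkVec_injective edgeGens_subset
      hP'.span_real_edgeGens).2 h4
    refine hP.similar_of_gram_perm hP' σ (Or.inl rfl) hc ?_
    rw [hx, hy, one_smul]
    exact hG

theorem exists_minimizer_pcu : ∃ N₀ : PeriodicNetwork 3 6, N₀.IsPcu ∧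
    N₀.IsMinimizer (bouquet 3) ∧ N₀.lengthQuotient = 3 ∧
      ∀ N : PeriodicNetwork 3 6, N.IsMinimizer (bouquet 3) → N₀.Similar N := by
  obtain ⟨N₀, p, g, hP, hg, he⟩ := exists_pcu
  have hQ : N₀.HasQuotient (bouquet 3) := hP.hasQuotient
  obtain ⟨h1, h2, h3⟩ := isMinimizer_of_bound (N := N₀) (by positivity)
    (fun M hM => irreducible_six_iff.2 (numVertices_bouquet hM))
    (fun M hM => bound_bouquet_three hM) hQ he
  refine ⟨N₀, ⟨hQ, ?_⟩, h1, h2.trans ?_, fun M hM => ?_⟩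
  · have := hP.hasLoopVectors
    rw [hg] at this
    exact this
  · exact rpow_third_twentySeven
  · have h4 := h3 M hM
    obtain ⟨p', g', hP'⟩ := M.exists_presentation hM.2.1
    rw [hP'.single_length] at h4
    have hG := (three_loops_bound (detIntegral_covolume M.lattice) M.volume_pos
      (fun i => (g' i).2) hP'.span_real_single).2 h4
    have hpos : 0 < (∑ i, ‖(g' i : E3)‖) / 3 := by
      have := Finset.sum_pos (fun i _ => norm_pos_iff.2 (hP'.single_ne_zero i))
        (Finset.univ_nonempty (α := Fin 3))
      positivity
    refine hP.similar_of_gram_single hP' hpos fun i j => ?_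
    rw [hG, congrFun hg i, congrFun hg j]
    congr 1
    rw [inner_E3]
    fin_cases i <;> fin_cases j <;> simp

theorem exists_minimizers_cds : ∃ F : Set.Ioo (0 : ℝ) 1 → PeriodicNetwork 3 4,
    (∀ t, (F t).IsCds t ∧ (F t).IsMinimizer (doubleBouquet 1 2) ∧ (F t).lengthQuotient = 3) ∧
    (∀ N : PeriodicNetwork 3 4, N.IsMinimizer (doubleBouquet 1 2) → ∃ t, (F t).Similar N) ∧
    ∀ s t, (F s).Similar (F t) ↔ ((s : ℝ) = t ∨ (s : ℝ) = 1 - t) := by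
  choose F p g hP hy hx hΛ he using exists_cds
  have hmin := fun t => isMinimizer_of_bound (N := F t) (c := 27) (by norm_num)
    (fun M hM => irreducible_four_iff.2 (numVertices_doubleBouquet hM))
    (fun M hM => bound_double_one_two hM) (hP t).hasQuotient_double (he t)
  refine ⟨F, fun t => ⟨⟨(hP t).hasQuotient_double, ?_⟩, (hmin t).1,
    (hmin t).2.1.trans rpow_third_twentySeven⟩, fun M hM => ?_, fun s t => ⟨fun h => ?_, ?_⟩⟩
  · have := (hP t).hasEdgeVectors
    rw [hx, hy] at this
    exact this
  -- Any member of the family would do, as all attain the same bound.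
  · have h4 := (hmin ⟨1 / 2, by norm_num⟩).2.2 M hM
    obtain ⟨p', g', hP'⟩ := exists_double_presentation hM.2.1
    rw [hP'.double_length] at h4
    obtain ⟨t, ht, c, hc, hG⟩ := (loop_loop_two_bound (detIntegral_covolume M.lattice)
      M.volume_pos hP'.linkVec_ne_zero edgeGens_subset hP'.span_real_edgeGens).2 h4
    refine ⟨⟨t, ht⟩, (hP _).similar_of_gram hP' hc ?_⟩
    rw [hx, hy]
    exact hG
  · exact eq_or_eq_of_similar_cds s.2 t.2 (hP s) (hP t) (hy s) (hy t) (hx s) (hx t) (hΛ s) (hΛ t) h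
  · rintro (h | h)
    · obtain rfl : s = t := Subtype.ext h
      exact (hP s).similar_of_gram (hP s) one_pos fun i j => by rw [one_pow, one_mul]
    · exact similar_cds_symm (hP s) (hP t) (hy s) (hy t) (hx s) (hx t) h

theorem lt_lengthQuotient_of_seven_le {d : ℕ} (hd : 7 ≤ d) {N : PeriodicNetwork 3 d}
    (hN : N.Irreducible) {c : ℝ} (hc : c ∈ ({2.67, 2.73, (12 * √3) ^ (1 / 3 : ℝ), 3,
      (27 * √3) ^ (1 / 3 : ℝ), (405 / 8) ^ (1 / 3 : ℝ)} : Set ℝ)) : c < N.lengthQuotient := by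
  refine N.lt_lengthQuotient (c := 405 / 8) ?_
    (bound_of_numVertices_le_two hd (numVertices_le_two_of_irreducible hd hN))
  have h3 : √3 * √3 = 3 := sqrt_three_sq
  have h0 : 0 ≤ √3 := Real.sqrt_nonneg 3
  -- With this, `12 * √3` and `27 * √3` are at most 21.6 and 48.6, hence below `405 / 8`.
  have h4 : √3 ≤ 1.8 := by nlinarith
  simp only [Set.mem_insert_iff, Set.mem_singleton_iff] at hc
  rcases hc with rfl | rfl | rfl | rfl | rfl | rfl
  · norm_num
  · norm_num
  · rw [rpow_third_pow (by positivity)]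
    linarith
  · norm_num
  · rw [rpow_third_pow (by positivity)]
    linarith
  · rw [rpow_third_pow (by positivity)]

end PeriodicNetwork

theorem theoremA :
    -- the possible quotient graphs
    (∀ N : PeriodicNetwork 3 4, N.Irreducible →
      N.HasQuotient (dipole 4) ∨ N.HasQuotient (doubleBouquet 1 2)) ∧
    (∀ N : PeriodicNetwork 3 5, N.Irreducible → N.Balanced →
      N.HasQuotient (dipole 5) ∨ N.HasQuotient (doubleBouquet 1 3)) ∧
    (∀ N : PeriodicNetwork 3 6, N.Irreducible → N.HasQuotient (bouquet 3)) ∧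
    -- the minimal values, and uniqueness of the minimizers with quotient `D_4`, `D_5`, `D_{1,3}`, `B_3`
    (∃ N₀ : PeriodicNetwork 3 4, N₀.IsDia ∧ N₀.IsMinimizer (dipole 4) ∧
      N₀.lengthQuotient = (12 * √3) ^ (1 / 3 : ℝ) ∧
      ∀ N : PeriodicNetwork 3 4, N.IsMinimizer (dipole 4) → N₀.Similar N) ∧
    (∃ N₀ : PeriodicNetwork 3 5, N₀.IsBnn ∧ N₀.IsMinimizer (doubleBouquet 1 3) ∧
      N₀.lengthQuotient = (27 * √3) ^ (1 / 3 : ℝ) ∧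
      ∀ N : PeriodicNetwork 3 5, N.IsMinimizer (doubleBouquet 1 3) → N₀.Similar N) ∧
    (∃ N₀ : PeriodicNetwork 3 5, N₀.IsSqp ∧ N₀.IsMinimizer (dipole 5) ∧
      N₀.lengthQuotient = (405 / 8) ^ (1 / 3 : ℝ) ∧
      ∀ N : PeriodicNetwork 3 5, N.IsMinimizer (dipole 5) → N₀.Similar N) ∧
    (∃ N₀ : PeriodicNetwork 3 6, N₀.IsPcu ∧ N₀.IsMinimizer (bouquet 3) ∧
      N₀.lengthQuotient = 3 ∧
      ∀ N : PeriodicNetwork 3 6, N.IsMinimizer (bouquet 3) → N₀.Similar N) ∧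
    -- the one-parameter family of minimizers with quotient `D_{1,2}`
    (∃ F : Set.Ioo (0 : ℝ) 1 → PeriodicNetwork 3 4,
      (∀ t, (F t).IsCds t ∧ (F t).IsMinimizer (doubleBouquet 1 2) ∧ (F t).lengthQuotient = 3) ∧
      (∀ N : PeriodicNetwork 3 4, N.IsMinimizer (doubleBouquet 1 2) → ∃ t, (F t).Similar N) ∧
      ∀ s t, (F s).Similar (F t) ↔ ((s : ℝ) = t ∨ (s : ℝ) = 1 - t)) ∧
    -- degree at least `7`: larger than the values above, and than the values for degree `3`
    (∀ d : ℕ, 7 ≤ d → ∀ N : PeriodicNetwork 3 d, N.Irreducible →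
      ∀ c ∈ ({2.67, 2.73, (12 * √3) ^ (1 / 3 : ℝ), 3, (27 * √3) ^ (1 / 3 : ℝ),
        (405 / 8) ^ (1 / 3 : ℝ)} : Set ℝ), c < N.lengthQuotient) :=
  ⟨fun _ hN => PeriodicNetwork.hasQuotient_four hN,
    fun _ hN hb => PeriodicNetwork.hasQuotient_five hN hb,
    fun _ hN => PeriodicNetwork.hasQuotient_six hN,
    PeriodicNetwork.exists_minimizer_dia, PeriodicNetwork.exists_minimizer_bnn,
    PeriodicNetwork.exists_minimizer_sqp, PeriodicNetwork.exists_minimizer_pcu,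
    PeriodicNetwork.exists_minimizers_cds,
    fun _ hd _ hN _ hc => PeriodicNetwork.lt_lengthQuotient_of_seven_le hd hN hc⟩
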